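/- Let $X$ be a complex manifold (Hausdorff, second countable) of complex dimension $n$, and let $(L,h)\to X$ be a positive Hermitian holomorphic line bundle, with $h$ smooth. Let $(L^*,h^*=h^{-1})$ be the dual bundle with projection $\pi:L^*\to X$. A trivializing coordinate chart consists of a holomorphic coordinate chart $(U,z)$ of $X$ and a holomorphic frame $e_L$ of $L$ over $U$; with the dual frame $e_{L^*}$ it gives coordinates $(z,\xi)\mapsto \xi\, e_{L^*}(z)$ on $\pi^{-1}(U)$. Put $e^{\phi}=h^*(e_{L^*},e_{L^*})=h(e_L,e_L)^{-1}$ and $g_{i\bar j}=\partial_{z_i}\partial_{\bar z_j}\phi$; positivity of $(L,h)$ means that $g=(g_{i\bar j})$ is positive definite, so $g$ is the Kähler metric with Kähler form $\omega_g=\frac{\sqrt{-1}}{2}\partial\bar\partial\phi=\frac12\mathrm{Ric}(L,h)$, and $dV_g=\omega_g^n/n!$. Let $\rho(v)=1-|v|^2_{h^*}$ for $v\in L^*$, let $D=\{v\in L^*:\rho(v)>0\}$ be the disk bundle, and let $T$ be the canonical top form of $(L^*,h^*)$, i.e. the globally well-defined $(n+1,n+1)$-form on $L^*$ given in any trivializing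 coordinate chart by $$T=(\sqrt{-1})^{(n+1)^2}e^{\phi(z)}\det g(z)\; dz\wedge d\xi\wedge d\bar z\wedge d\bar\xi ,\qquad dz=dz_1\wedge\dots\wedge dz_n .$$ Let $A^2_{(n+1,0)}(D)$ be the Hilbert space of square integrable holomorphic $(n+1,0)$-forms on $D$ with inner product $(f,g)=(\sqrt{-1})^{(n+1)^2}\int_D f\wedge\bar g$. For an orthonormal basis $\{\varphi_i\}$ of it, let $K_D=(\sqrt{-1})^{(n+1)^2}\sum_i\varphi_i\wedge\overline{\varphi_i}$ be the Bergman kernel form of $D$ (restricted to the diagonal). Let $\mathcal C_X$ be the canonical line bundle of $X$ with the Hermitian metric $(\det g)^{-1}$. For $k\ge 1$, let $A^2(X,L^k\otimes\mathcal C_X)$ be the Hilbert space of square integrable holomorphic sections of $L^k\otimes\mathcal C_X$ with respect to the metric $h_k=h^k\otimes(\det g)^{-1}$ and the volume form $dV_g$. For an orthonormal basis $\{s_{k,\alpha}\}_\alpha$ of it, let $B_k=\sum_\alpha|s_{k,\alpha}|^2_{h_k}$ be the Bergman kernel function. (If one of these spaces is zero, the corresponding kernel is zero.) Then, for all choices of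 the orthonormal bases, the sums defining $K_D$ (at each point of $D$) and $B_{k+1}$, $k\ge0$ (at each point of $X$) converge, and on $D$ $$K_D=\Bigl(\sum_{k=0}^{\infty}\frac{k+1}{2^{n+1}\pi}\,(1-\rho)^k\,(B_{k+1}\circ\pi)\Bigr)\,T .$$ The series on the right converges at each point of $D$, and uniformly on every compact subset of $D$. -/

import Mathlib

open scoped Manifold ContDiff Topology TensorProduct ComplexOrder
open Bundle MeasureTheory Filter

noncomputable section

namespace DiskBundle

/-! ### Wirtinger derivatives on `ℂⁿ` -/

/-- `∂f/∂zᵢ = (∂f/∂xᵢ - √-1 ∂f/∂yᵢ)/2`. -/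
def wirtinger {n : ℕ} (i : Fin n) (f : (Fin n → ℂ) → ℂ) (z : Fin n → ℂ) : ℂ :=
  (1 / 2) * (fderiv ℝ f z (Pi.single i 1) - Complex.I * fderiv ℝ f z (Pi.single i Complex.I))

/-- `∂f/∂z̄ᵢ = (∂f/∂xᵢ + √-1 ∂f/∂yᵢ)/2`. -/
def wirtingerBar {n : ℕ} (i : Fin n) (f : (Fin n → ℂ) → ℂ) (z : Fin n → ℂ) : ℂ :=
  (1 / 2) * (fderiv ℝ f z (Pi.single i 1) + Complex.I * fderiv ℝ f z (Pi.single i Complex.I))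

/-! ### Forms of type `(m, 0)` and their wedge products with conjugates -/

section Wedge

variable {V : Type*} [AddCommGroup V] [Module ℂ V] {m : ℕ}

/-- A complex multilinear alternating form regarded as a real multilinear one. -/
def realForm (f : V [⋀^Fin m]→ₗ[ℂ] ℂ) : V [⋀^Fin m]→ₗ[ℝ] ℂ :=
  { f.toMultilinearMap.restrictScalars ℝ with
    map_eq_zero_of_eq' := fun v _ _ h hij => f.map_eq_zero_of_eq v h hij }

/-- The complex conjugate `f̄` of an `(m, 0)`-form `f`. -/
def conjForm (f : V [⋀^Fin m]→ₗ[ℂ] ℂ) : V [⋀^Fin m]→ₗ[ℝ] ℂ :=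
  Complex.conjAe.toLinearMap.compAlternatingMap (realForm f)

/-- The wedge product `f ∧ ḡ`: an alternating real `2m`-form with complex values, whose first `m`
arguments are indexed by the left and whose last `m` arguments by the right summand. -/
def wedgeConj (f g : V [⋀^Fin m]→ₗ[ℂ] ℂ) : V [⋀^Fin m ⊕ Fin m]→ₗ[ℝ] ℂ :=
  (LinearMap.mul' ℝ ℂ).compAlternatingMap ((realForm f).domCoprod (conjForm g))

end Wedge

/-! ### Orthonormal bases -/

/-- `φ` is an orthonormal basis of the space of all `f` with `mem f`, for the inner product `ip`
(linear in the first variable): the `φ i` are orthonormal elements, and `f = ∑ᵢ (f, φᵢ) φᵢ`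
in norm for each element `f`. -/
structure IsOrthonormalBasis {V : Type*} [AddCommGroup V] [Module ℂ V] (mem : V → Prop)
    (ip : V → V → ℂ) {ι : Type*} (φ : ι → V) : Prop where
  mem_basis : ∀ i, mem (φ i)
  norm_eq_one : ∀ i, ip (φ i) (φ i) = 1
  orthogonal : ∀ i j, i ≠ j → ip (φ i) (φ j) = 0
  expansion : ∀ f, mem f →
    Tendsto (fun t : Finset ι =>
      (ip (f - ∑ i ∈ t, ip f (φ i) • φ i) (f - ∑ i ∈ t, ip f (φ i) • φ i)).re) atTop (𝓝 0)

/-! ### Trivializing coordinate charts -/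

section Bundles

variable (n : ℕ) {X : Type*} [TopologicalSpace X] [ChartedSpace (Fin n → ℂ) X]
  (L : X → Type*) [TopologicalSpace (TotalSpace ℂ L)]
  [∀ x, AddCommGroup (L x)] [∀ x, Module ℂ (L x)] [∀ x, TopologicalSpace (L x)]
  [FiberBundle ℂ L]

/-- A trivializing coordinate chart: a holomorphic coordinate chart `(U, z)` of `X` together with a
holomorphic trivialization (equivalently, a holomorphic frame) of `L` over `U`. -/
structure TrivializingChart where
  chart : OpenPartialHomeomorph X (Fin n → ℂ)
  chart_mem : chart ∈ IsManifold.maximalAtlas 𝓘(ℂ, Fin n → ℂ) ω X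
  triv : Trivialization ℂ (TotalSpace.proj : TotalSpace ℂ L → X)
  triv_mem : MemTrivializationAtlas triv
  source_subset : chart.source ⊆ triv.baseSet

attribute [instance] TrivializingChart.triv_mem

/-- The total space of the dual line bundle `L^*`. -/
abbrev Dual : Type _ := TotalSpace (ℂ →L[ℂ] ℂ) (fun x : X => L x →L[ℂ] ℂ)

/-- The model with corners of the complex manifold `L^*`, of complex dimension `n + 1`. -/
abbrev dualModel := (𝓘(ℂ, Fin n → ℂ)).prod 𝓘(ℂ, ℂ →L[ℂ] ℂ)

variable {n} {L}

theorem exists_trivializingChart [IsManifold 𝓘(ℂ, Fin n → ℂ) ω X] (x : X) :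
    ∃ c : TrivializingChart n L, x ∈ c.chart.source := by
  refine ⟨⟨(chartAt (Fin n → ℂ) x).restr (trivializationAt ℂ L x).baseSet, ?_,
    trivializationAt ℂ L x, inferInstance, ?_⟩, ?_⟩
  · exact restr_mem_maximalAtlas _ (IsManifold.chart_mem_maximalAtlas x)
      (trivializationAt ℂ L x).open_baseSet
  · rw [OpenPartialHomeomorph.restr_source' _ _ (trivializationAt ℂ L x).open_baseSet]
    exact Set.inter_subset_right
  · change x ∈ ((chartAt (Fin n → ℂ) x).restr (trivializationAt ℂ L x).baseSet).source
    rw [OpenPartialHomeomorph.restr_source' _ _ (trivializationAt ℂ L x).open_baseSet]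
    exact ⟨mem_chart_source _ x, mem_baseSet_trivializationAt ℂ L x⟩

variable (n) (L) in
theorem exists_cover [IsManifold 𝓘(ℂ, Fin n → ℂ) ω X] [SecondCountableTopology X] [Nonempty X] :
    ∃ c : ℕ → TrivializingChart n L, ∀ x, ∃ j, x ∈ (c j).chart.source := by
  choose c hc using exists_trivializingChart (n := n) (L := L) (X := X)
  obtain ⟨s, hs, hcov⟩ := TopologicalSpace.countable_cover_nhds
    (fun x => (c x).chart.open_source.mem_nhds (hc x))
  have hne : s.Nonempty := by
    by_contra h
    rw [Set.not_nonempty_iff_eq_empty] at h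
    obtain ⟨x⟩ := ‹Nonempty X›
    have : x ∈ ⋃ x ∈ s, (c x).chart.source := hcov ▸ Set.mem_univ x
    simp [h] at this
  obtain ⟨f, rfl⟩ := hs.exists_eq_range hne
  refine ⟨fun j => c (f j), fun x => ?_⟩
  have : x ∈ ⋃ x ∈ Set.range f, (c x).chart.source := hcov ▸ Set.mem_univ x
  simpa using this

section Reference

variable [IsManifold 𝓘(ℂ, Fin n → ℂ) ω X] [SecondCountableTopology X] [Nonempty X]

variable (n) (L) in
/-- A countable cover of `X` by (the domains `U₀, U₁, …` of) trivializing coordinate charts. -/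
def cover : ℕ → TrivializingChart n L := (exists_cover n L).choose

open Classical in
variable (n) (L) in
/-- The least `j` with `x ∈ Uⱼ`. The sets `{x | index x = j} = Uⱼ ∖ (U₀ ∪ … ∪ Uⱼ₋₁)` form
a partition of `X` into Borel sets, each inside one trivializing coordinate chart. It is used to
integrate over `X` and over `L^*`. -/
def index (x : X) : ℕ := Nat.find ((exists_cover n L).choose_spec x)

variable (n) (L) in
/-- A trivializing coordinate chart around `x`. Pointwise quantities that do not depend on the
choice of a trivializing coordinate chart are computed in this one. -/
def refChart (x : X) : TrivializingChart n L := cover n L (index n L x)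

end Reference

/-! ### Coordinates on `X` and on `L^*` -/

section Coordinates

variable [VectorBundle ℂ ℂ L]

namespace TrivializingChart

/-- The local frame `e_L` of `L` over `U`. -/
def frame (c : TrivializingChart n L) (x : X) : L x := c.triv.symm x 1

/-- The dual local frame `e_{L^*}` of `L^*` over `U`, with `e_{L^*}(e_L) = 1`. -/
def dualFrame (c : TrivializingChart n L) (x : X) : L x →L[ℂ] ℂ :=
  c.triv.continuousLinearMapAt ℂ x

/-- The coordinate vector field `∂/∂zᵢ`, at the point with coordinates `z`. -/
def coordVector (c : TrivializingChart n L) (z : Fin n → ℂ) (i : Fin n) :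
    TangentSpace 𝓘(ℂ, Fin n → ℂ) (c.chart.symm z) :=
  mfderiv 𝓘(ℂ, Fin n → ℂ) 𝓘(ℂ, Fin n → ℂ) c.chart.symm z (Pi.single i (1 : ℂ) : Fin n → ℂ)

/-- The parametrization `(z, ξ) ↦ ξ e_{L^*}(z)` of `π⁻¹(U) ⊆ L^*`. -/
def param (c : TrivializingChart n L) (w : (Fin n → ℂ) × ℂ) : Dual L :=
  ⟨c.chart.symm w.1, w.2 • c.dualFrame (c.chart.symm w.1)⟩

/-- The coordinate functions `(z₁, …, zₙ, ξ)` on `π⁻¹(U) ⊆ L^*`; note `ξ(v) = v(e_L)`. -/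
def coordFun (c : TrivializingChart n L) (v : Dual L) : Fin (n + 1) → ℂ :=
  Fin.snoc (α := fun _ => ℂ) (c.chart v.proj) (v.snd (c.frame v.proj))

end TrivializingChart

/-- The standard complex basis of `ℂⁿ × ℂ`. -/
def stdVec (i : Fin (n + 1)) : (Fin n → ℂ) × ℂ :=
  Fin.lastCases (motive := fun _ => (Fin n → ℂ) × ℂ) (0, 1) (fun i => (Pi.single i 1, 0)) i

/-- `(n+1, 0)`-forms on `L^*`. -/
abbrev DualForm (n : ℕ) {X : Type*} [TopologicalSpace X] [ChartedSpace (Fin n → ℂ) X]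
    (L : X → Type*) [TopologicalSpace (TotalSpace ℂ L)]
    [∀ x, AddCommGroup (L x)] [∀ x, Module ℂ (L x)] [∀ x, TopologicalSpace (L x)]
    [FiberBundle ℂ L] [VectorBundle ℂ ℂ L] : Type _ :=
  ∀ v : Dual L, TangentSpace (dualModel n) v [⋀^Fin (n + 1)]→ₗ[ℂ] ℂ

namespace TrivializingChart

/-- The tangent vector of `L^*` at `ξ e_{L^*}(z)` with coordinates `u`. -/
def tangentVec (c : TrivializingChart n L) (w u : (Fin n → ℂ) × ℂ) :
    TangentSpace (dualModel n) (c.param w) :=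
  mfderiv 𝓘(ℂ, (Fin n → ℂ) × ℂ) (dualModel n) c.param w u

/-- The coefficient `b(z, ξ)` of the form `σ = b dz₁ ∧ … ∧ dzₙ ∧ dξ`. -/
def formCoeff (c : TrivializingChart n L) (σ : DualForm n L) (w : (Fin n → ℂ) × ℂ) : ℂ :=
  σ (c.param w) fun i => c.tangentVec w (stdVec i)

/-- The density of a `(2n+2)`-form `α` on `L^*` with respect to Lebesgue measure in the
coordinates `(z, ξ)`, that is, the coefficient of `dx₁ ∧ dy₁ ∧ … ∧ dxₙ₊₁ ∧ dyₙ₊₁`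
(where `xₙ₊₁ + √-1 yₙ₊₁ = ξ`), which defines the orientation. The sign comes from
`dx₁ ∧ dy₁ ∧ … ∧ dxₘ ∧ dyₘ = (-1)^{m(m-1)/2} dx₁ ∧ … ∧ dxₘ ∧ dy₁ ∧ … ∧ dyₘ`. -/
def formDensity (c : TrivializingChart n L)
    (α : ∀ v : Dual L, TangentSpace (dualModel n) v [⋀^Fin (n + 1) ⊕ Fin (n + 1)]→ₗ[ℝ] ℂ)
    (w : (Fin n → ℂ) × ℂ) : ℂ :=
  (-1) ^ ((n + 1) * n / 2) * α (c.param w)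
    (Sum.elim (fun i => c.tangentVec w (stdVec i))
      (fun i => c.tangentVec w (Complex.I • stdVec i)))

/-- The form `dz₁ ∧ … ∧ dzₙ ∧ dξ` at the point `v` of `π⁻¹(U)`. -/
def dzdξ (c : TrivializingChart n L) (v : Dual L) :
    TangentSpace (dualModel n) v [⋀^Fin (n + 1)]→ₗ[ℂ] ℂ :=
  (Matrix.detRowAlternating : (Fin (n + 1) → ℂ) [⋀^Fin (n + 1)]→ₗ[ℂ] ℂ).compLinearMap
    (mfderiv (dualModel n) 𝓘(ℂ, Fin (n + 1) → ℂ) c.coordFun v).toLinearMap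

end TrivializingChart

/-! ### Hermitian metrics on `L` and the polarized Kähler metric -/

variable (n) (L) in
/-- A (smooth) Hermitian metric on `L`. -/
structure HermitianMetric where
  form : ∀ x, L x →ₗ[ℂ] L x →ₗ⋆[ℂ] ℂ
  conj_symm : ∀ x (u v : L x), star (form x u v) = form x v u
  pos : ∀ x (u : L x), u ≠ 0 → 0 < (form x u u).re
  smooth : ∀ c : TrivializingChart n L,
    ContDiffOn ℝ ∞ (fun z => (form _ (c.frame (c.chart.symm z)) (c.frame (c.chart.symm z))).re)
      c.chart.target

namespace HermitianMetric

variable (h : HermitianMetric n L)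

/-- `h(e_L, e_L)` in the coordinates `z`. -/
def local_h (c : TrivializingChart n L) (z : Fin n → ℂ) : ℝ :=
  (h.form _ (c.frame (c.chart.symm z)) (c.frame (c.chart.symm z))).re

/-- The local weight `φ`, with `e^φ = h^*(e_{L^*}, e_{L^*}) = h(e_L, e_L)⁻¹`. -/
def weight (c : TrivializingChart n L) (z : Fin n → ℂ) : ℝ := -Real.log (h.local_h c z)

/-- The matrix `g_{i j̄} = ∂²φ/∂zᵢ∂z̄ⱼ`, so that
`(√-1/2) ∑ g_{i j̄} dzᵢ ∧ dz̄ⱼ = (√-1/2) ∂∂̄φ = ½ Ric(L, h)`. -/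
def metricMatrix (c : TrivializingChart n L) (z : Fin n → ℂ) : Matrix (Fin n) (Fin n) ℂ :=
  Matrix.of fun i j => wirtinger i (wirtingerBar j fun z' => (h.weight c z' : ℂ)) z

/-- `(L, h)` is positive: `½ Ric(L, h)` is the Kähler form `ω_g` of a Kähler metric `g` on `X`,
i.e. `(L, h)` polarizes `(X, g)`. -/
def IsPositive : Prop :=
  ∀ c : TrivializingChart n L, ∀ z ∈ c.chart.target, (h.metricMatrix c z).PosDef

/-- `det g` in the coordinates `z`. The volume form `dV_g = ω_gⁿ/n!` is `det g` times
Lebesgue measure. -/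
def detg (c : TrivializingChart n L) (z : Fin n → ℂ) : ℝ := (h.metricMatrix c z).det.re

/-- The squared norm `|v|²_{h^*}` of `v ∈ L^*` for the dual metric. -/
def dualNormSq (v : Dual L) : ℝ :=
  sSup {r : ℝ | ∃ l : L v.proj, h.form v.proj l l = 1 ∧ r = ‖v.snd l‖ ^ 2}

/-- `ρ(v) = 1 - |v|²_{h^*}`. -/
def rho (v : Dual L) : ℝ := 1 - h.dualNormSq v

/-- The disk bundle `D = {v ∈ L^* : ρ(v) > 0}`. -/
def disk : Set (Dual L) := {v | 0 < h.rho v}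

variable [IsManifold 𝓘(ℂ, Fin n → ℂ) ω X] [SecondCountableTopology X] [Nonempty X]

/-- The canonical top form
`T = √-1^{(n+1)²} e^φ det g dz ∧ dξ ∧ dz̄ ∧ dξ̄` of `(L^*, h^*)`. -/
def canonicalTopForm (v : Dual L) :
    TangentSpace (dualModel n) v [⋀^Fin (n + 1) ⊕ Fin (n + 1)]→ₗ[ℝ] ℂ :=
  let c := refChart n L v.proj
  (Complex.I ^ ((n + 1) ^ 2) * Real.exp (h.weight c (c.chart v.proj)) *
    h.detg c (c.chart v.proj)) • wedgeConj (c.dzdξ v) (c.dzdξ v)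

/-! ### The Bergman space and the Bergman kernel form of `D` -/

/-- The part of `D` over `{x | index x = j}`, in the `j`-th coordinates `(z, ξ)`. -/
def diskPiece (j : ℕ) : Set ((Fin n → ℂ) × ℂ) :=
  {w | w.1 ∈ (cover n L j).chart.target ∧ index n L ((cover n L j).chart.symm w.1) = j ∧
    (cover n L j).param w ∈ h.disk}

/-- The integral over `D` of a `(2n+2)`-form. -/
def diskIntegral
    (α : ∀ v : Dual L, TangentSpace (dualModel n) v [⋀^Fin (n + 1) ⊕ Fin (n + 1)]→ₗ[ℝ] ℂ) : ℂ :=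
  ∑' j : ℕ, ∫ w in h.diskPiece j, (cover n L j).formDensity α w

/-- `(f, g) = √-1^{(n+1)²} ∫_D f ∧ ḡ`. -/
def formInner (f g : DualForm n L) : ℂ :=
  Complex.I ^ ((n + 1) ^ 2) * h.diskIntegral fun v => wedgeConj (f v) (g v)

/-- `σ` belongs to the Bergman space `A²_{(n+1,0)}(D)`: it is holomorphic and square integrable
on `D`. (Its values outside `D` play no role.) -/
structure MemBergmanForm (σ : DualForm n L) : Prop where
  holomorphic : ∀ c : TrivializingChart n L,
    AnalyticOnNhd ℂ (c.formCoeff σ) {w | w.1 ∈ c.chart.target ∧ c.param w ∈ h.disk}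
  square_integrable :
    ∑' j : ℕ, ∫⁻ w in h.diskPiece j,
      ‖(cover n L j).formDensity (fun v => wedgeConj (σ v) (σ v)) w‖ₑ < ⊤

/-- `φ` is an orthonormal basis of `A²_{(n+1,0)}(D)`. -/
def IsFormBasis {ι : Type*} (φ : ι → DualForm n L) : Prop :=
  IsOrthonormalBasis h.MemBergmanForm h.formInner φ

end HermitianMetric

/-- The Bergman kernel form `K_D = √-1^{(n+1)²} ∑ φᵢ ∧ φ̄ᵢ` computed from the orthonormal basis
`φ`, at the point `v` and evaluated on `2n+2` tangent vectors. -/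
def bergmanKernelForm {ι : Type*} (φ : ι → DualForm n L) (v : Dual L)
    (u : Fin (n + 1) ⊕ Fin (n + 1) → TangentSpace (dualModel n) v) : ℂ :=
  Complex.I ^ ((n + 1) ^ 2) * ∑' i, wedgeConj (φ i v) (φ i v) u

/-! ### The Bergman space and the Bergman kernel function of `Lᵏ ⊗ K_X` -/

/-- The fiber at `x` of `Lᵏ ⊗ C_X`, where `C_X` is the canonical line bundle. -/
abbrev Twisted (n : ℕ) {X : Type*} [TopologicalSpace X] [ChartedSpace (Fin n → ℂ) X]
    (L : X → Type*) [∀ x, AddCommGroup (L x)] [∀ x, Module ℂ (L x)] (k : ℕ) (x : X) : Type _ :=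
  (⨂[ℂ]^k (L x)) ⊗[ℂ] (TangentSpace 𝓘(ℂ, Fin n → ℂ) x [⋀^Fin n]→ₗ[ℂ] ℂ)

namespace TrivializingChart

/-- The linear functional on the fiber of `Lᵏ ⊗ C_X` that sends
`(l₁ ⊗ … ⊗ lₖ) ⊗ η` to `e_{L^*}(l₁) ⋯ e_{L^*}(lₖ) η(∂/∂z₁, …, ∂/∂zₙ)`. -/
def coframe (c : TrivializingChart n L) (k : ℕ) (z : Fin n → ℂ) :
    Twisted n L k (c.chart.symm z) →ₗ[ℂ] ℂ :=
  LinearMap.mul' ℂ ℂ ∘ₗ TensorProduct.map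
    (PiTensorProduct.lift ((MultilinearMap.mkPiAlgebra ℂ (Fin k) ℂ).compLinearMap
      fun _ => (c.dualFrame (c.chart.symm z)).toLinearMap))
    { toFun := fun η => η (c.coordVector z)
      map_add' := fun _ _ => rfl
      map_smul' := fun _ _ => rfl }

/-- The coefficient `γ(z)` of a section `s = γ e_L^{⊗ k} ⊗ dz₁ ∧ … ∧ dzₙ`. -/
def sectionCoeff (c : TrivializingChart n L) {k : ℕ} (s : ∀ x, Twisted n L k x)
    (z : Fin n → ℂ) : ℂ :=
  c.coframe k z (s (c.chart.symm z))

end TrivializingChart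

namespace HermitianMetric

variable (h : HermitianMetric n L)

/-- The pointwise inner product `h_k(s, s')` for the metric `h_k = hᵏ ⊗ (det g)⁻¹` on `Lᵏ ⊗ C_X`,
in the coordinates `z`. -/
def fiberInner (c : TrivializingChart n L) {k : ℕ} (s s' : ∀ x, Twisted n L k x)
    (z : Fin n → ℂ) : ℂ :=
  c.sectionCoeff s z * star (c.sectionCoeff s' z) * (h.local_h c z) ^ k * (h.detg c z : ℂ)⁻¹

variable [IsManifold 𝓘(ℂ, Fin n → ℂ) ω X] [SecondCountableTopology X] [Nonempty X]

variable (n) (L) in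
/-- The set `{x | index x = j}` in the `j`-th coordinates `z`. -/
def basePiece (j : ℕ) : Set (Fin n → ℂ) :=
  {z | z ∈ (cover n L j).chart.target ∧ index n L ((cover n L j).chart.symm z) = j}

/-- `(s, s') = ∫_X h_k(s, s') dV_g`. -/
def sectionInner {k : ℕ} (s s' : ∀ x, Twisted n L k x) : ℂ :=
  ∑' j : ℕ, ∫ z in basePiece n L j,
    h.fiberInner (cover n L j) s s' z * h.detg (cover n L j) z

/-- `s` belongs to the Bergman space `A²(X, Lᵏ ⊗ C_X)` of square integrable holomorphic
sections. -/
structure MemBergmanSection {k : ℕ} (s : ∀ x, Twisted n L k x) : Prop where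
  holomorphic : ∀ c : TrivializingChart n L,
    AnalyticOnNhd ℂ (c.sectionCoeff s) c.chart.target
  square_integrable :
    ∑' j : ℕ, ∫⁻ z in basePiece n L j,
      ‖h.fiberInner (cover n L j) s s z * h.detg (cover n L j) z‖ₑ < ⊤

/-- `s` is an orthonormal basis of `A²(X, Lᵏ ⊗ C_X)`. -/
def IsSectionBasis {k : ℕ} {κ : Type*} (s : κ → ∀ x, Twisted n L k x) : Prop :=
  IsOrthonormalBasis h.MemBergmanSection h.sectionInner s

/-- The squared pointwise norm `|s|²_{h_k}`. -/
def fiberNormSq {k : ℕ} (s : ∀ x, Twisted n L k x) (x : X) : ℝ :=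
  (h.fiberInner (refChart n L x) s s ((refChart n L x).chart x)).re

/-- The Bergman kernel function `B_k = ∑ |s_{k,α}|²_{h_k}` of `Lᵏ ⊗ C_X`, computed from the
orthonormal basis `s`. -/
def bergmanFunction {k : ℕ} {κ : Type*} (s : κ → ∀ x, Twisted n L k x) (x : X) : ℝ :=
  ∑' α, h.fiberNormSq (s α) x

end HermitianMetric

end Coordinates

end Bundles

end DiskBundle

end

/-! In a trivializing chart an (n+1,0)-form on D is b(z,ξ) dz ∧ dξ. Expand b = Σ γ_k(z) ξ^k along
the fibre. A change of frame multiplies ξ by a holomorphic factor r, and dξ contributes one more r,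
so γ_k is the coefficient of a section s_k of L^{k+1} ⊗ C_X. The fibre of D is the disc of radius R
with R² = h(e_L, e_L). There the monomials are orthogonal and ξ^k has squared norm π/(k+1) ·
R^{2k+2}. The power R^{2k+2} is exactly the weight of the metric of L^{k+1}, while det g in the
volume form cancels det g in the metric of C_X. Together with the factor 2^{n+1} that compares the
form with Lebesgue measure, this gives ‖σ‖² = Σ ‖s_k‖² / c_k, where c_k is the constant of the
theorem (`fiberWeight`). Morally, A²(D) is the Hilbert sum of the rescaled spaces A²(X, L^{k+1} ⊗
C_X).

The kernels are compared through their extremal property. For every orthonormal basis, Σ |ev φ_i|²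
is the least C with |ev f|² ≤ C ‖f‖² (`IsHermitianForm.sum_le_of_bound`,
`IsHermitianForm.isReproducingBound_tsum`). Fibrewise Taylor coefficients
(`exists_sections_of_form`) and Cauchy–Schwarz show that the series is such a bound
(`isReproducingBound_series`). Test forms that are polynomial in ξ (`exists_form_of_sections`) show
that every such bound dominates its partial sums (`HermitianMetric.sum_le_of_bound`). Thus Bessel's
inequality suffices for general forms: neither the full Parseval identity nor completeness of the
spaces enters.

That some finite bound exists is the mean value inequality on polydiscs (`exists_bound_formEval`).
Applied at a point farther out in the same fibre, it also yields the geometric domination behind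
uniform convergence (`exists_summable_bound`). -/

noncomputable section

namespace DiskBundle

set_option linter.unusedSectionVars false

/-! ### Holomorphic coordinates on the dual bundle. -/

section Geometry

variable {n : ℕ} {X : Type*} [TopologicalSpace X] [ChartedSpace (Fin n → ℂ) X]
  {L : X → Type*} [TopologicalSpace (TotalSpace ℂ L)]
  [∀ x, AddCommGroup (L x)] [∀ x, Module ℂ (L x)] [∀ x, TopologicalSpace (L x)]
  [FiberBundle ℂ L] [VectorBundle ℂ ℂ L]

namespace TrivializingChart

/-- The dual bundle is the bundle of homomorphisms from L to the trivial line bundle; this instance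
lets its trivializations be built from those of L. -/
instance memTrivializationAtlas_trivial : MemTrivializationAtlas (Trivial.trivialization X ℂ) :=
  ⟨Set.mem_singleton _⟩

variable [∀ x, IsTopologicalAddGroup (L x)] [∀ x, ContinuousSMul ℂ (L x)]

/-- The trivialization of the dual bundle given by the dual frame. -/
def dualTriv (c : TrivializingChart n L) :
    Trivialization (ℂ →L[ℂ] ℂ) (TotalSpace.proj : Dual L → X) :=
  Trivialization.continuousLinearMap (RingHom.id ℂ) c.triv (Trivial.trivialization X ℂ)

instance (c : TrivializingChart n L) : MemTrivializationAtlas c.dualTriv := by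
  unfold dualTriv
  infer_instance

lemma dualTriv_apply (c : TrivializingChart n L) (v : Dual L) :
    c.dualTriv v = (v.proj, v.snd.comp (c.triv.symmL ℂ v.proj)) := by
  rw [dualTriv, Trivialization.continuousLinearMap_apply]
  simp

lemma dualTriv_baseSet (c : TrivializingChart n L) : c.dualTriv.baseSet = c.triv.baseSet := by
  simp [dualTriv, Trivialization.baseSet_continuousLinearMap]

lemma dualTriv_symm_apply (c : TrivializingChart n L) (x : X) (f : ℂ →L[ℂ] ℂ) :
    c.dualTriv.toOpenPartialHomeomorph.symm (x, f) =
      ⟨x, f.comp (c.dualFrame x)⟩ := by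
  trans (⟨x, ((Trivial.trivialization X ℂ).symmL ℂ x).comp
    (f.comp (c.triv.continuousLinearMapAt ℂ x))⟩ : Dual L)
  · exact Pretrivialization.continuousLinearMap_symm_apply (RingHom.id ℂ) (e₁ := c.triv)
      (e₂ := Trivial.trivialization X ℂ) (x, f)
  · simp [dualFrame]

variable [IsManifold 𝓘(ℂ, Fin n → ℂ) ω X] [ContMDiffVectorBundle ω ℂ L 𝓘(ℂ, Fin n → ℂ)]

instance contMDiffVectorBundle_dual :
    ContMDiffVectorBundle ω (ℂ →L[ℂ] ℂ) (fun x : X => L x →L[ℂ] ℂ) 𝓘(ℂ, Fin n → ℂ) :=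
  ContMDiffVectorBundle.continuousLinearMap (E₂ := Bundle.Trivial X ℂ)

/-- The coordinates `(z, ξ)` on `π⁻¹(U)`, as a pair. -/
def coordPair (c : TrivializingChart n L) (v : Dual L) : (Fin n → ℂ) × ℂ :=
  (c.chart v.proj, v.snd (c.frame v.proj))

lemma dualFrame_frame (c : TrivializingChart n L) {x : X} (hx : x ∈ c.chart.source) :
    c.dualFrame x (c.frame x) = 1 := by
  have := c.triv.continuousLinearMapAt_symmL (R := ℂ) (c.source_subset hx) 1
  rwa [c.triv.symmL_apply (c.source_subset hx)] at this

lemma dualFrame_smul_frame (c : TrivializingChart n L) {x : X} (hx : x ∈ c.chart.source) (l : L x) :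
    c.dualFrame x l • c.frame x = l := by
  have := c.triv.symmL_continuousLinearMapAt (R := ℂ) (c.source_subset hx) l
  rw [← this, c.triv.symmL_continuousLinearMapAt (c.source_subset hx)]
  conv_rhs => rw [← this, ← mul_one (c.triv.continuousLinearMapAt ℂ x l), ← smul_eq_mul, map_smul,
    c.triv.symmL_apply (c.source_subset hx)]
  rfl

lemma coordPair_param (c : TrivializingChart n L) {w : (Fin n → ℂ) × ℂ} (hw : w.1 ∈ c.chart.target) :
    c.coordPair (c.param w) = w := by
  ext1
  · simp [coordPair, param, c.chart.right_inv hw]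
  · change w.2 * c.dualFrame (c.chart.symm w.1) (c.frame (c.chart.symm w.1)) = w.2
    rw [c.dualFrame_frame (c.chart.map_target hw), mul_one]

lemma param_coordPair (c : TrivializingChart n L) {v : Dual L} (hv : v.proj ∈ c.chart.source) :
    c.param (c.coordPair v) = v := by
  obtain ⟨x, f⟩ := v
  have hv' : x ∈ c.chart.source := hv
  have hf : f (c.frame x) • c.dualFrame x = f := by
    ext l
    conv_rhs => rw [← c.dualFrame_smul_frame hv' l, map_smul]
    exact mul_comm _ _
  -- The base point is generalized to `y` because the fibre component depends on it; the equality of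
  -- base points can then be substituted.
  have key : ∀ y, y = x → (⟨y, f (c.frame x) • c.dualFrame y⟩ : Dual L) = ⟨x, f⟩ := by
    rintro y rfl
    rw [hf]
  exact key _ (c.chart.left_inv hv')

lemma param_proj_mem (c : TrivializingChart n L) {w : (Fin n → ℂ) × ℂ} (hw : w.1 ∈ c.chart.target) :
    (c.param w).proj ∈ c.chart.source := c.chart.map_target hw

/-- Up to the chart of the base, `param` is the inverse of `dualTriv` applied to the functional ξ ·
id. -/
lemma contMDiffOn_param (c : TrivializingChart n L) :
    ContMDiffOn 𝓘(ℂ, (Fin n → ℂ) × ℂ) (dualModel n) ω c.param (c.chart.target ×ˢ Set.univ) := by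
  have h1 := Trivialization.contMDiffOn_symm (n := ω) (IB := 𝓘(ℂ, Fin n → ℂ)) c.dualTriv
  have hz : ContMDiffOn 𝓘(ℂ, (Fin n → ℂ) × ℂ) 𝓘(ℂ, Fin n → ℂ) ω
      (fun w : (Fin n → ℂ) × ℂ => c.chart.symm w.1) (c.chart.target ×ˢ Set.univ) :=
    (contMDiffOn_symm_of_mem_maximalAtlas c.chart_mem).comp
      (contDiff_fst.contMDiff.contMDiffOn) (fun w hw => hw.1)
  have hξ : ContMDiffOn 𝓘(ℂ, (Fin n → ℂ) × ℂ) 𝓘(ℂ, ℂ →L[ℂ] ℂ) ω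
      (fun w : (Fin n → ℂ) × ℂ => w.2 • ContinuousLinearMap.id ℂ ℂ) (c.chart.target ×ˢ Set.univ) :=
    (contDiff_snd.smul contDiff_const).contMDiff.contMDiffOn
  have h2 := hz.prodMk hξ
  refine (h1.comp h2 ?_).congr ?_
  · intro w hw
    simp only [Set.mem_preimage, Trivialization.mem_target, dualTriv_baseSet]
    exact c.source_subset (c.chart.map_target hw.1)
  · intro w hw
    simp only [Function.comp, dualTriv_symm_apply, param]
    congr 1

lemma contMDiffAt_coordPair (c : TrivializingChart n L) {v : Dual L}
    (hv : v.proj ∈ c.chart.source) :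
    ContMDiffAt (dualModel n) 𝓘(ℂ, (Fin n → ℂ) × ℂ) ω c.coordPair v := by
  have hs : v ∈ c.dualTriv.source := by
    rw [Trivialization.mem_source, dualTriv_baseSet]; exact c.source_subset hv
  have h1 := ((Trivialization.contMDiffOn (n := ω) (IB := 𝓘(ℂ, Fin n → ℂ)) c.dualTriv) v hs).contMDiffAt
    (c.dualTriv.open_source.mem_nhds hs)
  have hz : ContMDiffAt (dualModel n) 𝓘(ℂ, Fin n → ℂ) ω (fun v : Dual L => c.chart v.proj) v :=
    ContMDiffAt.comp v ((contMDiffOn_of_mem_maximalAtlas c.chart_mem).contMDiffAt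
      (c.chart.open_source.mem_nhds hv)) (Bundle.contMDiffAt_proj _)
  have hev : ContMDiff 𝓘(ℂ, ℂ →L[ℂ] ℂ) 𝓘(ℂ, ℂ) ω (fun f : ℂ →L[ℂ] ℂ => f 1) :=
    (ContinuousLinearMap.apply ℂ ℂ (1 : ℂ)).contDiff.contMDiff
  have hξ : ContMDiffAt (dualModel n) 𝓘(ℂ, ℂ) ω (fun v : Dual L => (c.dualTriv v).2 1) v :=
    hev.contMDiffAt.comp v h1.snd
  refine (hz.prodMk_space hξ).congr_of_eventuallyEq ?_
  filter_upwards [c.dualTriv.open_source.mem_nhds hs] with u hu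
  rw [Trivialization.mem_source, dualTriv_baseSet] at hu
  simp [coordPair, dualTriv_apply, frame, c.triv.symmL_apply hu]

lemma contMDiffAt_coordFun (c : TrivializingChart n L) {v : Dual L}
    (hv : v.proj ∈ c.chart.source) :
    ContMDiffAt (dualModel n) 𝓘(ℂ, Fin (n + 1) → ℂ) ω c.coordFun v := by
  have h := c.contMDiffAt_coordPair hv
  have hl : ContDiff ℂ ω (fun w : (Fin n → ℂ) × ℂ => (Fin.snoc (α := fun _ => ℂ) w.1 w.2 : Fin (n + 1) → ℂ)) := by
    rw [contDiff_pi]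
    intro i
    induction i using Fin.lastCases with
    | last => simpa using contDiff_snd
    | cast i =>
      simp only [Fin.snoc_castSucc]
      fun_prop
  exact hl.contMDiff.contMDiffAt.comp v h

lemma contMDiffAt_param (c : TrivializingChart n L) {w : (Fin n → ℂ) × ℂ}
    (hw : w.1 ∈ c.chart.target) :
    ContMDiffAt 𝓘(ℂ, (Fin n → ℂ) × ℂ) (dualModel n) ω c.param w :=
  c.contMDiffOn_param.contMDiffAt ((c.chart.open_target.prod isOpen_univ).mem_nhds ⟨hw, trivial⟩)

end TrivializingChart
end Geometry

/-! ### Alternating forms of top degree -/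

section TopForms

/-- Appending a last coordinate, as a linear equivalence. -/
def snocLinearEquiv (n : ℕ) : ((Fin n → ℂ) × ℂ) ≃ₗ[ℂ] (Fin (n + 1) → ℂ) where
  toFun w := Fin.snoc (α := fun _ => ℂ) w.1 w.2
  map_add' w w' := by
    ext i
    induction i using Fin.lastCases <;> simp
  map_smul' a w := by
    ext i
    induction i using Fin.lastCases <;> simp
  invFun f := (Fin.init f, f (Fin.last n))
  left_inv w := by ext1 <;> simp
  right_inv f := by simp

/-- The vectors `stdVec i` as a basis. -/
def stdBasis (n : ℕ) : Module.Basis (Fin (n + 1)) ℂ ((Fin n → ℂ) × ℂ) :=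
  Module.Basis.ofEquivFun (snocLinearEquiv n)

lemma snocLinearEquiv_stdVec {n : ℕ} (i : Fin (n + 1)) :
    snocLinearEquiv n (stdVec i) = Pi.single i 1 := by
  change Fin.snoc (α := fun _ => ℂ) (stdVec i).1 (stdVec i).2 = _
  ext j
  induction i using Fin.lastCases with
  | last =>
    induction j using Fin.lastCases with
    | last => simp [stdVec]
    | cast j => simp [stdVec, (Fin.castSucc_lt_last j).ne]
  | cast i =>
    induction j using Fin.lastCases with
    | last => simp [stdVec, (Fin.castSucc_lt_last i).ne']
    | cast j =>
      simp only [stdVec, Fin.lastCases_castSucc, Fin.snoc_castSucc, Pi.single_apply]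
      simp

lemma stdBasis_apply {n : ℕ} (i : Fin (n + 1)) : stdBasis n i = stdVec i := by
  rw [stdBasis, Module.Basis.coe_ofEquivFun, LinearEquiv.symm_apply_eq, snocLinearEquiv_stdVec]
  

/-- Top-degree alternating forms on W are multiples of the determinant of a basis. The map `f` into
another space is there so that the derivative of a parametrization can take its place. -/
lemma alternating_comp_det {m : ℕ} {V W : Type*} [AddCommGroup V] [Module ℂ V] [AddCommGroup W]
    [Module ℂ W] (M : V [⋀^Fin m]→ₗ[ℂ] ℂ) (b : Module.Basis (Fin m) ℂ W) (f : W →ₗ[ℂ] V)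
    (A : W →ₗ[ℂ] W) : M (fun i => f (A (b i))) = M (fun i => f (b i)) * LinearMap.det A := by
  have h := (M.compLinearMap f).eq_smul_basis_det b
  have h1 := congrArg (fun N => N (A ∘ b)) h
  simp only [AlternatingMap.smul_apply, Module.Basis.det_comp, Module.Basis.det_self, mul_one,
    smul_eq_mul] at h1
  exact h1

lemma det_blockTriangular {n : ℕ} (A : ((Fin n → ℂ) × ℂ) →ₗ[ℂ] ((Fin n → ℂ) × ℂ))
    (B : (Fin n → ℂ) →ₗ[ℂ] (Fin n → ℂ)) (l : (Fin n → ℂ) → ℂ) (g : ℂ)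
    (h : ∀ u, A u = (B u.1, l u.1 + g * u.2)) : LinearMap.det A = LinearMap.det B * g := by
  let e := (Pi.basisFun ℂ (Fin n)).prod (Module.Basis.singleton Unit ℂ)
  rw [← LinearMap.det_toMatrix e, ← LinearMap.det_toMatrix (Pi.basisFun ℂ (Fin n))]
  have : LinearMap.toMatrix e e A = Matrix.fromBlocks
      (LinearMap.toMatrix (Pi.basisFun ℂ (Fin n)) (Pi.basisFun ℂ (Fin n)) B) 0
      (Matrix.of fun _ j => l (Pi.single j 1)) (Matrix.of fun _ _ => g) := by
    -- `l` is not assumed linear. The matrix reads it at basis vectors and, in the last column, at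
    -- 0.
    have h0 : l 0 = 0 := by
      have := h 0
      simpa using (congrArg Prod.snd this).symm
    ext i j
    rcases i with i | i <;> rcases j with j | j <;>
      simp [LinearMap.toMatrix_apply, e, h, h0]
  rw [this, Matrix.det_fromBlocks_zero₁₂, Matrix.det_unique (n := Unit)]
  rfl

end TopForms

/-! ### Transition functions between trivializing charts. -/

section Geometry

variable {n : ℕ} {X : Type*} [TopologicalSpace X] [ChartedSpace (Fin n → ℂ) X]
  {L : X → Type*} [TopologicalSpace (TotalSpace ℂ L)]
  [∀ x, AddCommGroup (L x)] [∀ x, Module ℂ (L x)] [∀ x, TopologicalSpace (L x)]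
  [FiberBundle ℂ L] [VectorBundle ℂ ℂ L]

variable [∀ x, IsTopologicalAddGroup (L x)] [∀ x, ContinuousSMul ℂ (L x)]
  [IsManifold 𝓘(ℂ, Fin n → ℂ) ω X] [ContMDiffVectorBundle ω ℂ L 𝓘(ℂ, Fin n → ℂ)]

namespace TrivializingChart

/-- The coordinates of `U ∩ U'` in `U`. -/
def overlap (c c' : TrivializingChart n L) : Set (Fin n → ℂ) :=
  {z | z ∈ c.chart.target ∧ c.chart.symm z ∈ c'.chart.source}

/-- The change of coordinates on the base. -/
def baseTrans (c c' : TrivializingChart n L) (z : Fin n → ℂ) : Fin n → ℂ :=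
  c'.chart (c.chart.symm z)

/-- The quotient of the dual frames. -/
def ratio (c c' : TrivializingChart n L) (z : Fin n → ℂ) : ℂ :=
  c.dualFrame (c.chart.symm z) (c'.frame (c.chart.symm z))

/-- The change of coordinates on the total space. -/
def totalTrans (c c' : TrivializingChart n L) (w : (Fin n → ℂ) × ℂ) : (Fin n → ℂ) × ℂ :=
  c'.coordPair (c.param w)

lemma totalTrans_eq (c c' : TrivializingChart n L) (w : (Fin n → ℂ) × ℂ) :
    c.totalTrans c' w = (c.baseTrans c' w.1, w.2 * c.ratio c' w.1) := rfl

lemma isOpen_overlap (c c' : TrivializingChart n L) : IsOpen (c.overlap c') :=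
  c.chart.isOpen_inter_preimage_symm c'.chart.open_source

lemma baseTrans_mem (c c' : TrivializingChart n L) {z : Fin n → ℂ} (hz : z ∈ c.overlap c') :
    c.baseTrans c' z ∈ c'.overlap c := by
  refine ⟨c'.chart.map_source hz.2, ?_⟩
  rw [baseTrans, c'.chart.left_inv hz.2]
  exact c.chart.map_target hz.1

lemma symm_baseTrans (c c' : TrivializingChart n L) {z : Fin n → ℂ} (hz : z ∈ c.overlap c') :
    c'.chart.symm (c.baseTrans c' z) = c.chart.symm z := c'.chart.left_inv hz.2

lemma dualFrame_eq (c c' : TrivializingChart n L) {z : Fin n → ℂ} (hz : z ∈ c.overlap c') :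
    c.dualFrame (c.chart.symm z) = c.ratio c' z • c'.dualFrame (c.chart.symm z) := by
  ext l
  conv_lhs => rw [← c'.dualFrame_smul_frame hz.2 l, map_smul]
  exact mul_comm _ _

lemma frame_eq (c c' : TrivializingChart n L) {z : Fin n → ℂ} (hz : z ∈ c.overlap c') :
    c'.frame (c.chart.symm z) = c.ratio c' z • c.frame (c.chart.symm z) :=
  (c.dualFrame_smul_frame (c.chart.map_target hz.1) _).symm

lemma ratio_ne_zero (c c' : TrivializingChart n L) {z : Fin n → ℂ} (hz : z ∈ c.overlap c') :
    c.ratio c' z ≠ 0 := by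
  intro h
  have h1 := c.frame_eq c' hz
  rw [h, zero_smul] at h1
  simpa [h1] using c'.dualFrame_frame hz.2

lemma contDiffAt_totalTrans (c c' : TrivializingChart n L) {w : (Fin n → ℂ) × ℂ}
    (hw : w.1 ∈ c.overlap c') : ContDiffAt ℂ ω (c.totalTrans c') w :=
  (ContMDiffAt.comp w (c'.contMDiffAt_coordPair hw.2) (c.contMDiffAt_param hw.1)).contDiffAt

lemma param_totalTrans (c c' : TrivializingChart n L) {w : (Fin n → ℂ) × ℂ}
    (hw : w.1 ∈ c.overlap c') : c'.param (c.totalTrans c' w) = c.param w :=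
  c'.param_coordPair hw.2

lemma contDiffAt_baseTrans (c c' : TrivializingChart n L) {z : Fin n → ℂ}
    (hz : z ∈ c.overlap c') : ContDiffAt ℂ ω (c.baseTrans c') z :=
  (c.contDiffAt_totalTrans c' (w := (z, 0)) hz).fst.comp z
    (f := fun z => (z, (0 : ℂ))) (contDiffAt_id.prodMk contDiffAt_const)

lemma contDiffAt_ratio (c c' : TrivializingChart n L) {z : Fin n → ℂ}
    (hz : z ∈ c.overlap c') : ContDiffAt ℂ ω (c.ratio c') z := by
  have := (c.contDiffAt_totalTrans c' (w := (z, 1)) hz).snd.comp z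
    (f := fun z => (z, (1 : ℂ))) (contDiffAt_id.prodMk contDiffAt_const)
  simpa [Function.comp_def, totalTrans_eq] using this

/-- The complex Jacobian determinant of the change of coordinates on the base. -/
def jac (c c' : TrivializingChart n L) (z : Fin n → ℂ) : ℂ :=
  LinearMap.det (fderiv ℂ (c.baseTrans c') z : (Fin n → ℂ) →ₗ[ℂ] (Fin n → ℂ))

/-- The transition map is (z, ξ) ↦ (F(z), ξ r(z)), whose derivative is block triangular. The extra
factor `ratio` is what turns the k-th Taylor coefficient into a section of the power k + 1. -/
lemma det_fderiv_totalTrans (c c' : TrivializingChart n L) {w : (Fin n → ℂ) × ℂ}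
    (hw : w.1 ∈ c.overlap c') :
    LinearMap.det (fderiv ℂ (c.totalTrans c') w : ((Fin n → ℂ) × ℂ) →ₗ[ℂ] ((Fin n → ℂ) × ℂ)) =
      c.jac c' w.1 * c.ratio c' w.1 := by
  have hb := ((c.contDiffAt_baseTrans c' hw).differentiableAt (by simp)).hasFDerivAt.comp w
    (hasFDerivAt_fst (𝕜 := ℂ))
  have hr := ((c.contDiffAt_ratio c' hw).differentiableAt (by simp)).hasFDerivAt.comp w
    (hasFDerivAt_fst (𝕜 := ℂ))
  have ht := hb.prodMk ((hasFDerivAt_snd (𝕜 := ℂ) (p := w)).mul hr)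
  have ht' : fderiv ℂ (c.totalTrans c') w = _ := ht.fderiv
  rw [ht']
  refine det_blockTriangular _ _ (fun a => w.2 * fderiv ℂ (c.ratio c') w.1 a) _ fun u => ?_
  ext1
  · simp
  · simp [mul_comm]

/-- Chain rule for `c'.param ∘ c.totalTrans c'`. Both sides are read in the model space, since their
base points agree only up to a proved equality. -/
lemma tangentVec_eq (c c' : TrivializingChart n L) {w : (Fin n → ℂ) × ℂ}
    (hw : w.1 ∈ c.overlap c') (u : (Fin n → ℂ) × ℂ) :
    (c.tangentVec w u : (Fin n → ℂ) × (ℂ →L[ℂ] ℂ)) =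
      c'.tangentVec (c.totalTrans c' w) (fderiv ℂ (c.totalTrans c') w u) := by
  have he : c.param =ᶠ[𝓝 w] c'.param ∘ c.totalTrans c' := by
    filter_upwards [((c.isOpen_overlap c').preimage continuous_fst).mem_nhds hw] with w' hw'
    exact (c.param_totalTrans c' hw').symm
  have h1 : MDifferentiableAt 𝓘(ℂ, (Fin n → ℂ) × ℂ) (dualModel n) c'.param (c.totalTrans c' w) :=
    (c'.contMDiffAt_param (c.baseTrans_mem c' hw).1).mdifferentiableAt (by simp)
  have h2 : MDifferentiableAt 𝓘(ℂ, (Fin n → ℂ) × ℂ) 𝓘(ℂ, (Fin n → ℂ) × ℂ) (c.totalTrans c') w :=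
    ((c.contDiffAt_totalTrans c' hw).differentiableAt (by simp)).mdifferentiableAt
  have h3 := mfderiv_comp w h1 h2
  have h4 := he.mfderiv_eq (I := 𝓘(ℂ, (Fin n → ℂ) × ℂ)) (I' := dualModel n)
  rw [tangentVec, tangentVec, ← mfderiv_eq_fderiv]
  rw [h3] at h4
  exact congrArg (fun f : ((Fin n → ℂ) × ℂ) →L[ℂ] ((Fin n → ℂ) × (ℂ →L[ℂ] ℂ)) => f u) h4

lemma form_congr (σ : DualForm n L) {v v' : Dual L} (h : v = v')
    (u : Fin (n + 1) → (Fin n → ℂ) × (ℂ →L[ℂ] ℂ)) : σ v u = σ v' u := by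
  subst h; rfl

/-- The transformation law of the coefficient of an `(n+1, 0)`-form. -/
lemma formCoeff_eq (c c' : TrivializingChart n L) (σ : DualForm n L) {w : (Fin n → ℂ) × ℂ}
    (hw : w.1 ∈ c.overlap c') :
    c.formCoeff σ w =
      c'.formCoeff σ (c.totalTrans c' w) * (c.jac c' w.1 * c.ratio c' w.1) := by
  rw [← det_fderiv_totalTrans c c' hw]
  have h := alternating_comp_det (σ (c'.param (c.totalTrans c' w))) (stdBasis n)
    (mfderiv 𝓘(ℂ, (Fin n → ℂ) × ℂ) (dualModel n) c'.param (c.totalTrans c' w)).toLinearMap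
    (fderiv ℂ (c.totalTrans c') w : ((Fin n → ℂ) × ℂ) →ₗ[ℂ] ((Fin n → ℂ) × ℂ))
  simp only [stdBasis_apply] at h
  refine Eq.trans ?_ h
  rw [formCoeff]
  refine (form_congr σ (c.param_totalTrans c' hw).symm _).trans ?_
  congr 1
  ext1 i
  exact c.tangentVec_eq c' hw _

end TrivializingChart
end Geometry

/-! ### Coefficients of forms and of sections, and gluing. -/

section Geometry

variable {n : ℕ} {X : Type*} [TopologicalSpace X] [ChartedSpace (Fin n → ℂ) X]
  {L : X → Type*} [TopologicalSpace (TotalSpace ℂ L)]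
  [∀ x, AddCommGroup (L x)] [∀ x, Module ℂ (L x)] [∀ x, TopologicalSpace (L x)]
  [FiberBundle ℂ L] [VectorBundle ℂ ℂ L]

variable [∀ x, IsTopologicalAddGroup (L x)] [∀ x, ContinuousSMul ℂ (L x)]
  [IsManifold 𝓘(ℂ, Fin n → ℂ) ω X] [ContMDiffVectorBundle ω ℂ L 𝓘(ℂ, Fin n → ℂ)]

lemma finrank_prod_dual (n : ℕ) :
    Module.finrank ℂ ((Fin n → ℂ) × (ℂ →L[ℂ] ℂ)) = n + 1 := by
  have e : (ℂ →L[ℂ] ℂ) ≃ₗ[ℂ] ℂ := (ContinuousLinearMap.toSpanSingletonCLE (𝕜 := ℂ) (E := ℂ)).symm.toLinearEquiv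
  rw [Module.finrank_prod, e.finrank_eq]
  simp

lemma single_eq_one {m : ℕ} (i : Fin m) : (Pi.single i 1 : Fin m → ℂ) = (1 : Matrix _ _ ℂ) i := by
  ext j
  rw [Matrix.one_apply, Pi.single_apply]
  simp [eq_comm]

namespace TrivializingChart

/-- Near `w`, the composite `coordFun ∘ param` is the linear map `snocLinearEquiv`, which is its own
derivative. -/
lemma mfderiv_coordFun_tangentVec (c : TrivializingChart n L) {w : (Fin n → ℂ) × ℂ}
    (hw : w.1 ∈ c.chart.target) (u : (Fin n → ℂ) × ℂ) :
    mfderiv (dualModel n) 𝓘(ℂ, Fin (n + 1) → ℂ) c.coordFun (c.param w) (c.tangentVec w u) =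
      (snocLinearEquiv n u : Fin (n + 1) → ℂ) := by
  have he : c.coordFun ∘ c.param =ᶠ[𝓝 w] (snocLinearEquiv n).toContinuousLinearEquiv := by
    filter_upwards [(c.chart.open_target.preimage continuous_fst).mem_nhds hw] with w' hw'
    exact congrArg (snocLinearEquiv n) (c.coordPair_param hw')
  have h1 : MDifferentiableAt (dualModel n) 𝓘(ℂ, Fin (n + 1) → ℂ) c.coordFun (c.param w) :=
    (c.contMDiffAt_coordFun (c.param_proj_mem hw)).mdifferentiableAt (by simp)
  have h2 : MDifferentiableAt 𝓘(ℂ, (Fin n → ℂ) × ℂ) (dualModel n) c.param w :=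
    (c.contMDiffAt_param hw).mdifferentiableAt (by simp)
  have h3 := mfderiv_comp w h1 h2
  have h4 := he.mfderiv_eq (I := 𝓘(ℂ, (Fin n → ℂ) × ℂ)) (I' := 𝓘(ℂ, Fin (n + 1) → ℂ))
  rw [h3, mfderiv_eq_fderiv, ContinuousLinearEquiv.fderiv] at h4
  exact congrArg (fun f : ((Fin n → ℂ) × ℂ) →L[ℂ] (Fin (n + 1) → ℂ) => f u) h4

lemma dzdξ_tangentVec (c : TrivializingChart n L) {w : (Fin n → ℂ) × ℂ}
    (hw : w.1 ∈ c.chart.target) :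
    c.dzdξ (c.param w) (fun i => c.tangentVec w (stdVec i)) = 1 := by
  have : (fun i => mfderiv (dualModel n) 𝓘(ℂ, Fin (n + 1) → ℂ) c.coordFun (c.param w)
      (c.tangentVec w (stdVec i)) : Fin (n + 1) → Fin (n + 1) → ℂ) = (1 : Matrix _ _ ℂ) :=
    funext fun i => (c.mfderiv_coordFun_tangentVec hw _).trans
      ((snocLinearEquiv_stdVec i).trans (single_eq_one i))
  change Matrix.detRowAlternating (fun i => mfderiv (dualModel n) 𝓘(ℂ, Fin (n + 1) → ℂ) c.coordFun
    (c.param w) (c.tangentVec w (stdVec i))) = (1 : ℂ)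
  refine (congrArg _ this).trans ?_
  exact Matrix.det_one

lemma form_eq_smul (c : TrivializingChart n L) (σ : DualForm n L) {w : (Fin n → ℂ) × ℂ}
    (hw : w.1 ∈ c.chart.target) :
    σ (c.param w) = c.formCoeff σ w • c.dzdξ (c.param w) := by
  -- An alternating form vanishes on dependent vectors, whereas `dzdξ` takes the value 1 on these.
  -- They therefore form a basis, on which a top-degree form is determined by one value.
  have hli : LinearIndependent ℂ
      (fun i => c.tangentVec w (stdVec i) : Fin (n + 1) → (Fin n → ℂ) × (ℂ →L[ℂ] ℂ)) := by
    by_contra h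
    have h0 := AlternatingMap.map_linearDependent (c.dzdξ (c.param w)) _ h
    rw [c.dzdξ_tangentVec hw] at h0
    exact one_ne_zero h0
  let b : Module.Basis (Fin (n + 1)) ℂ ((Fin n → ℂ) × (ℂ →L[ℂ] ℂ)) :=
    basisOfLinearIndependentOfCardEqFinrank hli (by rw [finrank_prod_dual, Fintype.card_fin])
  have hb : (b : Fin (n + 1) → (Fin n → ℂ) × (ℂ →L[ℂ] ℂ)) = fun i => c.tangentVec w (stdVec i) :=
    coe_basisOfLinearIndependentOfCardEqFinrank _ _
  let D : ((Fin n → ℂ) × (ℂ →L[ℂ] ℂ)) [⋀^Fin (n + 1)]→ₗ[ℂ] ℂ := c.dzdξ (c.param w)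
  have hD : D b = 1 := by rw [hb]; exact c.dzdξ_tangentVec hw
  let S : ((Fin n → ℂ) × (ℂ →L[ℂ] ℂ)) [⋀^Fin (n + 1)]→ₗ[ℂ] ℂ := σ (c.param w)
  have hS : S b = c.formCoeff σ w := by rw [hb]; rfl
  have h1 := AlternatingMap.eq_smul_basis_det (e := b) D
  have h2 := AlternatingMap.eq_smul_basis_det (e := b) S
  rw [hD, one_smul] at h1
  rw [hS, ← h1] at h2
  exact h2

/-- A family of coefficients with the transformation law of `(n+1, 0)`-forms comes from a form. -/
lemma exists_form (β : TrivializingChart n L → (Fin n → ℂ) × ℂ → ℂ)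
    (hβ : ∀ c c' : TrivializingChart n L, ∀ w : (Fin n → ℂ) × ℂ, w.1 ∈ c.overlap c' →
      β c w = β c' (c.totalTrans c' w) * (c.jac c' w.1 * c.ratio c' w.1)) :
    ∃ σ : DualForm n L, ∀ c : TrivializingChart n L, ∀ w : (Fin n → ℂ) × ℂ,
      w.1 ∈ c.chart.target → c.formCoeff σ w = β c w := by
  choose r hr using exists_trivializingChart (n := n) (L := L) (X := X)
  -- The form is defined point by point in one chosen chart over each base point. The transformation
  -- law then gives the right coefficient in every chart, so no regularity of the choice is needed.
  refine ⟨fun v => β (r v.proj) ((r v.proj).coordPair v) • (r v.proj).dzdξ v, fun c w hw => ?_⟩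
  set σ : DualForm n L := fun v => β (r v.proj) ((r v.proj).coordPair v) • (r v.proj).dzdξ v with hσ
  have hm : w.1 ∈ c.overlap (r (c.param w).proj) := ⟨hw, hr _⟩
  rw [c.formCoeff_eq _ σ hm, hβ c _ w hm]
  congr 1
  set c' := r (c.param w).proj with hc'
  have hm' := (c.baseTrans_mem c' hm).1
  have hp := c.param_totalTrans c' hm
  have hd := c'.dzdξ_tangentVec (w := c.totalTrans c' w) hm'
  have e : σ (c'.param (c.totalTrans c' w)) =
      β c' (c.totalTrans c' w) • c'.dzdξ (c'.param (c.totalTrans c' w)) := by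
    have : r (c'.param (c.totalTrans c' w)).proj = c' := by rw [hp]
    rw [hσ]
    simp only [this]
    rw [c'.coordPair_param hm']
  rw [formCoeff, e, AlternatingMap.smul_apply, hd, smul_eq_mul, mul_one]

/-! ### Sections of `Lᵏ ⊗ C_X` -/

/-- The functional on the fiber of `Lᵏ ⊗ C_X` given by a functional on the fiber of `L` and
tangent vectors. -/
def coframeOf (k : ℕ) {x : X} (f : L x →L[ℂ] ℂ) (V : Fin n → Fin n → ℂ) : Twisted n L k x →ₗ[ℂ] ℂ :=
  LinearMap.mul' ℂ ℂ ∘ₗ TensorProduct.map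
    (PiTensorProduct.lift ((MultilinearMap.mkPiAlgebra ℂ (Fin k) ℂ).compLinearMap
      fun _ => f.toLinearMap))
    { toFun := fun η => η V
      map_add' := fun _ _ => rfl
      map_smul' := fun _ _ => rfl }

lemma coframe_eq (c : TrivializingChart n L) (k : ℕ) (z : Fin n → ℂ) :
    c.coframe k z = coframeOf k (c.dualFrame (c.chart.symm z)) (c.coordVector z) := rfl

lemma coframeOf_tmul (k : ℕ) {x : X} (f : L x →L[ℂ] ℂ) (V : Fin n → Fin n → ℂ) (l : Fin k → L x)
    (η : TangentSpace 𝓘(ℂ, Fin n → ℂ) x [⋀^Fin n]→ₗ[ℂ] ℂ) :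
    coframeOf k f V (PiTensorProduct.tprod ℂ l ⊗ₜ[ℂ] η) = (∏ i, f (l i)) * η V := by
  simp [coframeOf]

lemma coframeOf_smul (k : ℕ) {x : X} (f : L x →L[ℂ] ℂ) (V V' : Fin n → Fin n → ℂ) (a d : ℂ)
    (h : ∀ η : (Fin n → ℂ) [⋀^Fin n]→ₗ[ℂ] ℂ, η V = η V' * d) (t : Twisted n L k x) :
    coframeOf k (a • f) V t = coframeOf k f V' t * (a ^ k * d) := by
  have : coframeOf k (a • f) V = (a ^ k * d) • coframeOf (L := L) (x := x) k f V' := by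
    -- Both functionals are determined by pure tensors, where each of the k factors of L contributes
    -- `a` and the canonical factor contributes `d`.
    ext l η
    simp only [LinearMap.compMultilinearMap_apply, TensorProduct.AlgebraTensorModule.curry_apply,
      LinearMap.restrictScalars_self, TensorProduct.curry_apply, LinearMap.smul_apply]
    rw [coframeOf_tmul, coframeOf_tmul]
    have : η V = η V' * d := h η
    rw [this]
    simp only [smul_apply, smul_eq_mul, Finset.prod_mul_distrib,
      Finset.prod_const, Finset.card_univ, Fintype.card_fin]
    ring
  rw [this, LinearMap.smul_apply, smul_eq_mul, mul_comm]

lemma coordVector_eq (c c' : TrivializingChart n L) {z : Fin n → ℂ} (hz : z ∈ c.overlap c')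
    (i : Fin n) : (c.coordVector z i : Fin n → ℂ) =
      mfderiv 𝓘(ℂ, Fin n → ℂ) 𝓘(ℂ, Fin n → ℂ) c'.chart.symm (c.baseTrans c' z)
        (fderiv ℂ (c.baseTrans c') z (Pi.single i 1)) := by
  have he : c.chart.symm =ᶠ[𝓝 z] c'.chart.symm ∘ c.baseTrans c' := by
    filter_upwards [(c.isOpen_overlap c').mem_nhds hz] with w hw
    exact (c.symm_baseTrans c' hw).symm
  have h1 : MDifferentiableAt 𝓘(ℂ, Fin n → ℂ) 𝓘(ℂ, Fin n → ℂ) c'.chart.symm (c.baseTrans c' z) :=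
    ((contMDiffOn_symm_of_mem_maximalAtlas c'.chart_mem).contMDiffAt
      (c'.chart.open_target.mem_nhds (c.baseTrans_mem c' hz).1)).mdifferentiableAt (by simp)
  have h2 : MDifferentiableAt 𝓘(ℂ, Fin n → ℂ) 𝓘(ℂ, Fin n → ℂ) (c.baseTrans c') z :=
    ((c.contDiffAt_baseTrans c' hz).differentiableAt (by simp)).mdifferentiableAt
  have h3 := mfderiv_comp z h1 h2
  have h4 := he.mfderiv_eq (I := 𝓘(ℂ, Fin n → ℂ)) (I' := 𝓘(ℂ, Fin n → ℂ))
  rw [h3, mfderiv_eq_fderiv] at h4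
  exact congrArg (fun f : (Fin n → ℂ) →L[ℂ] (Fin n → ℂ) => f (Pi.single i 1)) h4

lemma alternating_coordVector (c c' : TrivializingChart n L) {z : Fin n → ℂ}
    (hz : z ∈ c.overlap c') (η : (Fin n → ℂ) [⋀^Fin n]→ₗ[ℂ] ℂ) :
    η (c.coordVector z) = η (c'.coordVector (c.baseTrans c' z)) * c.jac c' z := by
  have h := alternating_comp_det η (Pi.basisFun ℂ (Fin n))
    (mfderiv 𝓘(ℂ, Fin n → ℂ) 𝓘(ℂ, Fin n → ℂ) c'.chart.symm (c.baseTrans c' z)).toLinearMap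
    (fderiv ℂ (c.baseTrans c') z : (Fin n → ℂ) →ₗ[ℂ] (Fin n → ℂ))
  simp only [Pi.basisFun_apply] at h
  refine Eq.trans ?_ h
  congr 1
  ext1 i
  exact c.coordVector_eq c' hz i

/-- The transformation law of the coefficient of a section of `Lᵏ ⊗ C_X`. -/
lemma sectionCoeff_eq (c c' : TrivializingChart n L) {k : ℕ} (s : ∀ x, Twisted n L k x)
    {z : Fin n → ℂ} (hz : z ∈ c.overlap c') :
    c.sectionCoeff s z =
      c'.sectionCoeff s (c.baseTrans c' z) * (c.ratio c' z ^ k * c.jac c' z) := by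
  -- Only the base point at which `s` and the dual frame are taken is moved; the coordinate vectors
  -- live in the fixed model space.
  have key : ∀ x, c.chart.symm z = x →
      coframeOf k (c'.dualFrame x) (c'.coordVector (c.baseTrans c' z)) (s x) =
      coframeOf k (c'.dualFrame (c.chart.symm z)) (c'.coordVector (c.baseTrans c' z))
        (s (c.chart.symm z)) := by
    rintro x rfl; rfl
  rw [sectionCoeff, sectionCoeff, coframe_eq, coframe_eq, key _ (c.symm_baseTrans c' hz).symm,
    c.dualFrame_eq c' hz]
  exact coframeOf_smul k _ _ _ _ _ (c.alternating_coordVector c' hz) _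

lemma exists_coframe_eq_one (c : TrivializingChart n L) (k : ℕ) {z : Fin n → ℂ}
    (hz : z ∈ c.chart.target) : ∃ t, c.coframe k z t = 1 := by
  let A : (Fin n → ℂ) →L[ℂ] (Fin n → ℂ) :=
    mfderiv 𝓘(ℂ, Fin n → ℂ) 𝓘(ℂ, Fin n → ℂ) c.chart (c.chart.symm z)
  have hA : ∀ i, A (c.coordVector z i) = Pi.single i (1 : ℂ) := by
    intro i
    have he : c.chart ∘ c.chart.symm =ᶠ[𝓝 z] id := by
      filter_upwards [c.chart.open_target.mem_nhds hz] with w hw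
      exact c.chart.right_inv hw
    have h1 : MDifferentiableAt 𝓘(ℂ, Fin n → ℂ) 𝓘(ℂ, Fin n → ℂ) c.chart (c.chart.symm z) :=
      ((contMDiffOn_of_mem_maximalAtlas c.chart_mem).contMDiffAt
        (c.chart.open_source.mem_nhds (c.chart.map_target hz))).mdifferentiableAt (by simp)
    have h2 : MDifferentiableAt 𝓘(ℂ, Fin n → ℂ) 𝓘(ℂ, Fin n → ℂ) c.chart.symm z :=
      ((contMDiffOn_symm_of_mem_maximalAtlas c.chart_mem).contMDiffAt
        (c.chart.open_target.mem_nhds hz)).mdifferentiableAt (by simp)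
    have h3 := mfderiv_comp z h1 h2
    have h4 := he.mfderiv_eq (I := 𝓘(ℂ, Fin n → ℂ)) (I' := 𝓘(ℂ, Fin n → ℂ))
    rw [h3, mfderiv_id] at h4
    exact congrArg (fun f : (Fin n → ℂ) →L[ℂ] (Fin n → ℂ) => f (Pi.single i 1)) h4
  let η : (Fin n → ℂ) [⋀^Fin n]→ₗ[ℂ] ℂ := Matrix.detRowAlternating.compLinearMap A.toLinearMap
  -- The witness is the local frame e_L^{⊗k} ⊗ dz₁ ∧ … ∧ dzₙ, with dz built from the derivative of
  -- the chart.
  refine ⟨PiTensorProduct.tprod ℂ (fun _ => c.frame (c.chart.symm z)) ⊗ₜ[ℂ] η, ?_⟩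
  have hη : η (c.coordVector z) = 1 := by
    have : (fun i => A (c.coordVector z i)) = (1 : Matrix (Fin n) (Fin n) ℂ) :=
      funext fun i => (hA i).trans (single_eq_one i)
    change Matrix.detRowAlternating (fun i => A (c.coordVector z i)) = (1 : ℂ)
    rw [this]
    exact Matrix.det_one
  refine (coframeOf_tmul k (c.dualFrame (c.chart.symm z)) (c.coordVector z) _ _).trans ?_
  rw [c.dualFrame_frame (c.chart.map_target hz), Finset.prod_const_one, one_mul]
  exact hη

/-- A family of coefficients with the transformation law of sections of `Lᵏ ⊗ C_X` comes from a
section. -/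
lemma exists_section (k : ℕ) (γ : TrivializingChart n L → (Fin n → ℂ) → ℂ)
    (hγ : ∀ c c' : TrivializingChart n L, ∀ z ∈ c.overlap c',
      γ c z = γ c' (c.baseTrans c' z) * (c.ratio c' z ^ k * c.jac c' z)) :
    ∃ s : ∀ x, Twisted n L k x, ∀ c : TrivializingChart n L, ∀ z ∈ c.chart.target,
      c.sectionCoeff s z = γ c z := by
  choose r hr using exists_trivializingChart (n := n) (L := L) (X := X)
  -- The vectors `t x` play the role of local frames: scaling them by γ prescribes the coefficient
  -- in the chosen chart, and the transformation law covers the others.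
  have ht : ∀ x, ∃ t : Twisted n L k x,
      coframeOf k ((r x).dualFrame x) ((r x).coordVector ((r x).chart x)) t = 1 := by
    intro x
    have key : ∀ y, (r x).chart.symm ((r x).chart x) = y → ∃ t : Twisted n L k y,
        coframeOf k ((r x).dualFrame y) ((r x).coordVector ((r x).chart x)) t = 1 := by
      rintro y rfl
      exact (r x).exists_coframe_eq_one k ((r x).chart.map_source (hr x))
    exact key x ((r x).chart.left_inv (hr x))
  choose t ht using ht
  refine ⟨fun x => γ (r x) ((r x).chart x) • t x, fun c z hz => ?_⟩
  have hm : z ∈ c.overlap (r (c.chart.symm z)) := ⟨hz, hr _⟩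
  rw [sectionCoeff, map_smul, hγ c _ z hm, smul_eq_mul, baseTrans]
  congr 1
  rw [coframe_eq, c.dualFrame_eq _ hm,
    coframeOf_smul k _ _ _ _ _ (c.alternating_coordVector _ hm), baseTrans, ht, one_mul]

end TrivializingChart
end Geometry

/-! ### Wedge products with conjugates -/

section WedgeValue

variable {V : Type*} [AddCommGroup V] [Module ℂ V] {m : ℕ}

lemma wedgeConj_apply (f g : V [⋀^Fin m]→ₗ[ℂ] ℂ) (v : Fin m ⊕ Fin m → V) :
    wedgeConj f g v = ∑ q : Equiv.Perm.ModSumCongr (Fin m) (Fin m),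
      LinearMap.mul' ℝ ℂ (AlternatingMap.domCoprod.summand (realForm f) (conjForm g) q v) := by
  rw [← map_sum]
  change LinearMap.mul' ℝ ℂ ((realForm f).domCoprod (conjForm g) v) = _
  congr 1
  have := congrArg (fun M => M v) (AlternatingMap.domCoprod_coe (realForm f) (conjForm g))
  simp

/-- The exterior product is taken over ℝ, so complex scalars cannot be moved through it directly.
They are pulled out of each summand, after the two factors have been multiplied in ℂ. -/
lemma wedgeConj_smul (f g : V [⋀^Fin m]→ₗ[ℂ] ℂ) (a b : ℂ) :
    wedgeConj (a • f) (b • g) = (a * star b) • wedgeConj f g := by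
  ext v
  rw [AlternatingMap.smul_apply, wedgeConj_apply, wedgeConj_apply, Finset.smul_sum]
  refine Finset.sum_congr rfl fun q _ => ?_
  induction q using Quotient.inductionOn' with
  | h σ =>
    have hf : ∀ u, realForm (a • f) u = a * realForm f u := fun _ => rfl
    have hg : ∀ u, conjForm (b • g) u = star b * conjForm g u := by
      intro u
      change (starRingEnd ℂ) (b * g u) = _
      rw [map_mul]
      rfl
    simp only [AlternatingMap.domCoprod.summand_mk'', Units.smul_def]
    change LinearMap.mul' ℝ ℂ ((Equiv.Perm.sign σ : ℤ) •
        (realForm (a • f) (fun i => v (σ (Sum.inl i))) ⊗ₜ[ℝ]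
          conjForm (b • g) (fun i => v (σ (Sum.inr i))))) =
      (a * star b) * LinearMap.mul' ℝ ℂ ((Equiv.Perm.sign σ : ℤ) •
        (realForm f (fun i => v (σ (Sum.inl i))) ⊗ₜ[ℝ] conjForm g (fun i => v (σ (Sum.inr i)))))
    rw [map_zsmul, map_zsmul, LinearMap.mul'_apply, LinearMap.mul'_apply, hf, hg, zsmul_eq_mul,
      zsmul_eq_mul]
    ring

/-- Both factors are alternatizations of a product of coordinate functions, conjugated in the second
one. The exterior product of alternatizations is the alternatization of the tensor product, which
here is a determinant of size 2m. -/
lemma wedgeConj_det (A : V →ₗ[ℂ] (Fin m → ℂ)) (v : Fin m ⊕ Fin m → V) :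
    wedgeConj ((Matrix.detRowAlternating : (Fin m → ℂ) [⋀^Fin m]→ₗ[ℂ] ℂ).compLinearMap A)
      ((Matrix.detRowAlternating : (Fin m → ℂ) [⋀^Fin m]→ₗ[ℂ] ℂ).compLinearMap A) v =
      Matrix.det (Matrix.of fun p q => Sum.elim (fun i => A (v p) i) (fun i => star (A (v p) i)) q) := by
  let P : MultilinearMap ℝ (fun _ : Fin m => V) ℂ := 
    (MultilinearMap.mkPiAlgebra ℝ (Fin m) ℂ).compLinearMap
      fun i => ((LinearMap.proj i ∘ₗ A).restrictScalars ℝ)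
  let Q : MultilinearMap ℝ (fun _ : Fin m => V) ℂ := 
    (MultilinearMap.mkPiAlgebra ℝ (Fin m) ℂ).compLinearMap
      fun i => Complex.conjAe.toLinearMap ∘ₗ ((LinearMap.proj i ∘ₗ A).restrictScalars ℝ)
  have hP : realForm ((Matrix.detRowAlternating : (Fin m → ℂ) [⋀^Fin m]→ₗ[ℂ] ℂ).compLinearMap A) =
      MultilinearMap.alternatization P := by
    ext u
    change Matrix.det (Matrix.of fun i => A (u i)) = _
    rw [MultilinearMap.alternatization_apply, Matrix.det_apply]
    refine Finset.sum_congr rfl fun σ _ => ?_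
    simp [P]
  have hQ : conjForm ((Matrix.detRowAlternating : (Fin m → ℂ) [⋀^Fin m]→ₗ[ℂ] ℂ).compLinearMap A) =
      MultilinearMap.alternatization Q := by
    ext u
    change (starRingEnd ℂ) (Matrix.det (Matrix.of fun i => A (u i))) = _
    rw [MultilinearMap.alternatization_apply, Matrix.det_apply, map_sum]
    refine Finset.sum_congr rfl fun σ _ => ?_
    simp [Q, Units.smul_def]
  rw [wedgeConj, hP, hQ, ← MultilinearMap.domCoprod_alternization]
  change LinearMap.mul' ℝ ℂ (MultilinearMap.alternatization (P.domCoprod Q) v) = _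
  rw [MultilinearMap.alternatization_apply, Matrix.det_apply, map_sum]
  refine Finset.sum_congr rfl fun σ _ => ?_
  rw [Units.smul_def, Units.smul_def, map_zsmul]
  congr 1
  simp [P, Q, Fintype.prod_sum_type]

/-- The determinant has the blocks 1, 1 above i, -i; its Schur complement is -2i times the identity.
-/
lemma wedgeConj_det_basis (A : V →ₗ[ℂ] (Fin m → ℂ)) (e : Fin m → V)
    (he : ∀ i, A (e i) = Pi.single i 1) :
    wedgeConj ((Matrix.detRowAlternating : (Fin m → ℂ) [⋀^Fin m]→ₗ[ℂ] ℂ).compLinearMap A)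
      ((Matrix.detRowAlternating : (Fin m → ℂ) [⋀^Fin m]→ₗ[ℂ] ℂ).compLinearMap A)
      (Sum.elim e fun i => Complex.I • e i) = (-2 * Complex.I) ^ m := by
  rw [wedgeConj_det]
  have : (Matrix.of fun p q => Sum.elim
      (fun i => A (Sum.elim e (fun i => Complex.I • e i) p) i)
      (fun i => star (A (Sum.elim e (fun i => Complex.I • e i) p) i)) q) =
      Matrix.fromBlocks (1 : Matrix (Fin m) (Fin m) ℂ) 1 (Complex.I • 1) (-Complex.I • 1) := by
    ext p q
    rcases p with p | p <;> rcases q with q | q <;>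
      simp only [Matrix.of_apply, Sum.elim_inl, Sum.elim_inr, map_smul, he, Matrix.fromBlocks_apply₁₁,
        Matrix.fromBlocks_apply₁₂, Matrix.fromBlocks_apply₂₁, Matrix.fromBlocks_apply₂₂,
        Pi.single_apply, Matrix.one_apply, Pi.smul_apply, Matrix.smul_apply, smul_eq_mul] <;>
      by_cases h : p = q <;> simp [h, eq_comm]
  rw [this, Matrix.det_fromBlocks_one₁₁, Matrix.mul_one, ← sub_smul, Matrix.det_smul,
    Matrix.det_one, Fintype.card_fin]
  ring

/-- The power of √-1 in the inner product, the sign of the orientation and the factor (-2i)^{n+1} of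
`wedgeConj_det_basis` combine to 2^{n+1}. This is the origin of that power of 2 in the theorem. -/
lemma sign_identity (n : ℕ) :
    Complex.I ^ ((n + 1) ^ 2) * ((-1) ^ ((n + 1) * n / 2) * (-2 * Complex.I) ^ (n + 1)) =
      2 ^ (n + 1) := by
  have key : Complex.I ^ ((n + 1) ^ 2) * ((-1) ^ ((n + 1) * n / 2) * (-Complex.I) ^ (n + 1)) = 1 := by
    induction n with
    | zero => simp
    | succ n ih =>
      have h1 : (n + 1 + 1) * (n + 1) / 2 = (n + 1) * n / 2 + (n + 1) := by
        rw [show (n + 1 + 1) * (n + 1) = (n + 1) * n + (n + 1) * 2 by ring,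
          Nat.add_mul_div_right _ _ (by norm_num)]
      rw [h1, show (n + 1 + 1) ^ 2 = (n + 1) ^ 2 + (2 * (n + 1) + 1) by ring, pow_add,
        pow_add (-1 : ℂ), pow_succ (-Complex.I) (n + 1), pow_succ Complex.I (2 * (n + 1)), pow_mul,
        Complex.I_sq]
      have h2 : ((-1 : ℂ) ^ (n + 1)) * (-1) ^ (n + 1) = 1 := by
        rw [← mul_pow]; simp
      calc _ = (Complex.I ^ ((n + 1) ^ 2) * ((-1) ^ ((n + 1) * n / 2) * (-Complex.I) ^ (n + 1))) *
            (((-1 : ℂ) ^ (n + 1)) * (-1) ^ (n + 1)) * (Complex.I * (-Complex.I)) := by ring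
        _ = 1 := by rw [ih, h2]; simp
  calc _ = 2 ^ (n + 1) * (Complex.I ^ ((n + 1) ^ 2) *
        ((-1) ^ ((n + 1) * n / 2) * (-Complex.I) ^ (n + 1))) := by
        rw [show (-2 * Complex.I : ℂ) = 2 * (-Complex.I) by ring, mul_pow]; ring
    _ = _ := by rw [key, mul_one]

end WedgeValue

/-! ### Densities of forms and the disk bundle in coordinates. -/

section Geometry

variable {n : ℕ} {X : Type*} [TopologicalSpace X] [ChartedSpace (Fin n → ℂ) X]
  {L : X → Type*} [TopologicalSpace (TotalSpace ℂ L)]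
  [∀ x, AddCommGroup (L x)] [∀ x, Module ℂ (L x)] [∀ x, TopologicalSpace (L x)]
  [FiberBundle ℂ L] [VectorBundle ℂ ℂ L]

variable [∀ x, IsTopologicalAddGroup (L x)] [∀ x, ContinuousSMul ℂ (L x)]
  [IsManifold 𝓘(ℂ, Fin n → ℂ) ω X] [ContMDiffVectorBundle ω ℂ L 𝓘(ℂ, Fin n → ℂ)]

namespace TrivializingChart

/-- The density of `f ∧ ḡ` in terms of the coefficients of `f` and `g`. -/
lemma formDensity_wedgeConj (c : TrivializingChart n L) (σ τ : DualForm n L)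
    {w : (Fin n → ℂ) × ℂ} (hw : w.1 ∈ c.chart.target) :
    Complex.I ^ ((n + 1) ^ 2) * c.formDensity (fun v => wedgeConj (σ v) (τ v)) w =
      2 ^ (n + 1) * (c.formCoeff σ w * star (c.formCoeff τ w)) := by
  let D : ((Fin n → ℂ) × (ℂ →L[ℂ] ℂ)) [⋀^Fin (n + 1)]→ₗ[ℂ] ℂ := c.dzdξ (c.param w)
  let T : Fin (n + 1) → (Fin n → ℂ) × (ℂ →L[ℂ] ℂ) := fun i => c.tangentVec w (stdVec i)
  have h2 : wedgeConj D D (Sum.elim T (fun i => Complex.I • T i)) = (-2 * Complex.I) ^ (n + 1) := by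
    refine wedgeConj_det_basis (V := (Fin n → ℂ) × (ℂ →L[ℂ] ℂ)) _ _ fun i => ?_
    exact (c.mfderiv_coordFun_tangentVec hw _).trans (snocLinearEquiv_stdVec i)
  -- The derivative of `param` is complex linear, so the imaginary directions are √-1 times the real
  -- ones.
  have h3 : (fun i => c.tangentVec w (Complex.I • stdVec i)) = fun i => Complex.I • T i := by
    funext i
    let A : ((Fin n → ℂ) × ℂ) →L[ℂ] ((Fin n → ℂ) × (ℂ →L[ℂ] ℂ)) :=
      mfderiv 𝓘(ℂ, (Fin n → ℂ) × ℂ) (dualModel n) c.param w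
    exact map_smul A _ _
  have h4 : wedgeConj (σ (c.param w)) (τ (c.param w))
      (Sum.elim (fun i => c.tangentVec w (stdVec i))
        (fun i => c.tangentVec w (Complex.I • stdVec i))) =
      (c.formCoeff σ w * star (c.formCoeff τ w)) * (-2 * Complex.I) ^ (n + 1) := by
    have h5 := congrArg (fun M => M (Sum.elim T fun i => Complex.I • T i))
      (wedgeConj_smul D D (c.formCoeff σ w) (c.formCoeff τ w))
    simp only [AlternatingMap.smul_apply, h2, smul_eq_mul] at h5
    rw [h3, c.form_eq_smul σ hw, c.form_eq_smul τ hw]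
    exact h5
  rw [formDensity, h4, ← sign_identity n]
  ring

end TrivializingChart

namespace HermitianMetric

variable (h : HermitianMetric n L)

lemma local_h_pos (c : TrivializingChart n L) {z : Fin n → ℂ} (hz : z ∈ c.chart.target) :
    0 < h.local_h c z := by
  refine h.pos _ _ fun h0 => ?_
  have := c.dualFrame_frame (c.chart.map_target hz)
  rw [h0, map_zero] at this
  exact zero_ne_one this

lemma form_self_eq (x : X) (u : L x) : h.form x u u = ((h.form x u u).re : ℂ) := by
  have := h.conj_symm x u u
  rw [Complex.star_def] at this
  exact (Complex.conj_eq_iff_re.1 this).symm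

lemma form_smul_frame (c : TrivializingChart n L) (z : Fin n → ℂ) (t : ℂ) :
    h.form _ (t • c.frame (c.chart.symm z)) (t • c.frame (c.chart.symm z)) =
      ((‖t‖ ^ 2 * h.local_h c z : ℝ) : ℂ) := by
  rw [map_smulₛₗ, map_smul, LinearMap.smul_apply, h.form_self_eq, smul_eq_mul, smul_eq_mul,
    ← mul_assoc, Complex.conj_mul']
  push_cast
  rfl

/-- On a line all unit vectors differ by a phase, so the supremum defining the dual norm runs over a
single value. -/
lemma dualNormSq_param (c : TrivializingChart n L) {w : (Fin n → ℂ) × ℂ}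
    (hw : w.1 ∈ c.chart.target) :
    h.dualNormSq (c.param w) = ‖w.2‖ ^ 2 / h.local_h c w.1 := by
  have hx := c.chart.map_target hw
  have hp := h.local_h_pos c hw
  set x := c.chart.symm w.1 with hxd
  set e := c.frame x with he
  have hform : ∀ t : ℂ, h.form x (t • e) (t • e) = ((‖t‖ ^ 2 * h.local_h c w.1 : ℝ) : ℂ) :=
    h.form_smul_frame c w.1
  have hset : {r : ℝ | ∃ l : L x, h.form x l l = 1 ∧ r = ‖(w.2 • c.dualFrame x) l‖ ^ 2} =
      {‖w.2‖ ^ 2 / h.local_h c w.1} := by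
    ext r
    simp only [Set.mem_ofPred_eq, Set.mem_singleton_iff]
    constructor
    · rintro ⟨l, hl, rfl⟩
      rw [← c.dualFrame_smul_frame hx l, hform] at hl
      have hl' : ‖c.dualFrame x l‖ ^ 2 * h.local_h c w.1 = 1 := by exact_mod_cast hl
      have : (w.2 • c.dualFrame x) l = w.2 * c.dualFrame x l := rfl
      rw [this, norm_mul, mul_pow, eq_div_iff hp.ne', mul_assoc, hl', mul_one]
    · rintro rfl
      have hs : ‖((Real.sqrt (h.local_h c w.1))⁻¹ : ℂ)‖ ^ 2 = (h.local_h c w.1)⁻¹ := by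
        rw [norm_inv, Complex.norm_real, Real.norm_of_nonneg (Real.sqrt_nonneg _), inv_pow,
          Real.sq_sqrt hp.le]
      refine ⟨((Real.sqrt (h.local_h c w.1))⁻¹ : ℂ) • e, ?_, ?_⟩
      · rw [hform, hs, inv_mul_cancel₀ hp.ne', Complex.ofReal_one]
      · have : (w.2 • c.dualFrame x) (((Real.sqrt (h.local_h c w.1))⁻¹ : ℂ) • e) =
            w.2 * ((Real.sqrt (h.local_h c w.1))⁻¹ : ℂ) := by
          rw [map_smul]
          change _ * (w.2 * c.dualFrame x (c.frame x)) = _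
          rw [c.dualFrame_frame hx, mul_one, mul_comm]
        rw [this, norm_mul, mul_pow, hs, div_eq_mul_inv]
  change sSup {r : ℝ | ∃ l : L x, h.form x l l = 1 ∧ r = ‖(w.2 • c.dualFrame x) l‖ ^ 2} = _
  rw [hset, csSup_singleton]

lemma param_mem_disk (c : TrivializingChart n L) {w : (Fin n → ℂ) × ℂ}
    (hw : w.1 ∈ c.chart.target) : c.param w ∈ h.disk ↔ ‖w.2‖ ^ 2 < h.local_h c w.1 := by
  change 0 < 1 - h.dualNormSq (c.param w) ↔ _
  rw [h.dualNormSq_param c hw, sub_pos, div_lt_one (h.local_h_pos c hw)]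

lemma local_h_baseTrans (c c' : TrivializingChart n L) {z : Fin n → ℂ} (hz : z ∈ c.overlap c') :
    h.local_h c' (c.baseTrans c' z) = ‖c.ratio c' z‖ ^ 2 * h.local_h c z := by
  have key : ∀ y, y = c.chart.symm z → (h.form y (c'.frame y) (c'.frame y)).re =
      ‖c.ratio c' z‖ ^ 2 * h.local_h c z := by
    rintro y rfl
    rw [c.frame_eq c' hz, h.form_smul_frame, Complex.ofReal_re]
  exact key _ (c.symm_baseTrans c' hz)

end HermitianMetric
end Geometry

/-! ### Wirtinger calculus -/

section Wirtinger

variable {n : ℕ}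

lemma fderiv_apply_eq_wirtinger (u : (Fin n → ℂ) → ℂ) (p y : Fin n → ℂ) :
    fderiv ℝ u p y = ∑ k, (wirtinger k u p * y k + wirtingerBar k u p * star (y k)) := by
  have hy : y = ∑ k, ((y k).re • (Pi.single k 1 : Fin n → ℂ) +
      (y k).im • (Pi.single k Complex.I : Fin n → ℂ)) := by
    ext j
    simp only [Finset.sum_apply, Pi.add_apply, Pi.smul_apply, Pi.single_apply]
    rw [Finset.sum_eq_single j]
    · simp
    · intro b _ hb; simp [hb.symm]
    · simp
  conv_lhs => rw [hy]
  rw [map_sum]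
  refine Finset.sum_congr rfl fun k _ => ?_
  rw [map_add, map_smul, map_smul, wirtinger, wirtingerBar]
  have hz : y k = (y k).re + (y k).im * Complex.I := (Complex.re_add_im _).symm
  have hz' : star (y k) = (y k).re - (y k).im * Complex.I := by
    rw [Complex.star_def]; apply Complex.ext <;> simp
  rw [hz']
  nth_rewrite 3 [hz]
  simp only [Complex.real_smul]
  linear_combination (y k).im * fderiv ℝ u p (Pi.single k Complex.I) * Complex.I_sq

/-- The splitting of a real differential into complex linear and antilinear parts is unique. The
rules below are obtained by reading off its coefficients. -/
lemma wirtinger_of_fderiv {u : (Fin n → ℂ) → ℂ} {p : Fin n → ℂ} (a b : Fin n → ℂ)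
    (h : ∀ y, fderiv ℝ u p y = ∑ k, (a k * y k + b k * star (y k))) (i : Fin n) :
    wirtinger i u p = a i ∧ wirtingerBar i u p = b i := by
  have h1 : fderiv ℝ u p (Pi.single i 1) = a i + b i := by
    rw [h, Finset.sum_eq_single i]
    · simp
    · intro k _ hk; simp [hk]
    · simp
  have h2 : fderiv ℝ u p (Pi.single i Complex.I) = (a i - b i) * Complex.I := by
    rw [h, Finset.sum_eq_single i]
    · simp; ring
    · intro k _ hk; simp [hk]
    · simp
  rw [wirtinger, wirtingerBar, h1, h2]
  constructor
  · linear_combination (-(1 / 2 : ℂ)) * (a i - b i) * Complex.I_sq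
  · linear_combination ((1 / 2 : ℂ)) * (a i - b i) * Complex.I_sq

lemma fderiv_apply_sum_single (F : (Fin n → ℂ) →L[ℂ] ℂ) (y : Fin n → ℂ) :
    F y = ∑ k, F (Pi.single k 1) * y k := by
  conv_lhs => rw [← Finset.univ_sum_single y]
  rw [map_sum]
  refine Finset.sum_congr rfl fun k _ => ?_
  have : (Pi.single k (y k) : Fin n → ℂ) = y k • Pi.single k 1 := by
    rw [← Pi.single_smul, smul_eq_mul, mul_one]
  rw [this, map_smul, smul_eq_mul, mul_comm]

lemma wirtinger_holomorphic {G : (Fin n → ℂ) → ℂ} {p : Fin n → ℂ}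
    (hG : DifferentiableAt ℂ G p) (i : Fin n) :
    wirtinger i G p = fderiv ℂ G p (Pi.single i 1) ∧ wirtingerBar i G p = 0 := by
  refine wirtinger_of_fderiv (fun i => fderiv ℂ G p (Pi.single i 1)) (fun _ => 0) (fun y => ?_) i
  rw [(hG.hasFDerivAt.restrictScalars ℝ).fderiv]
  simpa using fderiv_apply_sum_single (fderiv ℂ G p) y

lemma wirtinger_conj {G : (Fin n → ℂ) → ℂ} {p : Fin n → ℂ}
    (hG : DifferentiableAt ℂ G p) (i : Fin n) :
    wirtinger i (fun z => star (G z)) p = 0 ∧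
      wirtingerBar i (fun z => star (G z)) p = star (fderiv ℂ G p (Pi.single i 1)) := by
  refine wirtinger_of_fderiv (fun _ => 0) (fun i => star (fderiv ℂ G p (Pi.single i 1)))
    (fun y => ?_) i
  have h1 : HasFDerivAt (fun z => star (G z)) _ p :=
    (Complex.conjCLE.hasFDerivAt (x := G p)).comp p (hG.hasFDerivAt.restrictScalars ℝ)
  rw [h1.fderiv]
  change (starRingEnd ℂ) (fderiv ℂ G p y) = _
  rw [fderiv_apply_sum_single, map_sum]
  simp

lemma differentiableAt_real_conj {G : (Fin n → ℂ) → ℂ} {p : Fin n → ℂ}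
    (hG : DifferentiableAt ℂ G p) : DifferentiableAt ℝ (fun z => star (G z)) p :=
  ((Complex.conjCLE.hasFDerivAt (x := G p)).comp p
    (hG.hasFDerivAt.restrictScalars ℝ)).differentiableAt

lemma wirtinger_comp {u : (Fin n → ℂ) → ℂ} {F : (Fin n → ℂ) → (Fin n → ℂ)} {p : Fin n → ℂ}
    (hu : DifferentiableAt ℝ u (F p)) (hF : DifferentiableAt ℂ F p) (i : Fin n) :
    wirtinger i (u ∘ F) p = ∑ k, wirtinger k u (F p) * fderiv ℂ F p (Pi.single i 1) k ∧
      wirtingerBar i (u ∘ F) p =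
        ∑ k, wirtingerBar k u (F p) * star (fderiv ℂ F p (Pi.single i 1) k) := by
  refine wirtinger_of_fderiv
    (fun i => ∑ k, wirtinger k u (F p) * fderiv ℂ F p (Pi.single i 1) k)
    (fun i => ∑ k, wirtingerBar k u (F p) * star (fderiv ℂ F p (Pi.single i 1) k)) (fun y => ?_) i
  rw [(hu.hasFDerivAt.comp p (hF.hasFDerivAt.restrictScalars ℝ)).fderiv]
  change fderiv ℝ u (F p) (fderiv ℂ F p y) = _
  rw [fderiv_apply_eq_wirtinger]
  have hk : ∀ k, fderiv ℂ F p y k = ∑ j, fderiv ℂ F p (Pi.single j 1) k * y j := fun k =>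
    fderiv_apply_sum_single ((ContinuousLinearMap.proj k).comp (fderiv ℂ F p)) y
  simp only [hk, star_sum, star_mul', Finset.mul_sum, Finset.sum_mul, ← Finset.sum_add_distrib]
  rw [Finset.sum_comm]
  refine Finset.sum_congr rfl fun j _ => Finset.sum_congr rfl fun k _ => by ring

lemma wirtinger_add {u v : (Fin n → ℂ) → ℂ} {p : Fin n → ℂ} (hu : DifferentiableAt ℝ u p)
    (hv : DifferentiableAt ℝ v p) (i : Fin n) :
    wirtinger i (fun z => u z + v z) p = wirtinger i u p + wirtinger i v p ∧
      wirtingerBar i (fun z => u z + v z) p = wirtingerBar i u p + wirtingerBar i v p := by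
  simp only [wirtinger, wirtingerBar, fderiv_fun_add hu hv, add_apply]
  constructor <;> ring

lemma wirtinger_mul {u v : (Fin n → ℂ) → ℂ} {p : Fin n → ℂ} (hu : DifferentiableAt ℝ u p)
    (hv : DifferentiableAt ℝ v p) (i : Fin n) :
    wirtinger i (fun z => u z * v z) p = wirtinger i u p * v p + u p * wirtinger i v p := by
  simp only [wirtinger, fderiv_fun_mul hu hv, add_apply, smul_apply, smul_eq_mul]
  ring

lemma wirtinger_sum {m : ℕ} {u : Fin m → (Fin n → ℂ) → ℂ} {p : Fin n → ℂ}
    (hu : ∀ k, DifferentiableAt ℝ (u k) p) (i : Fin n) :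
    wirtinger i (fun z => ∑ k, u k z) p = ∑ k, wirtinger i (u k) p := by
  simp only [wirtinger, fderiv_fun_sum (fun k _ => hu k), sum_apply,
    Finset.mul_sum, ← Finset.sum_sub_distrib]

lemma wirtinger_congr {u v : (Fin n → ℂ) → ℂ} {p : Fin n → ℂ} (h : u =ᶠ[𝓝 p] v) (i : Fin n) :
    wirtinger i u p = wirtinger i v p ∧ wirtingerBar i u p = wirtingerBar i v p := by
  simp only [wirtinger, wirtingerBar, h.fderiv_eq, and_self]

lemma contDiffAt_wirtinger {u : (Fin n → ℂ) → ℂ} {p : Fin n → ℂ} (hu : ContDiffAt ℝ ∞ u p)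
    (i : Fin n) : ContDiffAt ℝ ∞ (wirtinger i u) p ∧ ContDiffAt ℝ ∞ (wirtingerBar i u) p := by
  have h1 : ContDiffAt ℝ ∞ (fderiv ℝ u) p := hu.fderiv_right (by simp)
  constructor
  · exact contDiffAt_const.mul ((h1.clm_apply contDiffAt_const).sub
      (contDiffAt_const.mul (h1.clm_apply contDiffAt_const)))
  · exact contDiffAt_const.mul ((h1.clm_apply contDiffAt_const).add
      (contDiffAt_const.mul (h1.clm_apply contDiffAt_const)))

/-- The complex Hessian of `u ∘ F + G + Ḡ + a` for holomorphic `F` and `G`. -/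
lemma wirtinger_wirtingerBar_comp {u : (Fin n → ℂ) → ℂ} {F : (Fin n → ℂ) → (Fin n → ℂ)}
    {G : (Fin n → ℂ) → ℂ} {v : (Fin n → ℂ) → ℂ} {p : Fin n → ℂ} (a : ℂ)
    (hu : ContDiffAt ℝ ∞ u (F p)) (hF : ContDiffAt ℂ ω F p) (hG : ContDiffAt ℂ ω G p)
    (hv : v =ᶠ[𝓝 p] fun z => u (F z) + (G z + a + star (G z))) (i j : Fin n) :
    wirtinger i (wirtingerBar j v) p =
      ∑ k, ∑ l, fderiv ℂ F p (Pi.single i 1) l * wirtinger l (wirtingerBar k u) (F p) *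
        star (fderiv ℂ F p (Pi.single j 1) k) := by
  have hFn : ∀ᶠ z in 𝓝 p, ContDiffAt ℂ ω F z := hF.eventually (by simp)
  have hGn : ∀ᶠ z in 𝓝 p, ContDiffAt ℂ ω G z := hG.eventually (by simp)
  have hun : ∀ᶠ z in 𝓝 p, DifferentiableAt ℝ u (F z) := by
    have : ∀ᶠ y in 𝓝 (F p), ContDiffAt ℝ 1 u y := (hu.of_le (by simp)).eventually (by simp)
    filter_upwards [hF.continuousAt.eventually this] with z hz
    exact hz.differentiableAt (by simp)
  have hF' : ContDiffAt ℂ ω (fderiv ℂ F) p := hF.fderiv_right (by simp)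
  have hG' : ContDiffAt ℂ ω (fderiv ℂ G) p := hG.fderiv_right (by simp)
  have hFk : ∀ k, DifferentiableAt ℂ (fun z => fderiv ℂ F z (Pi.single j 1) k) p := fun k =>
    ((contDiffAt_pi.1 (hF'.clm_apply contDiffAt_const)) k).differentiableAt (by simp)
  have hGj : DifferentiableAt ℂ (fun z => fderiv ℂ G z (Pi.single j 1)) p :=
    (hG'.clm_apply contDiffAt_const).differentiableAt (by simp)
  have hbar : wirtingerBar j v =ᶠ[𝓝 p] fun z =>
      (∑ k, wirtingerBar k u (F z) * star (fderiv ℂ F z (Pi.single j 1) k)) +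
        star (fderiv ℂ G z (Pi.single j 1)) := by
    filter_upwards [hv.eventuallyEq_nhds, hFn, hGn, hun] with z hz hFz hGz huz
    have dF := hFz.differentiableAt (by simp)
    have dG := hGz.differentiableAt (by simp)
    have dG1 : DifferentiableAt ℂ (fun z => G z + a) z := dG.add_const a
    have dGa : DifferentiableAt ℝ (fun z => G z + a) z := dG1.restrictScalars ℝ
    have dGb := differentiableAt_real_conj dG
    have dFu : DifferentiableAt ℝ (fun z => u (F z)) z := huz.comp z (dF.restrictScalars ℝ)
    have dGc : DifferentiableAt ℝ (fun z => G z + a + star (G z)) z := dGa.add dGb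
    rw [(wirtinger_congr hz j).2, (wirtinger_add dFu dGc j).2,
      (wirtinger_add dGa dGb j).2, (wirtinger_holomorphic dG1 j).2, (wirtinger_conj dG j).2,
      zero_add]
    congr 1
    exact (wirtinger_comp huz dF j).2
  rw [(wirtinger_congr hbar i).1]
  have hub : ∀ k, DifferentiableAt ℝ (wirtingerBar k u) (F p) := fun k =>
    (contDiffAt_wirtinger hu k).2.differentiableAt (by simp)
  have dF := hF.differentiableAt (by simp)
  have hcomp : ∀ k, DifferentiableAt ℝ (fun z => wirtingerBar k u (F z)) p := fun k =>
    (hub k).comp p (dF.restrictScalars ℝ)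
  have hterm : ∀ k, DifferentiableAt ℝ
      (fun z => wirtingerBar k u (F z) * star (fderiv ℂ F z (Pi.single j 1) k)) p := fun k =>
    (hcomp k).mul (differentiableAt_real_conj (hFk k))
  rw [(wirtinger_add (DifferentiableAt.fun_sum fun k _ => hterm k) (differentiableAt_real_conj hGj) i).1,
    (wirtinger_conj hGj i).1, add_zero, wirtinger_sum hterm]
  refine Finset.sum_congr rfl fun k _ => ?_
  rw [wirtinger_mul (hcomp k) (differentiableAt_real_conj (hFk k)), (wirtinger_conj (hFk k) i).1,
    mul_zero, add_zero, (show wirtinger i (fun z => wirtingerBar k u (F z)) p = _ from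
      (wirtinger_comp (hub k) dF i).1), Finset.sum_mul]
  exact Finset.sum_congr rfl fun l _ => by ring

end Wirtinger

/-! ### Transformation of the weight and of the metric determinant. -/

section Geometry

variable {n : ℕ} {X : Type*} [TopologicalSpace X] [ChartedSpace (Fin n → ℂ) X]
  {L : X → Type*} [TopologicalSpace (TotalSpace ℂ L)]
  [∀ x, AddCommGroup (L x)] [∀ x, Module ℂ (L x)] [∀ x, TopologicalSpace (L x)]
  [FiberBundle ℂ L] [VectorBundle ℂ ℂ L]

variable [∀ x, IsTopologicalAddGroup (L x)] [∀ x, ContinuousSMul ℂ (L x)]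
  [IsManifold 𝓘(ℂ, Fin n → ℂ) ω X] [ContMDiffVectorBundle ω ℂ L 𝓘(ℂ, Fin n → ℂ)]

namespace HermitianMetric

open TrivializingChart

variable (h : HermitianMetric n L)

lemma contDiffAt_local_h (c : TrivializingChart n L) {z : Fin n → ℂ} (hz : z ∈ c.chart.target) :
    ContDiffAt ℝ ∞ (h.local_h c) z :=
  (h.smooth c).contDiffAt (c.chart.open_target.mem_nhds hz)

lemma contDiffAt_weight (c : TrivializingChart n L) {z : Fin n → ℂ} (hz : z ∈ c.chart.target) :
    ContDiffAt ℝ ∞ (fun z => (h.weight c z : ℂ)) z :=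
  Complex.ofRealCLM.contDiff.contDiffAt.comp z
    ((h.contDiffAt_local_h c hz).log (h.local_h_pos c hz).ne').neg

lemma weight_baseTrans (c c' : TrivializingChart n L) {z : Fin n → ℂ} (hz : z ∈ c.overlap c') :
    h.weight c z = h.weight c' (c.baseTrans c' z) + 2 * Real.log ‖c.ratio c' z‖ := by
  have hr : ‖c.ratio c' z‖ ≠ 0 := norm_ne_zero_iff.2 (c.ratio_ne_zero c' hz)
  rw [weight, weight, h.local_h_baseTrans c c' hz,
    Real.log_mul (pow_ne_zero 2 hr) (h.local_h_pos c hz.1).ne', Real.log_pow]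
  push_cast
  ring

/-- The weights of two charts differ by log |r|² with r holomorphic and nonvanishing. This is
pluriharmonic, so only the change of coordinates affects the complex Hessian. -/
lemma metricMatrix_baseTrans (c c' : TrivializingChart n L) {z : Fin n → ℂ}
    (hz : z ∈ c.overlap c') :
    h.metricMatrix c z =
      Matrix.transpose (LinearMap.toMatrix' (fderiv ℂ (c.baseTrans c') z : (Fin n → ℂ) →ₗ[ℂ] (Fin n → ℂ))) *
        h.metricMatrix c' (c.baseTrans c' z) *
        (LinearMap.toMatrix' (fderiv ℂ (c.baseTrans c') z : (Fin n → ℂ) →ₗ[ℂ] (Fin n → ℂ))).map star := by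
  set r := c.ratio c' with hrd
  have hr0 : r z ≠ 0 := c.ratio_ne_zero c' hz
  have hr := c.contDiffAt_ratio c' hz
  -- Dividing by `r z` moves the argument near 1, where the principal logarithm is holomorphic. The
  -- constant 2 log |r z| makes up for the division.
  let G : (Fin n → ℂ) → ℂ := fun y => Complex.log ((r z)⁻¹ * r y)
  have h1 : (r z)⁻¹ * r z = 1 := inv_mul_cancel₀ hr0
  have hG : ContDiffAt ℂ ω G z :=
    ContDiffAt.comp z (Complex.contDiffAt_log (by rw [h1]; exact Complex.one_mem_slitPlane))
      (contDiffAt_const.mul hr)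
  have hv : (fun y => (h.weight c y : ℂ)) =ᶠ[𝓝 z] fun y =>
      (fun y => (h.weight c' y : ℂ)) (c.baseTrans c' y) +
        (G y + (2 * Real.log ‖r z‖ : ℝ) + star (G y)) := by
    filter_upwards [(c.isOpen_overlap c').mem_nhds hz] with y hy
    have hy0 : r y ≠ 0 := c.ratio_ne_zero c' hy
    have hre : G y + star (G y) = ((2 * (Real.log ‖r y‖ - Real.log ‖r z‖) : ℝ) : ℂ) := by
      rw [Complex.star_def, Complex.add_conj, Complex.log_re, norm_mul, norm_inv,
        Real.log_mul (inv_ne_zero (norm_ne_zero_iff.2 hr0)) (norm_ne_zero_iff.2 hy0), Real.log_inv]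
      push_cast; ring
    rw [h.weight_baseTrans c c' hy]
    have : G y + (2 * Real.log ‖r z‖ : ℝ) + star (G y) = (2 * Real.log ‖r y‖ : ℝ) := by
      rw [add_right_comm, hre]; push_cast; ring
    rw [this]
    push_cast; rfl
  ext i j
  have := wirtinger_wirtingerBar_comp _ (h.contDiffAt_weight c' (c.baseTrans_mem c' hz).1)
    (c.contDiffAt_baseTrans c' hz) hG hv i j
  rw [metricMatrix, Matrix.of_apply, this, Matrix.mul_apply]
  refine Finset.sum_congr rfl fun k _ => ?_
  rw [Matrix.mul_apply, Finset.sum_mul]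
  refine Finset.sum_congr rfl fun l _ => ?_
  simp [LinearMap.toMatrix'_apply, metricMatrix]

lemma detg_baseTrans (c c' : TrivializingChart n L) {z : Fin n → ℂ} (hz : z ∈ c.overlap c') :
    h.detg c z = ‖c.jac c' z‖ ^ 2 * h.detg c' (c.baseTrans c' z) := by
  have hJ : (LinearMap.toMatrix' (fderiv ℂ (c.baseTrans c') z : (Fin n → ℂ) →ₗ[ℂ] (Fin n → ℂ))).det =
      c.jac c' z := LinearMap.det_toMatrix' _
  have hJ' : ((LinearMap.toMatrix' (fderiv ℂ (c.baseTrans c') z :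
      (Fin n → ℂ) →ₗ[ℂ] (Fin n → ℂ))).map star).det = star (c.jac c' z) := by
    rw [← hJ]
    exact (RingHom.map_det (starRingEnd ℂ) _).symm
  have : (h.metricMatrix c z).det =
      ((‖c.jac c' z‖ ^ 2 : ℝ) : ℂ) * (h.metricMatrix c' (c.baseTrans c' z)).det := by
    rw [h.metricMatrix_baseTrans c c' hz, Matrix.det_mul, Matrix.det_mul, Matrix.det_transpose, hJ, hJ']
    have := Complex.mul_conj' (c.jac c' z)
    push_cast
    rw [← this, Complex.star_def]
    ring
  rw [detg, this, Complex.re_ofReal_mul, detg]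

lemma continuousAt_detg (c : TrivializingChart n L) {z : Fin n → ℂ} (hz : z ∈ c.chart.target) :
    ContinuousAt (h.detg c) z := by
  refine Complex.continuous_re.continuousAt.comp ?_
  refine (continuous_id.matrix_det).continuousAt.comp (f := h.metricMatrix c) ?_
  refine continuousAt_pi.2 fun i => continuousAt_pi.2 fun j => ?_
  exact (contDiffAt_wirtinger (contDiffAt_wirtinger (h.contDiffAt_weight c hz) j).2 i).1.continuousAt

lemma detg_pos (hpos : h.IsPositive) (c : TrivializingChart n L) {z : Fin n → ℂ}
    (hz : z ∈ c.chart.target) : 0 < h.detg c z :=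
  (Complex.pos_iff.1 (hpos c z hz).det_pos).1

end HermitianMetric
end Geometry

/-! ### Reproducing bounds and orthonormal bases -/

section Reproducing

variable {V : Type*} [AddCommGroup V] [Module ℂ V]

/-- `ip` is a positive semidefinite Hermitian form on the subspace of all `f` with `mem f`. -/
structure IsHermitianForm (mem : V → Prop) (ip : V → V → ℂ) : Prop where
  zero_mem : mem 0
  add_mem : ∀ {f g}, mem f → mem g → mem (f + g)
  smul_mem : ∀ (a : ℂ) {f}, mem f → mem (a • f)
  add_left : ∀ {f g k}, mem f → mem g → mem k → ip (f + g) k = ip f k + ip g k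
  smul_left : ∀ (a : ℂ) {f k}, mem f → mem k → ip (a • f) k = a * ip f k
  conj_symm : ∀ {f g}, mem f → mem g → star (ip f g) = ip g f
  nonneg : ∀ {f}, mem f → 0 ≤ (ip f f).re

/-- The functional `ev` is bounded, with the square of its norm at most `C`. -/
structure IsReproducingBound (mem : V → Prop) (ip : V → V → ℂ) (ev : V →ₗ[ℂ] ℂ) (C : ℝ) : Prop where
  nonneg : 0 ≤ C
  bound : ∀ f, mem f → ‖ev f‖ ^ 2 ≤ C * (ip f f).re

variable {mem : V → Prop} {ip : V → V → ℂ} {ev : V →ₗ[ℂ] ℂ}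

namespace IsHermitianForm

variable (H : IsHermitianForm mem ip)
include H

lemma sum_mem {ι : Type*} (t : Finset ι) (a : ι → ℂ) {φ : ι → V} (hφ : ∀ i, mem (φ i)) :
    mem (∑ i ∈ t, a i • φ i) := by
  classical
  induction t using Finset.induction_on with
  | empty => simpa using H.zero_mem
  | insert i t hi ih => rw [Finset.sum_insert hi]; exact H.add_mem (H.smul_mem _ (hφ i)) ih

lemma sum_left {ι : Type*} (t : Finset ι) (a : ι → ℂ) {φ : ι → V} (hφ : ∀ i, mem (φ i)) {k : V}
    (hk : mem k) : ip (∑ i ∈ t, a i • φ i) k = ∑ i ∈ t, a i * ip (φ i) k := by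
  classical
  induction t using Finset.induction_on with
  | empty => simpa using H.smul_left 0 H.zero_mem hk
  | insert i t hi ih =>
    rw [Finset.sum_insert hi, Finset.sum_insert hi,
      H.add_left (H.smul_mem _ (hφ i)) (H.sum_mem t a hφ) hk, H.smul_left _ (hφ i) hk, ih]

lemma add_right {f g k : V} (hf : mem f) (hg : mem g) (hk : mem k) :
    ip k (f + g) = ip k f + ip k g := by
  rw [← H.conj_symm (H.add_mem hf hg) hk, H.add_left hf hg hk, star_add, H.conj_symm hf hk,
    H.conj_symm hg hk]

lemma smul_right (a : ℂ) {f k : V} (hf : mem f) (hk : mem k) :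
    ip k (a • f) = star a * ip k f := by
  rw [← H.conj_symm (H.smul_mem a hf) hk, H.smul_left a hf hk, star_mul', H.conj_symm hf hk]

lemma sum_right {ι : Type*} (t : Finset ι) (a : ι → ℂ) {φ : ι → V} (hφ : ∀ i, mem (φ i)) {k : V}
    (hk : mem k) : ip k (∑ i ∈ t, a i • φ i) = ∑ i ∈ t, star (a i) * ip k (φ i) := by
  rw [← H.conj_symm (H.sum_mem t a hφ) hk, H.sum_left t a hφ hk, star_sum]
  exact Finset.sum_congr rfl fun i _ => by rw [star_mul', H.conj_symm (hφ i) hk]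

lemma sub_mem {f g : V} (hf : mem f) (hg : mem g) : mem (f - g) := by
  rw [sub_eq_add_neg, ← neg_one_smul ℂ]
  exact H.add_mem hf (H.smul_mem _ hg)

variable {ι : Type*} {φ : ι → V} (hφ : IsOrthonormalBasis mem ip φ)
include hφ

lemma sum_basis_left (t : Finset ι) (a : ι → ℂ) {i : ι} (hi : i ∈ t) :
    ip (∑ j ∈ t, a j • φ j) (φ i) = a i := by
  rw [H.sum_left t a hφ.mem_basis (hφ.mem_basis i), Finset.sum_eq_single_of_mem i hi, hφ.norm_eq_one,
    mul_one]
  intro j _ hj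
  rw [hφ.orthogonal j i hj, mul_zero]

lemma sum_basis_self (t : Finset ι) (a : ι → ℂ) :
    ip (∑ j ∈ t, a j • φ j) (∑ j ∈ t, a j • φ j) = ((∑ j ∈ t, ‖a j‖ ^ 2 : ℝ) : ℂ) := by
  rw [H.sum_right t a hφ.mem_basis (H.sum_mem t a hφ.mem_basis), Complex.ofReal_sum]
  refine Finset.sum_congr rfl fun i hi => ?_
  rw [H.sum_basis_left hφ t a hi, Complex.star_def, Complex.conj_mul']
  push_cast; rfl

lemma bessel {f : V} (hf : mem f) (t : Finset ι) :
    ∑ i ∈ t, ‖ip f (φ i)‖ ^ 2 ≤ (ip f f).re := by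
  set S := ∑ i ∈ t, ip f (φ i) • φ i with hS
  have hSm : mem S := H.sum_mem t _ hφ.mem_basis
  have h1 : ip S S = ((∑ j ∈ t, ‖ip f (φ j)‖ ^ 2 : ℝ) : ℂ) := H.sum_basis_self hφ t _
  have h2 : ip f S = ((∑ j ∈ t, ‖ip f (φ j)‖ ^ 2 : ℝ) : ℂ) := by
    rw [hS, H.sum_right t _ hφ.mem_basis hf, Complex.ofReal_sum]
    refine Finset.sum_congr rfl fun i _ => ?_
    rw [Complex.star_def, Complex.conj_mul']
    push_cast; rfl
  have h3 : ip S f = ((∑ j ∈ t, ‖ip f (φ j)‖ ^ 2 : ℝ) : ℂ) := by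
    rw [← H.conj_symm hf hSm, h2, Complex.star_def, Complex.conj_ofReal]
  have h4 : ip (f - S) (f - S) = ip f f - ((∑ j ∈ t, ‖ip f (φ j)‖ ^ 2 : ℝ) : ℂ) := by
    have hn := H.smul_mem (-1) hSm
    rw [sub_eq_add_neg, ← neg_one_smul ℂ S, H.add_left hf hn (H.add_mem hf hn),
      H.add_right hf hn hf, H.add_right hf hn hn, H.smul_left _ hSm hf, H.smul_left _ hSm hn,
      H.smul_right _ hSm hf, H.smul_right _ hSm hSm, h1, h2, h3]
    simp [sub_eq_add_neg]
  have h5 := H.nonneg (H.sub_mem hf hSm)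
  rw [h4, Complex.sub_re, Complex.ofReal_re] at h5
  linarith

/-- Test the bound on the vector Σ conj(ev φ_i) φ_i: its value under `ev` and its squared norm are
the same number M, so M² ≤ C M. -/
lemma sum_le_of_bound {C : ℝ} (hC : IsReproducingBound mem ip ev C) (t : Finset ι) :
    ∑ i ∈ t, ‖ev (φ i)‖ ^ 2 ≤ C := by
  set M := ∑ i ∈ t, ‖ev (φ i)‖ ^ 2 with hM
  have hM0 : 0 ≤ M := Finset.sum_nonneg fun i _ => by positivity
  have h1 := hC.bound _ (H.sum_mem t (fun i => star (ev (φ i))) hφ.mem_basis)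
  have h2 := H.sum_basis_self hφ t (fun i => star (ev (φ i)))
  simp only [norm_star] at h2
  have h3 : ev (∑ i ∈ t, star (ev (φ i)) • φ i) = (M : ℂ) := by
    rw [map_sum, hM, Complex.ofReal_sum]
    refine Finset.sum_congr rfl fun i _ => ?_
    rw [map_smul, smul_eq_mul, Complex.star_def, Complex.conj_mul']
    push_cast; rfl
  rw [h2, h3, Complex.ofReal_re, Complex.norm_real, Real.norm_of_nonneg hM0, ← hM, sq] at h1
  rcases hM0.eq_or_lt with h0 | h0
  · rw [← h0]; exact hC.nonneg
  · exact le_of_mul_le_mul_right h1 h0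

lemma summable_of_bound {C : ℝ} (hC : IsReproducingBound mem ip ev C) :
    Summable fun i => ‖ev (φ i)‖ ^ 2 :=
  summable_of_sum_le (fun _ => by positivity) (H.sum_le_of_bound hφ hC)

/-- The sum of the `|ev φᵢ|²` is the squared norm of `ev`. -/
lemma isReproducingBound_tsum {C : ℝ} (hC : IsReproducingBound mem ip ev C) :
    IsReproducingBound mem ip ev (∑' i, ‖ev (φ i)‖ ^ 2) := by
  have hs := H.summable_of_bound hφ hC
  refine ⟨tsum_nonneg fun _ => by positivity, fun f hf => ?_⟩
  -- The constant `C` serves only to carry norm convergence of the expansion over to `ev`; it does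
  -- not enter the final bound.
  have hlim : Tendsto (fun t : Finset ι => ev (f - ∑ i ∈ t, ip f (φ i) • φ i)) atTop (𝓝 0) := by
    rw [tendsto_zero_iff_norm_tendsto_zero]
    have h1 := (hφ.expansion f hf).const_mul C
    rw [mul_zero] at h1
    have h2 : Tendsto (fun t : Finset ι => ‖ev (f - ∑ i ∈ t, ip f (φ i) • φ i)‖ ^ 2) atTop (𝓝 0) :=
      squeeze_zero (fun _ => by positivity)
        (fun t => hC.bound _ (H.sub_mem hf (H.sum_mem t _ hφ.mem_basis))) h1
    have h3 := (Real.continuous_sqrt.tendsto 0).comp h2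
    simpa [Function.comp_def, Real.sqrt_sq (norm_nonneg _)] using h3
  have hlim2 : Tendsto (fun t : Finset ι => ‖∑ i ∈ t, ip f (φ i) * ev (φ i)‖ ^ 2) atTop
      (𝓝 (‖ev f‖ ^ 2)) := by
    have : Tendsto (fun t : Finset ι => ∑ i ∈ t, ip f (φ i) * ev (φ i)) atTop (𝓝 (ev f)) := by
      have := (tendsto_const_nhds (x := ev f)).sub hlim
      simpa [map_sub, map_sum, map_smul] using this
    exact this.norm.pow 2
  refine le_of_tendsto' hlim2 fun t => ?_
  calc ‖∑ i ∈ t, ip f (φ i) * ev (φ i)‖ ^ 2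
      ≤ (∑ i ∈ t, ‖ip f (φ i)‖ * ‖ev (φ i)‖) ^ 2 := by
        gcongr
        exact (norm_sum_le _ _).trans (Finset.sum_le_sum fun i _ => (norm_mul_le _ _))
    _ ≤ (∑ i ∈ t, ‖ip f (φ i)‖ ^ 2) * ∑ i ∈ t, ‖ev (φ i)‖ ^ 2 :=
        Finset.sum_mul_sq_le_sq_mul_sq t _ _
    _ ≤ (ip f f).re * ∑' i, ‖ev (φ i)‖ ^ 2 := by
        gcongr
        · exact H.nonneg hf
        · exact H.bessel hφ hf t
        · exact hs.sum_le_tsum t fun _ _ => by positivity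
    _ = _ := mul_comm _ _

end IsHermitianForm

end Reproducing

/-! ### Square integrals of holomorphic functions on discs -/

section Disc

open Metric Real

lemma circleIntegrable_norm_sq {q : ℂ → ℂ} {R r : ℝ} (hq : ContinuousOn q (ball 0 R)) (hr : 0 ≤ r)
    (hrR : r < R) : CircleIntegrable (fun ξ => ‖q ξ‖ ^ 2) 0 r := by
  refine ContinuousOn.circleIntegrable hr ((hq.mono fun ξ hξ => ?_).norm.pow 2)
  rw [mem_sphere_zero_iff_norm] at hξ
  rw [mem_ball_zero_iff, hξ]; exact hrR

/-- In |a + ξq|² the cross term is the real part of a holomorphic function vanishing at the origin,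
so its circle average is zero. -/
lemma circleAverage_norm_sq_step {q : ℂ → ℂ} {R r : ℝ} (hq : DifferentiableOn ℂ q (ball 0 R))
    (hr : 0 ≤ r) (hrR : r < R) (a : ℂ) :
    circleAverage (fun ξ => ‖a + ξ * q ξ‖ ^ 2) 0 r =
      ‖a‖ ^ 2 + r ^ 2 * circleAverage (fun ξ => ‖q ξ‖ ^ 2) 0 r := by
  have hsub : closedBall (0 : ℂ) r ⊆ ball 0 R := closedBall_subset_ball hrR
  have hd : DifferentiableOn ℂ (fun ξ => 2 * star a * (ξ * q ξ)) (ball 0 R) :=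
    (differentiableOn_id.mul hq).const_mul _
  have hdc : DiffContOnCl ℂ (fun ξ => 2 * star a * (ξ * q ξ)) (ball 0 |r|) := by
    rw [abs_of_nonneg hr]
    exact (hd.mono (closure_ball_subset_closedBall.trans hsub)).diffContOnCl
  have hmv := hdc.circleAverage
  simp only [zero_mul, mul_zero] at hmv
  have hci : CircleIntegrable (fun ξ => 2 * star a * (ξ * q ξ)) 0 r :=
    ContinuousOn.circleIntegrable hr (hd.continuousOn.mono (sphere_subset_closedBall.trans hsub))
  have hre : circleAverage (fun ξ => (2 * star a * (ξ * q ξ)).re) 0 r = 0 := by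
    have := Complex.reCLM.circleAverage_comp_comm hci
    rw [hmv] at this
    simpa [Function.comp_def] using this
  have hcire : CircleIntegrable (fun ξ => (2 * star a * (ξ * q ξ)).re) 0 r :=
    ContinuousOn.circleIntegrable hr (Complex.continuous_re.comp_continuousOn
      (hd.continuousOn.mono (sphere_subset_closedBall.trans hsub)))
  have hciq := circleIntegrable_norm_sq hq.continuousOn hr hrR
  have hciq' : CircleIntegrable (fun ξ => r ^ 2 * ‖q ξ‖ ^ 2) 0 r := hciq.const_smul (a := r ^ 2)
  have hexp : Set.EqOn (fun ξ => ‖a + ξ * q ξ‖ ^ 2)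
      (fun ξ => (‖a‖ ^ 2 + (2 * star a * (ξ * q ξ)).re) + r ^ 2 * ‖q ξ‖ ^ 2) (sphere 0 |r|) := by
    intro ξ hξ
    rw [abs_of_nonneg hr, mem_sphere_zero_iff_norm] at hξ
    have : ‖ξ * q ξ‖ ^ 2 = r ^ 2 * ‖q ξ‖ ^ 2 := by rw [norm_mul, hξ, mul_pow]
    simp only [← this]
    rw [← Complex.normSq_eq_norm_sq, ← Complex.normSq_eq_norm_sq, ← Complex.normSq_eq_norm_sq,
      Complex.normSq_add]
    have : (2 * star a * (ξ * q ξ)).re = 2 * (a * star (ξ * q ξ)).re := by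
      simp only [Complex.star_def, Complex.mul_re, Complex.conj_re, Complex.conj_im, Complex.mul_im]
      simp
      ring
    rw [this]
    simp only [Complex.star_def]
    ring
  rw [circleAverage_congr_sphere hexp,
    circleAverage_fun_add (f₁ := fun ξ => ‖a‖ ^ 2 + (2 * star a * (ξ * q ξ)).re)
      ((circleIntegrable_const _ _ _).add hcire) hciq',
    circleAverage_fun_add (circleIntegrable_const _ _ _) hcire, hre, circleAverage_const, add_zero]
  congr 1
  exact circleAverage_fun_smul (a := r ^ 2) (f := fun ξ => ‖q ξ‖ ^ 2)

lemma circleAverage_norm_sq_polynomial (N : ℕ) (a : ℕ → ℂ) {r : ℝ} (hr : 0 ≤ r) :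
    circleAverage (fun ξ => ‖∑ k ∈ Finset.range N, a k * ξ ^ k‖ ^ 2) 0 r =
      ∑ k ∈ Finset.range N, ‖a k‖ ^ 2 * r ^ (2 * k) := by
  induction N generalizing a with
  | zero => simp [circleAverage_const]
  | succ N ih =>
    have hd : DifferentiableOn ℂ (fun ξ => ∑ k ∈ Finset.range N, a (k + 1) * ξ ^ k) (ball 0 (r + 1)) :=
      (DifferentiableOn.fun_sum fun k _ => by fun_prop)
    have := circleAverage_norm_sq_step hd hr (lt_add_one r) (a 0)
    rw [ih] at this
    have he : (fun ξ => ‖∑ k ∈ Finset.range (N + 1), a k * ξ ^ k‖ ^ 2) =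
        fun ξ => ‖a 0 + ξ * ∑ k ∈ Finset.range N, a (k + 1) * ξ ^ k‖ ^ 2 := by
      funext ξ
      rw [Finset.sum_range_succ', add_comm, Finset.mul_sum, pow_zero, mul_one]
      congr 3
      exact Finset.sum_congr rfl fun k _ => by ring
    rw [he, this, Finset.sum_range_succ', add_comm, Finset.mul_sum, mul_zero, pow_zero, mul_one]
    congr 1
    exact Finset.sum_congr rfl fun k _ => by ring

/-- The Taylor coefficients at the origin. -/
def taylorCoeff (f : ℂ → ℂ) (k : ℕ) : ℂ := iteratedDeriv k f 0 / (k.factorial : ℂ)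

/-- Splitting off the constant term and dividing by ξ shifts the power series by one place. -/
lemma iterate_dslope_zero {f : ℂ → ℂ} {R : ℝ} (hR : 0 < R) (hf : DifferentiableOn ℂ f (ball 0 R))
    (k : ℕ) : (Function.swap dslope 0)^[k] f 0 = taylorCoeff f k := by
  have ha : AnalyticAt ℂ f 0 := hf.analyticAt (ball_mem_nhds _ hR)
  have h1 := ha.hasFPowerSeriesAt
  rw [← (h1.has_fpower_series_iterate_dslope_fslope k).coeff_zero 1,
    ← FormalMultilinearSeries.coeff, FormalMultilinearSeries.coeff_iterate_fslope, zero_add,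
    FormalMultilinearSeries.coeff_ofScalars, taylorCoeff]

/-- Writing f = a₀ + ξq and repeating with q peels off one Taylor coefficient at a time. After N
steps the remainder is an average of squares, hence nonnegative. -/
lemma sum_taylorCoeff_le_circleAverage {f : ℂ → ℂ} {R r : ℝ} (hf : DifferentiableOn ℂ f (ball 0 R))
    (hr : 0 ≤ r) (hrR : r < R) (N : ℕ) :
    ∑ k ∈ Finset.range N, ‖taylorCoeff f k‖ ^ 2 * r ^ (2 * k) ≤
      circleAverage (fun ξ => ‖f ξ‖ ^ 2) 0 r := by
  have hR := hr.trans_lt hrR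
  have hq : ∀ k, DifferentiableOn ℂ ((Function.swap dslope 0)^[k] f) (ball 0 R) := by
    intro k
    induction k with
    | zero => exact hf
    | succ k ih =>
      rw [Function.iterate_succ_apply']
      exact (Complex.differentiableOn_dslope (ball_mem_nhds _ hR)).2 ih
  have key : ∀ N, circleAverage (fun ξ => ‖f ξ‖ ^ 2) 0 r =
      ∑ k ∈ Finset.range N, ‖taylorCoeff f k‖ ^ 2 * r ^ (2 * k) +
        r ^ (2 * N) * circleAverage (fun ξ => ‖(Function.swap dslope 0)^[N] f ξ‖ ^ 2) 0 r := by
    intro N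
    induction N with
    | zero => simp
    | succ N ih =>
      have := circleAverage_norm_sq_step (hq (N + 1)) hr hrR (taylorCoeff f N)
      have he : (fun ξ => ‖(Function.swap dslope 0)^[N] f ξ‖ ^ 2) =
          fun ξ => ‖taylorCoeff f N + ξ * (Function.swap dslope 0)^[N + 1] f ξ‖ ^ 2 := by
        funext ξ
        rw [Function.iterate_succ_apply', ← iterate_dslope_zero hR hf N]
        have := sub_smul_dslope ((Function.swap dslope 0)^[N] f) 0 ξ
        rw [sub_zero, smul_eq_mul] at this
        change _ = ‖_ + ξ * dslope ((Function.swap dslope 0)^[N] f) 0 ξ‖ ^ 2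
        rw [this, add_sub_cancel]
      rw [ih, he, this, Finset.sum_range_succ]
      ring
  rw [key N]
  have : 0 ≤ circleAverage (fun ξ => ‖(Function.swap dslope 0)^[N] f ξ‖ ^ 2) 0 r :=
    circleAverage_nonneg_of_nonneg fun _ _ => by positivity
  have := mul_nonneg (pow_nonneg hr (2 * N)) this
  linarith

lemma hasSum_taylorCoeff {f : ℂ → ℂ} {R : ℝ} (hf : DifferentiableOn ℂ f (ball 0 R)) {ξ : ℂ}
    (hξ : ξ ∈ ball 0 R) : HasSum (fun k => taylorCoeff f k * ξ ^ k) (f ξ) := by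
  have := Complex.hasSum_taylorSeries_on_ball hf hξ
  have he : (fun k => taylorCoeff f k * ξ ^ k) =
      fun k : ℕ => (k.factorial : ℂ)⁻¹ • (ξ - 0) ^ k • iteratedDeriv k f 0 := by
    funext k
    rw [taylorCoeff, sub_zero, smul_eq_mul, smul_eq_mul]
    ring
  rw [he]
  exact this

lemma measurable_indicator_of_continuousOn {α β : Type*} [TopologicalSpace α] [MeasurableSpace α]
    [OpensMeasurableSpace α] [TopologicalSpace β] [Zero β] [MeasurableSpace β] [BorelSpace β]
    {g : α → β} {s : Set α} (hg : ContinuousOn g s) (hs : MeasurableSet s) :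
    Measurable (s.indicator g) := by
  classical
  rw [← Set.piecewise_eq_indicator]
  exact hg.measurable_piecewise continuousOn_const hs

/-- Polar coordinates. Working in [0, ∞] avoids any integrability assumption up to the boundary of
the disc. -/
lemma lintegral_ball_norm_sq {f : ℂ → ℂ} {R : ℝ} (hf : ContinuousOn f (ball 0 R)) :
    ∫⁻ ξ in ball 0 R, ‖f ξ‖ₑ ^ 2 =
      ∫⁻ r in Set.Ioo 0 R, ENNReal.ofReal (2 * π * (r * circleAverage (fun ξ => ‖f ξ‖ ^ 2) 0 r)) := by
  set F := (ball (0 : ℂ) R).indicator (fun ξ => ‖f ξ‖ₑ ^ 2) with hF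
  have hcont : ContinuousOn (fun ξ => ‖f ξ‖ₑ ^ 2) (ball 0 R) :=
    (ENNReal.continuous_pow 2).comp_continuousOn (continuous_enorm.comp_continuousOn hf)
  have hFm : Measurable F := measurable_indicator_of_continuousOn hcont measurableSet_ball
  have hcirc : ∀ r θ : ℝ, Complex.polarCoord.symm (r, θ) = circleMap 0 r θ := by
    intro r θ
    rw [Complex.polarCoord_symm_apply, circleMap, zero_add, Complex.exp_mul_I, Complex.ofReal_cos,
      Complex.ofReal_sin]
  rw [← lintegral_indicator measurableSet_ball, ← Complex.lintegral_comp_polarCoord_symm,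
    polarCoord_target, Measure.volume_eq_prod, ← Measure.prod_restrict, lintegral_prod]
  · have hinner : ∀ r ∈ Set.Ioi (0 : ℝ),
        ∫⁻ θ in Set.Ioo (-π) π, ENNReal.ofReal r • F (Complex.polarCoord.symm (r, θ)) =
        (Set.Iio R).indicator (fun r => ENNReal.ofReal
          (2 * π * (r * circleAverage (fun ξ => ‖f ξ‖ ^ 2) 0 r))) r := by
      intro r hr
      have hr' : 0 < r := hr
      by_cases hrR : r < R
      · have hmem : ∀ θ, circleMap 0 r θ ∈ ball (0 : ℂ) R := fun θ => by
          rw [mem_ball_zero_iff, norm_circleMap_zero, abs_of_pos hr']; exact hrR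
        have hcf : Continuous fun θ => ‖f (circleMap 0 r θ)‖ ^ 2 :=
          ((hf.comp_continuous (continuous_circleMap 0 r) hmem).norm).pow 2
        -- Polar coordinates use angles in (-π, π), circle averages those from 0 to 2π; periodicity
        -- allows the shift by -π.
        rw [Set.indicator_of_mem (Set.mem_Iio.2 hrR), circleAverage_eq_integral_add (-π),
          intervalIntegral.integral_comp_add_right (fun θ => ‖f (circleMap 0 r θ)‖ ^ 2)]
        have h1 : ∀ θ, ENNReal.ofReal r • F (Complex.polarCoord.symm (r, θ)) =
            ENNReal.ofReal (r * ‖f (circleMap 0 r θ)‖ ^ 2) := by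
          intro θ
          rw [hcirc, hF, Set.indicator_of_mem (hmem θ), ENNReal.ofReal_mul hr'.le,
            ENNReal.ofReal_pow (norm_nonneg _), ofReal_norm, smul_eq_mul]
        simp only [h1]
        rw [← ofReal_integral_eq_lintegral_ofReal, integral_const_mul]
        · congr 1
          rw [← integral_Ioc_eq_integral_Ioo, ← intervalIntegral.integral_of_le (by linarith [pi_pos])]
          rw [show 0 + -π = -π by ring, show 2 * π + -π = π by ring, smul_eq_mul]
          field_simp
        · exact ((hcf.const_mul r).integrableOn_Icc.mono_set Set.Ioo_subset_Icc_self)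
        · exact ae_of_all _ fun θ => by positivity
      · rw [Set.indicator_of_notMem (by simpa using hrR)]
        have h0 : ∀ θ, F (Complex.polarCoord.symm (r, θ)) = 0 := fun θ => by
          rw [hcirc, hF, Set.indicator_of_notMem]
          rw [mem_ball_zero_iff, norm_circleMap_zero, abs_of_pos hr']; exact hrR
        simp only [h0, smul_zero, lintegral_zero]
    rw [setLIntegral_congr_fun measurableSet_Ioi hinner, lintegral_indicator measurableSet_Iio,
      Measure.restrict_restrict measurableSet_Iio, Set.inter_comm, Set.Ioi_inter_Iio]
  · refine Measurable.aemeasurable ?_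
    have hm : Measurable fun p : ℝ × ℝ => Complex.polarCoord.symm p := by
      simp only [Complex.polarCoord_symm_apply]
      fun_prop
    exact (ENNReal.measurable_ofReal.comp measurable_fst).mul (hFm.comp hm)

lemma lintegral_Ioo_sum_pow (N : ℕ) (a : ℕ → ℂ) {R : ℝ} (hR : 0 ≤ R) :
    ∫⁻ r in Set.Ioo 0 R, ENNReal.ofReal
      (2 * π * (r * ∑ k ∈ Finset.range N, ‖a k‖ ^ 2 * r ^ (2 * k))) =
      ENNReal.ofReal (∑ k ∈ Finset.range N, ‖a k‖ ^ 2 * (π / (k + 1) * R ^ (2 * k + 2))) := by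
  rw [← ofReal_integral_eq_lintegral_ofReal]
  · congr 1
    rw [← integral_Ioc_eq_integral_Ioo, ← intervalIntegral.integral_of_le hR]
    have : ∀ r : ℝ, 2 * π * (r * ∑ k ∈ Finset.range N, ‖a k‖ ^ 2 * r ^ (2 * k)) =
        ∑ k ∈ Finset.range N, (2 * π * ‖a k‖ ^ 2) * r ^ (2 * k + 1) := by
      intro r
      rw [Finset.mul_sum, Finset.mul_sum]
      exact Finset.sum_congr rfl fun k _ => by ring
    simp only [this]
    rw [intervalIntegral.integral_finsetSum]
    · refine Finset.sum_congr rfl fun k _ => ?_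
      rw [intervalIntegral.integral_const_mul, integral_pow]
      have : (k : ℝ) + 1 ≠ 0 := by positivity
      push_cast
      field_simp
      ring
    · intro k _
      exact (by fun_prop : Continuous fun r : ℝ => (2 * π * ‖a k‖ ^ 2) * r ^ (2 * k + 1)).intervalIntegrable _ _
  · refine (Continuous.integrableOn_Icc ?_).mono_set Set.Ioo_subset_Icc_self
    fun_prop
  · refine (ae_restrict_iff' measurableSet_Ioo).2 (ae_of_all _ fun r hr => ?_)
    have := hr.1.le
    exact mul_nonneg (by positivity) (mul_nonneg this (Finset.sum_nonneg fun k _ => by positivity))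

/-- Bessel's inequality for the monomials on a disc. -/
lemma sum_taylorCoeff_le_lintegral {f : ℂ → ℂ} {R : ℝ} (hR : 0 ≤ R)
    (hf : DifferentiableOn ℂ f (ball 0 R)) (N : ℕ) :
    ENNReal.ofReal (∑ k ∈ Finset.range N, ‖taylorCoeff f k‖ ^ 2 * (π / (k + 1) * R ^ (2 * k + 2))) ≤
      ∫⁻ ξ in ball 0 R, ‖f ξ‖ₑ ^ 2 := by
  rw [lintegral_ball_norm_sq hf.continuousOn, ← lintegral_Ioo_sum_pow N _ hR]
  refine setLIntegral_mono' measurableSet_Ioo fun r hr => ENNReal.ofReal_le_ofReal ?_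
  have h1 := sum_taylorCoeff_le_circleAverage hf hr.1.le hr.2 N
  have h2 := hr.1.le
  gcongr

lemma lintegral_polynomial (N : ℕ) (a : ℕ → ℂ) {R : ℝ} (hR : 0 ≤ R) :
    ∫⁻ ξ in ball (0 : ℂ) R, ‖∑ k ∈ Finset.range N, a k * ξ ^ k‖ₑ ^ 2 =
      ENNReal.ofReal (∑ k ∈ Finset.range N, ‖a k‖ ^ 2 * (π / (k + 1) * R ^ (2 * k + 2))) := by
  rw [lintegral_ball_norm_sq (by fun_prop), ← lintegral_Ioo_sum_pow N _ hR]
  exact setLIntegral_congr_fun measurableSet_Ioo fun r hr => by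
    rw [circleAverage_norm_sq_polynomial N a hr.1.le]

end Disc

/-! ### The mean value inequality on polydiscs -/

section MeanValue

open Metric Real

/-- The mean value inequality for square integrals over balls of radius `r`. -/
def HasMeanValueBound (E : Type*) [NormedAddCommGroup E] [NormedSpace ℂ E] [MeasureSpace E]
    (r : ℝ) : Prop :=
  ∃ C : ENNReal, C ≠ 0 ∧ ∀ (a : E) (f : E → ℂ), DifferentiableOn ℂ f (ball a r) →
    C * ‖f a‖ₑ ^ 2 ≤ ∫⁻ z in ball a r, ‖f z‖ₑ ^ 2

/-- Keep only the constant Taylor coefficient in Bessel's inequality; the constant is the area of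
the disc. -/
lemma hasMeanValueBound_complex {r : ℝ} (hr : 0 < r) : HasMeanValueBound ℂ r := by
  refine ⟨ENNReal.ofReal (π * r ^ 2), by simp; positivity, fun a f hf => ?_⟩
  have hpre : (fun ξ => a + ξ) ⁻¹' (ball a r) = ball 0 r := by
    ext ξ; simp
  have h1 : ∫⁻ z in ball a r, ‖f z‖ₑ ^ 2 = ∫⁻ ξ in ball 0 r, ‖f (a + ξ)‖ₑ ^ 2 := by
    rw [← hpre]
    exact ((measurePreserving_add_left volume a).setLIntegral_comp_preimage_emb
      (MeasurableEquiv.addLeft a).measurableEmbedding (fun z => ‖f z‖ₑ ^ 2) _).symm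
  have hd : DifferentiableOn ℂ (fun ξ => f (a + ξ)) (ball 0 r) :=
    hf.comp (by fun_prop) (fun ξ hξ => by rw [← hpre] at hξ; exact hξ)
  have h2 := sum_taylorCoeff_le_lintegral hr.le hd 1
  rw [h1]
  refine le_trans (le_of_eq ?_) h2
  simp only [Finset.sum_range_one, taylorCoeff, iteratedDeriv_zero, Nat.factorial_zero,
    Nat.cast_one, div_one, add_zero, CharP.cast_eq_zero, zero_add, mul_zero]
  rw [mul_comm (‖f a‖ ^ 2), ENNReal.ofReal_mul (by positivity : 0 ≤ π * r ^ 2),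
    ENNReal.ofReal_pow (norm_nonneg (f a)), ofReal_norm]

lemma continuousOn_enorm_sq {α : Type*} [TopologicalSpace α] {f : α → ℂ} {s : Set α}
    (hf : ContinuousOn f s) : ContinuousOn (fun z => ‖f z‖ₑ ^ 2) s :=
  (ENNReal.continuous_pow 2).comp_continuousOn (continuous_enorm.comp_continuousOn hf)

/-- Balls for the maximum norm are products of balls, so the inequality can be applied in one
variable at a time. -/
lemma HasMeanValueBound.prod {E F : Type*} [NormedAddCommGroup E] [NormedSpace ℂ E] [MeasureSpace E]
    [BorelSpace E] [SecondCountableTopology E] [SFinite (volume : Measure E)]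
    [NormedAddCommGroup F] [NormedSpace ℂ F] [MeasureSpace F]
    [BorelSpace F] [SecondCountableTopology F] [SFinite (volume : Measure F)] {r : ℝ} (hr : 0 < r)
    (hE : HasMeanValueBound E r) (hF : HasMeanValueBound F r) : HasMeanValueBound (E × F) r := by
  obtain ⟨C, hC, hE⟩ := hE
  obtain ⟨C', hC', hF⟩ := hF
  refine ⟨C' * C, mul_ne_zero hC' hC, fun a f hf => ?_⟩
  obtain ⟨a, b⟩ := a
  rw [← ball_prod_same] at hf ⊢
  have hm : AEMeasurable (fun z => ‖f z‖ₑ ^ 2)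
      ((volume.prod volume).restrict (ball a r ×ˢ ball b r)) :=
    (continuousOn_enorm_sq hf.continuousOn).aemeasurable
      (isOpen_ball.prod isOpen_ball).measurableSet
  rw [Measure.volume_eq_prod, setLIntegral_prod _ hm]
  calc C' * C * ‖f (a, b)‖ₑ ^ 2 = C' * (C * ‖f (a, b)‖ₑ ^ 2) := mul_assoc _ _ _
    _ ≤ C' * ∫⁻ x in ball a r, ‖f (x, b)‖ₑ ^ 2 := by
        gcongr
        exact hE a (fun x => f (x, b)) (hf.comp (by fun_prop)
          fun x hx => ⟨hx, mem_ball_self hr⟩)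
    _ ≤ ∫⁻ x in ball a r, C' * ‖f (x, b)‖ₑ ^ 2 := lintegral_const_mul_le _ _
    _ ≤ _ := setLIntegral_mono' measurableSet_ball fun x hx =>
        hF b (fun y => f (x, y)) (hf.comp (by fun_prop) fun y hy => ⟨hx, hy⟩)

lemma hasMeanValueBound_pi (n : ℕ) {r : ℝ} (hr : 0 < r) : HasMeanValueBound (Fin n → ℂ) r := by
  induction n with
  | zero =>
    -- In dimension zero the ball is the whole one-point space and the volume is a Dirac mass.
    refine ⟨1, one_ne_zero, fun a f _ => ?_⟩
    have hb : ball a r = Set.univ := by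
      ext z; simp [Subsingleton.elim z a, hr]
    have hv : (volume : Measure (Fin 0 → ℂ)) = Measure.dirac a := by
      rw [volume_pi, Measure.pi_of_empty (x := a)]
    rw [hb, Measure.restrict_univ, hv, lintegral_dirac, one_mul]
  | succ n ih =>
    obtain ⟨C, hC, h⟩ := (hasMeanValueBound_complex hr).prod hr ih
    refine ⟨C, hC, fun a f hf => ?_⟩
    let e := MeasurableEquiv.piFinSuccAbove (fun _ : Fin (n + 1) => ℂ) 0
    have he : ∀ z, e z = (z 0, fun i => z i.succ) := fun z => by
      simp [e, MeasurableEquiv.piFinSuccAbove_apply]; rfl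
    have hball : e ⁻¹' ball (e a) r = ball a r := by
      ext z
      rw [Set.mem_preimage, he, he, ← ball_prod_same, Set.mem_prod, ball_pi _ hr, ball_pi _ hr]
      simp only [Set.mem_pi, Set.mem_univ, true_implies, Fin.forall_fin_succ]
    have hsymm : ∀ p, e.symm p = Fin.cons (α := fun _ => ℂ) p.1 p.2 := fun p => by
      simp [e, MeasurableEquiv.piFinSuccAbove_symm_apply]
      rfl
    have hd : DifferentiableOn ℂ (fun p => f (e.symm p)) (ball (e a) r) := by
      refine hf.comp (f := fun p => e.symm p) (t := ball a r) ?_ fun p hp => ?_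
      · rw [show (fun p => e.symm p) = fun p => Fin.cons (α := fun _ => ℂ) p.1 p.2 from funext hsymm]
        rw [differentiableOn_pi]
        intro i
        induction i using Fin.cases with
        | zero => simpa using differentiableOn_fst
        | succ i => simp only [Fin.cons_succ]; fun_prop
      · rw [← hball, Set.mem_preimage, e.apply_symm_apply]; exact hp
    have h1 := h (e a) (fun p => f (e.symm p)) hd
    rw [e.symm_apply_apply] at h1
    refine h1.trans (le_of_eq ?_)
    rw [← hball, ← (volume_preserving_piFinSuccAbove (fun _ : Fin (n + 1) => ℂ)
      0).setLIntegral_comp_preimage_emb e.measurableEmbedding]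
    exact lintegral_congr fun z => by
      change ‖f (e.symm (e z))‖ₑ ^ 2 = _
      rw [e.symm_apply_apply]

lemma hasMeanValueBound_coordinates (n : ℕ) {r : ℝ} (hr : 0 < r) :
    HasMeanValueBound ((Fin n → ℂ) × ℂ) r :=
  (hasMeanValueBound_pi n hr).prod hr (hasMeanValueBound_complex hr)

end MeanValue

/-! ### Square integrable families of functions -/

section SquareIntegrable

variable {E : Type*} [MeasurableSpace E] (ν : ℕ → Measure E)

/-- The family `a` of functions is square integrable. -/
structure IsSqIntegrable (a : ℕ → E → ℂ) : Prop where
  aestronglyMeasurable : ∀ j, AEStronglyMeasurable (a j) (ν j)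
  lt_top : ∑' j, ∫⁻ z, ‖a j z‖ₑ ^ 2 ∂ν j < ⊤

/-- The inner product of two families of functions. -/
def familyInner (a b : ℕ → E → ℂ) : ℂ := ∑' j, ∫ z, a j z * star (b j z) ∂ν j

variable {ν} {a b d : ℕ → E → ℂ}

namespace IsSqIntegrable

lemma zero : IsSqIntegrable ν (0 : ℕ → E → ℂ) :=
  ⟨fun _ => aestronglyMeasurable_zero, by simp⟩

lemma add (ha : IsSqIntegrable ν a) (hb : IsSqIntegrable ν b) : IsSqIntegrable ν (a + b) := by
  refine ⟨fun j => (ha.1 j).add (hb.1 j), ?_⟩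
  have h2 : ∀ x y : ENNReal, (x + y) ^ 2 ≤ 2 * (x ^ 2 + y ^ 2) := by
    intro x y
    have := ENNReal.rpow_add_le_mul_rpow_add_rpow x y (p := 2) (by norm_num)
    norm_num at this
    exact_mod_cast this
  calc ∑' j, ∫⁻ z, ‖(a + b) j z‖ₑ ^ 2 ∂ν j
      ≤ ∑' j, 2 * (∫⁻ z, ‖a j z‖ₑ ^ 2 ∂ν j + ∫⁻ z, ‖b j z‖ₑ ^ 2 ∂ν j) := by
        refine ENNReal.tsum_le_tsum fun j => ?_
        rw [← lintegral_add_left' ((ha.1 j).enorm.pow_const 2),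
          ← lintegral_const_mul' _ _ ENNReal.ofNat_ne_top]
        refine lintegral_mono fun z => ?_
        exact (pow_le_pow_left' (enorm_add_le (a j z) (b j z)) 2).trans (h2 _ _)
    _ = 2 * (∑' j, ∫⁻ z, ‖a j z‖ₑ ^ 2 ∂ν j + ∑' j, ∫⁻ z, ‖b j z‖ₑ ^ 2 ∂ν j) := by
        rw [ENNReal.tsum_mul_left, ENNReal.tsum_add]
    _ < ⊤ := ENNReal.mul_lt_top (by simp) (ENNReal.add_lt_top.2 ⟨ha.2, hb.2⟩)

lemma lintegral_smul (t : ℂ) (a : ℕ → E → ℂ) :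
    ∑' j, ∫⁻ z, ‖(t • a) j z‖ₑ ^ 2 ∂ν j = ‖t‖ₑ ^ 2 * ∑' j, ∫⁻ z, ‖a j z‖ₑ ^ 2 ∂ν j := by
  rw [← ENNReal.tsum_mul_left]
  refine tsum_congr fun j => ?_
  rw [← lintegral_const_mul' _ _ (by simp)]
  refine lintegral_congr fun z => ?_
  rw [Pi.smul_apply, Pi.smul_apply, smul_eq_mul, enorm_mul, mul_pow]

lemma smul (t : ℂ) (ha : IsSqIntegrable ν a) : IsSqIntegrable ν (t • a) := by
  refine ⟨fun j => (ha.1 j).const_smul t, ?_⟩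
  rw [lintegral_smul]
  exact ENNReal.mul_lt_top (by simp) ha.2

lemma lintegral_ne_top (ha : IsSqIntegrable ν a) (j : ℕ) : ∫⁻ z, ‖a j z‖ₑ ^ 2 ∂ν j ≠ ⊤ :=
  ENNReal.ne_top_of_tsum_ne_top ha.2.ne j

lemma memLp (ha : IsSqIntegrable ν a) (j : ℕ) : MemLp (a j) 2 (ν j) := by
  refine ⟨ha.1 j, ?_⟩
  rw [eLpNorm_lt_top_iff_lintegral_rpow_enorm_lt_top two_ne_zero ENNReal.ofNat_ne_top]
  simpa using (ha.lintegral_ne_top j).lt_top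

lemma integrable_mul_star (ha : IsSqIntegrable ν a) (hb : IsSqIntegrable ν b) (j : ℕ) :
    Integrable (fun z => a j z * star (b j z)) (ν j) :=
  (ha.memLp j).integrable_mul (hb.memLp j).star

/-- The crude estimate |ab| ≤ |a|² + |b|² is enough, as only summability over the pieces is at
stake. -/
lemma norm_integral_le (ha : IsSqIntegrable ν a) (hb : IsSqIntegrable ν b) (j : ℕ) :
    ‖∫ z, a j z * star (b j z) ∂ν j‖ ≤
      (∫⁻ z, ‖a j z‖ₑ ^ 2 ∂ν j).toReal + (∫⁻ z, ‖b j z‖ₑ ^ 2 ∂ν j).toReal := by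
  rw [← ENNReal.toReal_add (ha.lintegral_ne_top j) (hb.lintegral_ne_top j),
    ← toReal_enorm]
  refine ENNReal.toReal_mono (ENNReal.add_ne_top.2 ⟨ha.lintegral_ne_top j, hb.lintegral_ne_top j⟩) ?_
  rw [← lintegral_add_left' ((ha.1 j).enorm.pow_const 2)]
  refine (enorm_integral_le_lintegral_enorm _).trans (lintegral_mono fun z => ?_)
  have hs : ‖star (b j z)‖ₑ = ‖b j z‖ₑ := by rw [← ofReal_norm, norm_star, ofReal_norm]
  rw [enorm_mul, hs]
  rcases le_total ‖a j z‖ₑ ‖b j z‖ₑ with h | h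
  · exact (mul_le_mul_left h _).trans ((le_of_eq (sq _).symm).trans le_add_self)
  · exact (mul_le_mul_right h _).trans ((le_of_eq (sq _).symm).trans le_self_add)

lemma summable_toReal (ha : IsSqIntegrable ν a) :
    Summable fun j => (∫⁻ z, ‖a j z‖ₑ ^ 2 ∂ν j).toReal :=
  ENNReal.summable_toReal ha.2.ne

lemma summable_integral (ha : IsSqIntegrable ν a) (hb : IsSqIntegrable ν b) :
    Summable fun j => ∫ z, a j z * star (b j z) ∂ν j :=
  Summable.of_norm_bounded (ha.summable_toReal.add hb.summable_toReal) (ha.norm_integral_le hb)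

lemma familyInner_add (ha : IsSqIntegrable ν a) (hb : IsSqIntegrable ν b) (hd : IsSqIntegrable ν d) :
    familyInner ν (a + b) d = familyInner ν a d + familyInner ν b d := by
  rw [familyInner, familyInner, familyInner,
    ← (ha.summable_integral hd).tsum_add (hb.summable_integral hd)]
  refine tsum_congr fun j => ?_
  rw [← integral_add (ha.integrable_mul_star hd j) (hb.integrable_mul_star hd j)]
  simp only [Pi.add_apply, add_mul]

lemma familyInner_smul (t : ℂ) (a d : ℕ → E → ℂ) :
    familyInner ν (t • a) d = t * familyInner ν a d := by
  rw [familyInner, familyInner, ← tsum_mul_left]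
  refine tsum_congr fun j => ?_
  rw [← integral_const_mul]
  simp only [Pi.smul_apply, smul_eq_mul, mul_assoc]

lemma familyInner_conj (a b : ℕ → E → ℂ) :
    star (familyInner ν a b) = familyInner ν b a := by
  rw [familyInner, familyInner, Complex.star_def, Complex.conj_tsum]
  refine tsum_congr fun j => ?_
  rw [← integral_conj]
  refine integral_congr_ae (ae_of_all _ fun z => ?_)
  simp [mul_comm]

lemma familyInner_self (ha : IsSqIntegrable ν a) :
    familyInner ν a a = ((∑' j, ∫⁻ z, ‖a j z‖ₑ ^ 2 ∂ν j).toReal : ℂ) := by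
  rw [ENNReal.tsum_toReal_eq ha.lintegral_ne_top, familyInner, Complex.ofReal_tsum]
  refine tsum_congr fun j => ?_
  have h1 : ∀ z, a j z * star (a j z) = ((‖a j z‖ ^ 2 : ℝ) : ℂ) := fun z => by
    rw [Complex.star_def, Complex.mul_conj']; push_cast; rfl
  simp only [h1]
  have hm : AEStronglyMeasurable (fun z => ‖a j z‖ ^ 2) (ν j) := (ha.1 j).norm.pow 2
  rw [integral_complex_ofReal,
    integral_eq_lintegral_of_nonneg_ae (ae_of_all _ fun z => by positivity) hm]
  simp only [ENNReal.ofReal_pow (norm_nonneg _), ofReal_norm]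

end IsSqIntegrable

/-- The inner product of square integrable families, pulled back along a linear map. -/
lemma isHermitianForm_of_familyInner {V : Type*} [AddCommGroup V] [Module ℂ V]
    (A : V →ₗ[ℂ] (ℕ → E → ℂ)) {mem hol : V → Prop} {ip : V → V → ℂ}
    (hmem : ∀ f, mem f ↔ hol f ∧ IsSqIntegrable ν (A f)) (hip : ∀ f g, ip f g = familyInner ν (A f) (A g))
    (h0 : hol 0) (hadd : ∀ f g, hol f → hol g → hol (f + g)) (hsmul : ∀ (t : ℂ) f, hol f → hol (t • f)) :
    IsHermitianForm mem ip where
  zero_mem := (hmem 0).2 ⟨h0, by rw [map_zero]; exact .zero⟩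
  add_mem hf hg := by
    rw [hmem] at hf hg ⊢
    exact ⟨hadd _ _ hf.1 hg.1, by rw [map_add]; exact hf.2.add hg.2⟩
  smul_mem t hf := by
    intro hf
    rw [hmem] at hf ⊢
    exact ⟨hsmul _ _ hf.1, by rw [map_smul]; exact hf.2.smul t⟩
  add_left hf hg hk := by
    rw [hmem] at hf hg hk
    rw [hip, hip, hip, map_add, hf.2.familyInner_add hg.2 hk.2]
  smul_left t hf hk := by
    intro _ _
    rw [hip, hip, map_smul, IsSqIntegrable.familyInner_smul]
  conj_symm _ _ := by rw [hip, hip, IsSqIntegrable.familyInner_conj]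
  nonneg hf := by
    rw [hmem] at hf
    rw [hip, hf.2.familyInner_self, Complex.ofReal_re]
    exact ENNReal.toReal_nonneg

end SquareIntegrable

/-! ### The Bergman spaces inside spaces of square integrable families. -/

section Geometry

variable {n : ℕ} {X : Type*} [TopologicalSpace X] [ChartedSpace (Fin n → ℂ) X]
  {L : X → Type*} [TopologicalSpace (TotalSpace ℂ L)]
  [∀ x, AddCommGroup (L x)] [∀ x, Module ℂ (L x)] [∀ x, TopologicalSpace (L x)]
  [FiberBundle ℂ L] [VectorBundle ℂ ℂ L]

variable [∀ x, IsTopologicalAddGroup (L x)] [∀ x, ContinuousSMul ℂ (L x)]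
  [IsManifold 𝓘(ℂ, Fin n → ℂ) ω X] [ContMDiffVectorBundle ω ℂ L 𝓘(ℂ, Fin n → ℂ)]

namespace TrivializingChart

/-- The coefficient at a point, as a linear functional on forms. -/
def formEval (c : TrivializingChart n L) (w : (Fin n → ℂ) × ℂ) : DualForm n L →ₗ[ℂ] ℂ where
  toFun σ := c.formCoeff σ w
  map_add' _ _ := rfl
  map_smul' _ _ := rfl

/-- The coefficient at a point, as a linear functional on sections. -/
def sectionEval (c : TrivializingChart n L) (k : ℕ) (z : Fin n → ℂ) :
    (∀ x, Twisted n L k x) →ₗ[ℂ] ℂ where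
  toFun s := c.sectionCoeff s z
  map_add' _ _ := map_add (c.coframe k z) _ _
  map_smul' a _ := map_smul (c.coframe k z) a _

end TrivializingChart

namespace HermitianMetric

open TrivializingChart

variable (h : HermitianMetric n L)

/-- The part of the disk bundle over `U`, in coordinates. -/
def coordDisk (c : TrivializingChart n L) : Set ((Fin n → ℂ) × ℂ) :=
  {w | w.1 ∈ c.chart.target ∧ c.param w ∈ h.disk}

lemma mem_coordDisk (c : TrivializingChart n L) {w : (Fin n → ℂ) × ℂ} :
    w ∈ h.coordDisk c ↔ w.1 ∈ c.chart.target ∧ ‖w.2‖ ^ 2 < h.local_h c w.1 :=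
  and_congr_right fun hw => h.param_mem_disk c hw

lemma continuousOn_local_h (c : TrivializingChart n L) :
    ContinuousOn (h.local_h c) c.chart.target := (h.smooth c).continuousOn

lemma isOpen_coordDisk (c : TrivializingChart n L) : IsOpen (h.coordDisk c) := by
  have : h.coordDisk c = (c.chart.target ×ˢ Set.univ) ∩
      (fun w : (Fin n → ℂ) × ℂ => h.local_h c w.1 - ‖w.2‖ ^ 2) ⁻¹' Set.Ioi 0 := by
    ext w
    rw [h.mem_coordDisk]
    simp
  rw [this]
  refine ContinuousOn.isOpen_inter_preimage ?_ (c.chart.open_target.prod isOpen_univ) isOpen_Ioi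
  exact ((h.continuousOn_local_h c).comp continuousOn_fst fun w hw => hw.1).sub (by fun_prop)

section Pieces

variable [SecondCountableTopology X] [Nonempty X]

lemma index_eq_iff (x : X) (j : ℕ) :
    index n L x = j ↔ x ∈ (cover n L j).chart.source ∧ ∀ i < j, x ∉ (cover n L i).chart.source := by
  classical
  exact Nat.find_eq_iff _

lemma mem_refChart (x : X) : x ∈ (refChart n L x).chart.source :=
  ((index_eq_iff x _).1 rfl).1

/-- Displays the piece as an open set minus finitely many open sets, which makes it Borel. -/
lemma basePiece_eq (j : ℕ) : basePiece n L j = (cover n L j).chart.target \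
    ⋃ i ∈ Finset.range j, (cover n L j).overlap (cover n L i) := by
  ext z
  simp only [basePiece, Set.mem_ofPred_eq, Set.mem_sdiff, Set.mem_iUnion, Finset.mem_range,
    exists_prop, not_exists, not_and]
  refine and_congr_right fun hz => ?_
  rw [index_eq_iff]
  constructor
  · exact fun H i hi hz' => H.2 i hi hz'.2
  · exact fun H => ⟨(cover n L j).chart.map_target hz, fun i hi hx => H i hi ⟨hz, hx⟩⟩

lemma measurableSet_basePiece (j : ℕ) : MeasurableSet (basePiece n L j) := by
  rw [basePiece_eq]
  exact (cover n L j).chart.open_target.measurableSet.diff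
    (Finset.measurableSet_biUnion _ fun i _ => (isOpen_overlap _ _).measurableSet)

lemma diskPiece_eq (j : ℕ) :
    h.diskPiece j = h.coordDisk (cover n L j) ∩ Prod.fst ⁻¹' basePiece n L j := by
  ext w
  simp only [diskPiece, coordDisk, basePiece, Set.mem_ofPred_eq, Set.mem_inter_iff, Set.mem_preimage]
  tauto

lemma diskPiece_subset (j : ℕ) : h.diskPiece j ⊆ h.coordDisk (cover n L j) := by
  rw [diskPiece_eq]; exact Set.inter_subset_left

lemma measurableSet_diskPiece (j : ℕ) : MeasurableSet (h.diskPiece j) := by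
  rw [diskPiece_eq]
  exact (h.isOpen_coordDisk _).measurableSet.inter (measurable_fst (measurableSet_basePiece j))

lemma basePiece_subset (j : ℕ) : basePiece n L j ⊆ (cover n L j).chart.target := fun _ hz => hz.1

/-! ### The Bergman spaces as spaces of square integrable families -/

/-- The normalized coefficients of a form in the charts of the cover. -/
def formFamily : DualForm n L →ₗ[ℂ] (ℕ → (Fin n → ℂ) × ℂ → ℂ) where
  toFun σ j w := (Real.sqrt (2 ^ (n + 1)) : ℂ) * (cover n L j).formCoeff σ w
  map_add' σ τ := by
    funext j w
    exact (congrArg _ (map_add ((cover n L j).formEval w) σ τ)).trans (mul_add _ _ _)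
  map_smul' a σ := by
    funext j w
    exact (congrArg _ (map_smul ((cover n L j).formEval w) a σ)).trans (mul_left_comm _ _ _)

lemma sqrt_mul_star_sqrt {t : ℝ} (ht : 0 ≤ t) (x y : ℂ) :
    (Real.sqrt t : ℂ) * x * star ((Real.sqrt t : ℂ) * y) = t * (x * star y) := by
  have : (Real.sqrt t : ℂ) * Real.sqrt t = t := by
    rw [← Complex.ofReal_mul, Real.mul_self_sqrt ht]
  rw [star_mul', Complex.star_def, Complex.conj_ofReal]
  linear_combination (x * (starRingEnd ℂ) y) * this

lemma enorm_sqrt_mul_sq {t : ℝ} (ht : 0 ≤ t) (x : ℂ) :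
    ‖(Real.sqrt t : ℂ) * x‖ₑ ^ 2 = ‖(t : ℂ) * (x * star x)‖ₑ := by
  rw [← sqrt_mul_star_sqrt ht, enorm_mul _ (star _), sq, ← ofReal_norm (star _), norm_star,
    ofReal_norm]

lemma formInner_eq (σ τ : DualForm n L) : h.formInner σ τ =
    familyInner (fun j => volume.restrict (h.diskPiece j)) (formFamily σ) (formFamily τ) := by
  rw [formInner, diskIntegral, familyInner, ← tsum_mul_left]
  refine tsum_congr fun j => ?_
  rw [← integral_const_mul]
  refine setIntegral_congr_fun (h.measurableSet_diskPiece j) fun w hw => ?_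
  have h1 := (cover n L j).formDensity_wedgeConj σ τ (h.diskPiece_subset j hw).1
  have h2 := sqrt_mul_star_sqrt (t := 2 ^ (n + 1)) (by positivity)
    ((cover n L j).formCoeff σ w) ((cover n L j).formCoeff τ w)
  refine h1.trans ?_
  refine Eq.trans ?_ h2.symm
  push_cast
  rfl

lemma enorm_formDensity (σ : DualForm n L) {j : ℕ} {w : (Fin n → ℂ) × ℂ} (hw : w ∈ h.diskPiece j) :
    ‖(cover n L j).formDensity (fun v => wedgeConj (σ v) (σ v)) w‖ₑ = ‖formFamily σ j w‖ₑ ^ 2 := by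
  have h1 := (cover n L j).formDensity_wedgeConj σ σ (h.diskPiece_subset j hw).1
  have h2 := congrArg (fun x : ℂ => ‖x‖ₑ) h1
  have h3 : ‖Complex.I ^ ((n + 1) ^ 2)‖ₑ = 1 := by
    rw [← ofReal_norm, norm_pow, Complex.norm_I, one_pow, ENNReal.ofReal_one]
  simp only [enorm_mul _ ((cover n L j).formDensity _ w), h3, one_mul] at h2
  rw [h2]
  refine Eq.trans ?_ (enorm_sqrt_mul_sq (t := 2 ^ (n + 1)) (by positivity) _).symm
  push_cast
  rfl

/-- Measurability of the family comes for free from holomorphy, so membership is holomorphy plus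
finiteness of one integral. -/
lemma memBergmanForm_iff (σ : DualForm n L) : h.MemBergmanForm σ ↔
    (∀ c : TrivializingChart n L, AnalyticOnNhd ℂ (c.formCoeff σ) (h.coordDisk c)) ∧
      IsSqIntegrable (fun j => volume.restrict (h.diskPiece j)) (formFamily σ) := by
  have h1 : ∀ j, ∫⁻ w in h.diskPiece j,
      ‖(cover n L j).formDensity (fun v => wedgeConj (σ v) (σ v)) w‖ₑ =
      ∫⁻ w in h.diskPiece j, ‖formFamily σ j w‖ₑ ^ 2 := fun j =>
    setLIntegral_congr_fun (h.measurableSet_diskPiece j) fun w hw => h.enorm_formDensity σ hw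
  constructor
  · intro H
    refine ⟨H.holomorphic, fun j => ?_, ?_⟩
    · exact (((H.holomorphic _).continuousOn.mono (h.diskPiece_subset j)).aestronglyMeasurable
        (h.measurableSet_diskPiece j)).const_mul _
    · have := H.square_integrable
      simpa only [h1] using this
  · intro H
    refine ⟨H.1, ?_⟩
    have := H.2.lt_top
    simpa only [h1] using this

lemma isHermitianForm_form : IsHermitianForm h.MemBergmanForm h.formInner :=
  isHermitianForm_of_familyInner formFamily h.memBergmanForm_iff h.formInner_eq
    (fun _ => analyticOnNhd_const) (fun _ _ hσ hτ c => (hσ c).add (hτ c))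
    (fun _ _ hσ c => analyticOnNhd_const.mul (hσ c))

/-- The normalized coefficients of a section in the charts of the cover. -/
def sectionFamily (k : ℕ) : (∀ x, Twisted n L k x) →ₗ[ℂ] (ℕ → (Fin n → ℂ) → ℂ) where
  toFun s j z := (Real.sqrt (h.local_h (cover n L j) z ^ k) : ℂ) * (cover n L j).sectionCoeff s z
  map_add' s t := by
    funext j z
    exact (congrArg _ (map_add ((cover n L j).sectionEval k z) s t)).trans (mul_add _ _ _)
  map_smul' a s := by
    funext j z
    exact (congrArg _ (map_smul ((cover n L j).sectionEval k z) a s)).trans (mul_left_comm _ _ _)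

variable {h} (hpos : h.IsPositive)
include hpos

/-- The determinant in dV_g cancels the one in the metric of the canonical bundle: the inner product
of sections involves only h^k and Lebesgue measure. -/
lemma fiberInner_mul_detg (c : TrivializingChart n L) {k : ℕ} (s t : ∀ x, Twisted n L k x)
    {z : Fin n → ℂ} (hz : z ∈ c.chart.target) : h.fiberInner c s t z * h.detg c z =
      (h.local_h c z ^ k : ℝ) * (c.sectionCoeff s z * star (c.sectionCoeff t z)) := by
  have : (h.detg c z : ℂ) ≠ 0 := by exact_mod_cast (h.detg_pos hpos c hz).ne'
  rw [fiberInner]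
  push_cast
  field_simp

lemma sectionInner_eq {k : ℕ} (s t : ∀ x, Twisted n L k x) : h.sectionInner s t =
    familyInner (fun j => volume.restrict (basePiece n L j)) (h.sectionFamily k s)
      (h.sectionFamily k t) := by
  rw [sectionInner, familyInner]
  refine tsum_congr fun j => ?_
  refine setIntegral_congr_fun (measurableSet_basePiece j) fun z hz => ?_
  refine (fiberInner_mul_detg hpos (cover n L j) s t (basePiece_subset j hz)).trans ?_
  exact (sqrt_mul_star_sqrt (pow_nonneg (h.local_h_pos _ (basePiece_subset j hz)).le _) _ _).symm

lemma memBergmanSection_iff {k : ℕ} (s : ∀ x, Twisted n L k x) : h.MemBergmanSection s ↔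
    (∀ c : TrivializingChart n L, AnalyticOnNhd ℂ (c.sectionCoeff s) c.chart.target) ∧
      IsSqIntegrable (fun j => volume.restrict (basePiece n L j)) (h.sectionFamily k s) := by
  have h1 : ∀ j, ∫⁻ z in basePiece n L j,
      ‖h.fiberInner (cover n L j) s s z * h.detg (cover n L j) z‖ₑ =
      ∫⁻ z in basePiece n L j, ‖h.sectionFamily k s j z‖ₑ ^ 2 := fun j =>
    setLIntegral_congr_fun (measurableSet_basePiece j) fun z hz => by
      rw [fiberInner_mul_detg hpos _ s s (basePiece_subset j hz)]
      exact (enorm_sqrt_mul_sq (pow_nonneg (h.local_h_pos _ (basePiece_subset j hz)).le _) _).symm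
  constructor
  · intro H
    refine ⟨H.holomorphic, fun j => ?_, ?_⟩
    · have hc : ContinuousOn (h.sectionFamily k s j) (cover n L j).chart.target :=
        (Complex.continuous_ofReal.comp_continuousOn
          (Real.continuous_sqrt.comp_continuousOn ((h.continuousOn_local_h _).pow k))).mul
          (H.holomorphic _).continuousOn
      exact (hc.mono (basePiece_subset j)).aestronglyMeasurable (measurableSet_basePiece j)
    · have := H.square_integrable
      simpa only [h1] using this
  · intro H
    refine ⟨H.1, ?_⟩
    have := H.2.lt_top
    simpa only [h1] using this

lemma isHermitianForm_section (k : ℕ) :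
    IsHermitianForm (h.MemBergmanSection (k := k)) (h.sectionInner (k := k)) :=
  isHermitianForm_of_familyInner (h.sectionFamily k) (memBergmanSection_iff hpos)
    (sectionInner_eq hpos)
    (fun c => by
      have : c.sectionCoeff (0 : ∀ x, Twisted n L k x) = fun _ => 0 :=
        funext fun z => map_zero (c.sectionEval k z)
      rw [this]
      exact analyticOnNhd_const)
    (fun s t hs ht c => by
      have : c.sectionCoeff (s + t) = fun z => c.sectionCoeff s z + c.sectionCoeff t z :=
        funext fun z => map_add (c.sectionEval k z) s t
      rw [this]
      exact (hs c).add (ht c))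
    (fun a s hs c => by
      have : c.sectionCoeff (a • s) = fun z => a * c.sectionCoeff s z :=
        funext fun z => map_smul (c.sectionEval k z) a s
      rw [this]
      exact analyticOnNhd_const.mul (hs c))

omit hpos

/-! ### Squared norms as integrals with values in `[0, ∞]` -/

variable (h)

/-- The squared norm of a form, up to the factor `2 ^ (n + 1)`. -/
def formLintegral (σ : DualForm n L) : ENNReal :=
  ∑' j, ∫⁻ w in h.diskPiece j, ‖(cover n L j).formCoeff σ w‖ₑ ^ 2

/-- The squared norm of a section. -/
def sectionLintegral {k : ℕ} (s : ∀ x, Twisted n L k x) : ENNReal :=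
  ∑' j, ∫⁻ z in basePiece n L j,
    ENNReal.ofReal (h.local_h (cover n L j) z ^ k) * ‖(cover n L j).sectionCoeff s z‖ₑ ^ 2

lemma lintegral_formFamily (σ : DualForm n L) :
    ∑' j, ∫⁻ w in h.diskPiece j, ‖formFamily σ j w‖ₑ ^ 2 = 2 ^ (n + 1) * h.formLintegral σ := by
  rw [formLintegral, ← ENNReal.tsum_mul_left]
  refine tsum_congr fun j => ?_
  rw [← lintegral_const_mul' _ _ (by finiteness)]
  refine lintegral_congr fun w => ?_
  change ‖(Real.sqrt (2 ^ (n + 1)) : ℂ) * (cover n L j).formCoeff σ w‖ₑ ^ 2 = _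
  rw [enorm_mul, mul_pow, ← enorm_pow, ← Complex.ofReal_pow, Real.sq_sqrt (by positivity)]
  congr 1
  rw [← ofReal_norm, Complex.norm_real, Real.norm_of_nonneg (by positivity),
    ENNReal.ofReal_pow two_pos.le, ENNReal.ofReal_ofNat]

lemma lintegral_sectionFamily {k : ℕ} (s : ∀ x, Twisted n L k x) :
    ∑' j, ∫⁻ z in basePiece n L j, ‖h.sectionFamily k s j z‖ₑ ^ 2 = h.sectionLintegral s := by
  rw [sectionLintegral]
  refine tsum_congr fun j => ?_
  refine setLIntegral_congr_fun (measurableSet_basePiece j) fun z hz => ?_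
  have h0 := pow_nonneg (h.local_h_pos _ (basePiece_subset j hz)).le k
  change ‖(Real.sqrt (h.local_h (cover n L j) z ^ k) : ℂ) * (cover n L j).sectionCoeff s z‖ₑ ^ 2 = _
  rw [enorm_mul, mul_pow, ← enorm_pow, ← Complex.ofReal_pow, Real.sq_sqrt h0]
  congr 1
  rw [← ofReal_norm, Complex.norm_real, Real.norm_of_nonneg h0]

lemma memBergmanForm_of_lintegral {σ : DualForm n L}
    (hσ : ∀ c : TrivializingChart n L, AnalyticOnNhd ℂ (c.formCoeff σ) (h.coordDisk c))
    (hlt : h.formLintegral σ ≠ ⊤) : h.MemBergmanForm σ := by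
  refine (h.memBergmanForm_iff σ).2 ⟨hσ, fun j => ?_, ?_⟩
  · exact (((hσ _).continuousOn.mono (h.diskPiece_subset j)).aestronglyMeasurable
      (h.measurableSet_diskPiece j)).const_mul _
  · rw [lintegral_formFamily]
    exact ENNReal.mul_lt_top (by finiteness) hlt.lt_top

namespace MemBergmanForm

variable {h} {σ : DualForm n L} (hσ : h.MemBergmanForm σ)
include hσ

lemma lintegral_ne_top : h.formLintegral σ ≠ ⊤ := by
  have := ((h.memBergmanForm_iff σ).1 hσ).2.lt_top
  rw [lintegral_formFamily] at this
  intro h0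
  rw [h0, ENNReal.mul_top (by positivity)] at this
  exact this.ne rfl

lemma formInner_self : (h.formInner σ σ).re = 2 ^ (n + 1) * (h.formLintegral σ).toReal := by
  rw [h.formInner_eq, ((h.memBergmanForm_iff σ).1 hσ).2.familyInner_self, lintegral_formFamily,
    Complex.ofReal_re, ENNReal.toReal_mul]
  simp

end MemBergmanForm

lemma memBergmanSection_of_lintegral {h : HermitianMetric n L} (hpos : h.IsPositive) {k : ℕ}
    {s : ∀ x, Twisted n L k x}
    (hs : ∀ c : TrivializingChart n L, AnalyticOnNhd ℂ (c.sectionCoeff s) c.chart.target)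
    (hlt : h.sectionLintegral s ≠ ⊤) : h.MemBergmanSection s := by
  refine (memBergmanSection_iff hpos s).2 ⟨hs, fun j => ?_, ?_⟩
  · have hc : ContinuousOn (h.sectionFamily k s j) (cover n L j).chart.target :=
      (Complex.continuous_ofReal.comp_continuousOn
        (Real.continuous_sqrt.comp_continuousOn ((h.continuousOn_local_h _).pow k))).mul
        (hs _).continuousOn
    exact (hc.mono (basePiece_subset j)).aestronglyMeasurable (measurableSet_basePiece j)
  · rw [lintegral_sectionFamily]
    exact hlt.lt_top

namespace MemBergmanSection

variable {h} (hpos : h.IsPositive) {k : ℕ}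
  {s : ∀ x, Twisted n L k x} (hs : h.MemBergmanSection s)
include hpos hs

lemma lintegral_ne_top : h.sectionLintegral s ≠ ⊤ := by
  have := ((memBergmanSection_iff hpos s).1 hs).2.lt_top
  rw [lintegral_sectionFamily] at this
  exact this.ne

lemma sectionInner_self : (h.sectionInner s s).re = (h.sectionLintegral s).toReal := by
  rw [sectionInner_eq hpos, ((memBergmanSection_iff hpos s).1 hs).2.familyInner_self,
    lintegral_sectionFamily, Complex.ofReal_re]

end MemBergmanSection

end Pieces
end HermitianMetric
end Geometry

/-! ### Boundedness of the evaluation of forms. -/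

section Geometry

variable {n : ℕ} {X : Type*} [TopologicalSpace X] [ChartedSpace (Fin n → ℂ) X]
  {L : X → Type*} [TopologicalSpace (TotalSpace ℂ L)]
  [∀ x, AddCommGroup (L x)] [∀ x, Module ℂ (L x)] [∀ x, TopologicalSpace (L x)]
  [FiberBundle ℂ L] [VectorBundle ℂ ℂ L]

variable [∀ x, IsTopologicalAddGroup (L x)] [∀ x, ContinuousSMul ℂ (L x)]
  [IsManifold 𝓘(ℂ, Fin n → ℂ) ω X] [ContMDiffVectorBundle ω ℂ L 𝓘(ℂ, Fin n → ℂ)]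

namespace TrivializingChart

lemma totalTrans_totalTrans (c c' : TrivializingChart n L) {w : (Fin n → ℂ) × ℂ}
    (hw : w.1 ∈ c.overlap c') : c'.totalTrans c (c.totalTrans c' w) = w := by
  rw [totalTrans, c.param_totalTrans c' hw, c.coordPair_param hw.1]

/-- The change of variables formula for the square of the modulus of a coefficient. -/
lemma lintegral_formCoeff_eq (c c' : TrivializingChart n L) (σ : DualForm n L)
    {E : Set ((Fin n → ℂ) × ℂ)} (hE : MeasurableSet E) (hsub : ∀ w ∈ E, w.1 ∈ c.overlap c') :
    ∫⁻ w in E, ‖c.formCoeff σ w‖ₑ ^ 2 =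
      ∫⁻ w in c.totalTrans c' '' E, ‖c'.formCoeff σ w‖ₑ ^ 2 := by
  have hd : ∀ w ∈ E, HasFDerivWithinAt (c.totalTrans c')
      ((fderiv ℂ (c.totalTrans c') w).restrictScalars ℝ) E w := fun w hw =>
    (((c.contDiffAt_totalTrans c' (hsub w hw)).differentiableAt
      (by simp)).hasFDerivAt.restrictScalars ℝ).hasFDerivWithinAt
  have hinj : Set.InjOn (c.totalTrans c') E := fun w hw w' hw' hww => by
    rw [← c.totalTrans_totalTrans c' (hsub w hw), hww, c.totalTrans_totalTrans c' (hsub w' hw')]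
  have : (volume : Measure ((Fin n → ℂ) × ℂ)).IsAddHaarMeasure :=
    Measure.prod.instIsAddHaarMeasure _ _
  rw [lintegral_image_eq_lintegral_abs_det_fderiv_mul volume hE hd hinj]
  refine setLIntegral_congr_fun hE fun w hw => ?_
  -- The real determinant of a complex linear map is the squared modulus of its complex determinant,
  -- exactly the factor by which the squared coefficient changes.
  have hdet : ((fderiv ℂ (c.totalTrans c') w).restrictScalars ℝ).det =
      ‖c.jac c' w.1 * c.ratio c' w.1‖ ^ 2 := by
    rw [← c.det_fderiv_totalTrans c' (hsub w hw), ← Complex.normSq_eq_norm_sq,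
      ← Algebra.norm_complex_apply, ← LinearMap.det_restrictScalars]
    rfl
  change _ = ENNReal.ofReal |_| * _
  rw [hdet, c.formCoeff_eq c' σ (hsub w hw), enorm_mul, mul_pow, mul_comm, abs_of_nonneg (by positivity),
    ENNReal.ofReal_pow (norm_nonneg _), ofReal_norm]

end TrivializingChart

namespace HermitianMetric

open TrivializingChart Metric

variable (h : HermitianMetric n L) [SecondCountableTopology X] [Nonempty X]

/-- Cut E according to `index` of the base point and move each part to the chart of its index, where
it lands in the corresponding piece of D. The global norm thus controls integrals in any chart. -/
lemma lintegral_formCoeff_le (c : TrivializingChart n L) (σ : DualForm n L)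
    {E : Set ((Fin n → ℂ) × ℂ)} (hE : MeasurableSet E) (hsub : E ⊆ h.coordDisk c) :
    ∫⁻ w in E, ‖c.formCoeff σ w‖ₑ ^ 2 ≤ h.formLintegral σ := by
  let F : ℕ → Set ((Fin n → ℂ) × ℂ) := fun j => (E ∩ Prod.fst ⁻¹' c.overlap (cover n L j)) \
    ⋃ i ∈ Finset.range j, Prod.fst ⁻¹' c.overlap (cover n L i)
  have hm : ∀ j, MeasurableSet (Prod.fst ⁻¹' c.overlap (cover n L j) : Set ((Fin n → ℂ) × ℂ)) :=
    fun j => measurable_fst (isOpen_overlap _ _).measurableSet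
  have hF : ∀ j, MeasurableSet (F j) := fun j =>
    (hE.inter (hm j)).diff (Finset.measurableSet_biUnion _ fun i _ => hm i)
  have hmem : ∀ j, ∀ w ∈ F j, index n L (c.chart.symm w.1) = j := by
    rintro j w ⟨⟨hw, hj⟩, hi⟩
    simp only [Set.mem_iUnion, Finset.mem_range, exists_prop, not_exists, not_and] at hi
    exact (index_eq_iff _ _).2 ⟨hj.2, fun i hij hx => hi i hij ⟨hj.1, hx⟩⟩
  have hcov : E ⊆ ⋃ j, F j := by
    intro w hw
    have hx := (index_eq_iff (n := n) (L := L) (c.chart.symm w.1) _).1 rfl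
    refine Set.mem_iUnion.2 ⟨index n L (c.chart.symm w.1), ⟨hw, (hsub hw).1, hx.1⟩, ?_⟩
    simp only [Set.mem_iUnion, Finset.mem_range, exists_prop, not_exists, not_and]
    exact fun i hi hi' => hx.2 i hi hi'.2
  refine (lintegral_mono_set hcov).trans ((lintegral_iUnion_le F _).trans ?_)
  refine ENNReal.tsum_le_tsum fun j => ?_
  rw [c.lintegral_formCoeff_eq (cover n L j) σ (hF j) fun w hw => hw.1.2]
  refine lintegral_mono_set ?_
  rintro _ ⟨w, hw, rfl⟩
  refine ⟨(c.baseTrans_mem _ hw.1.2).1, ?_, ?_⟩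
  · rw [totalTrans_eq, c.symm_baseTrans _ hw.1.2]
    exact hmem j w hw
  · rw [c.param_totalTrans _ hw.1.2]
    exact (hsub hw.1.1).2

/-- Evaluation of forms is bounded, locally uniformly. -/
lemma exists_bound_formEval (c : TrivializingChart n L) {w₀ : (Fin n → ℂ) × ℂ}
    (hw₀ : w₀ ∈ h.coordDisk c) : ∃ C : ℝ, ∀ᶠ w in 𝓝 w₀,
      IsReproducingBound h.MemBergmanForm h.formInner (c.formEval w) C := by
  obtain ⟨r, hr, hball⟩ := Metric.isOpen_iff.1 (h.isOpen_coordDisk c) w₀ hw₀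
  -- With half the radius, the balls around all points near `w₀` stay in D, so one constant serves
  -- them all.
  obtain ⟨C, hC, hmv⟩ := hasMeanValueBound_coordinates n (half_pos hr)
  refine ⟨(C⁻¹).toReal, ?_⟩
  filter_upwards [ball_mem_nhds w₀ (half_pos hr)] with w hw
  refine ⟨ENNReal.toReal_nonneg, fun σ hσ => ?_⟩
  have hsub : ball w (r / 2) ⊆ h.coordDisk c :=
    (ball_subset_ball' (by rw [mem_ball] at hw; linarith)).trans hball
  have h1 := (hmv w (c.formCoeff σ) ((hσ.holomorphic c).differentiableOn.mono hsub)).trans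
    (h.lintegral_formCoeff_le c σ measurableSet_ball hsub)
  have hCt : C⁻¹ ≠ ⊤ := ENNReal.inv_ne_top.2 hC
  have h2 : ‖c.formCoeff σ w‖ₑ ^ 2 ≤ C⁻¹ * h.formLintegral σ := by
    -- `HasMeanValueBound` does not exclude an infinite constant. In that case finiteness of the
    -- norm forces the value to vanish, which agrees with `⊤⁻¹ = 0`.
    rcases eq_or_ne C ⊤ with rfl | hCtop
    · have h0 : ‖c.formCoeff σ w‖ₑ ^ 2 = 0 := by
        by_contra h0
        rw [ENNReal.top_mul h0] at h1
        exact hσ.lintegral_ne_top (top_le_iff.1 h1)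
      rw [h0]
      exact zero_le
    · rwa [mul_comm, ← div_eq_mul_inv, ENNReal.le_div_iff_mul_le (Or.inl hC) (Or.inl hCtop), mul_comm]
  have h3 := ENNReal.toReal_mono (ENNReal.mul_ne_top hCt hσ.lintegral_ne_top) h2
  rw [ENNReal.toReal_pow, toReal_enorm, ENNReal.toReal_mul] at h3
  refine (show _ ≤ _ from h3).trans (mul_le_mul_of_nonneg_left ?_ ENNReal.toReal_nonneg)
  rw [hσ.formInner_self]
  -- The factor 2^{n+1} in the norm is at least 1 and may be dropped in this qualitative bound.
  exact le_mul_of_one_le_left ENNReal.toReal_nonneg (one_le_pow₀ one_le_two)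

end HermitianMetric
end Geometry

/-! ### Taylor coefficients in the fibre variable and the weights c_k. -/

section Calculus

lemma iteratedDeriv_comp_mul_left (f : ℂ → ℂ) (r : ℂ) (k : ℕ) :
    iteratedDeriv k (fun ξ => f (r * ξ)) = fun ξ => r ^ k * iteratedDeriv k f (r * ξ) := by
  induction k with
  | zero => simp
  | succ k ih =>
    funext ξ
    rw [iteratedDeriv_succ, ih, deriv_const_mul_field, iteratedDeriv_succ,
      deriv_comp_mul_left r (iteratedDeriv k f) ξ, smul_eq_mul]
    ring

lemma taylorCoeff_comp_mul (f : ℂ → ℂ) (r a : ℂ) (k : ℕ) :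
    taylorCoeff (fun ξ => f (ξ * r) * a) k = taylorCoeff f k * (r ^ k * a) := by
  have h1 : (fun ξ => f (ξ * r) * a) = a • fun ξ => f (r * ξ) := by
    funext ξ; rw [Pi.smul_apply, smul_eq_mul, mul_comm ξ, mul_comm]
  rw [taylorCoeff, taylorCoeff, h1, iteratedDeriv_const_smul_field,
    iteratedDeriv_comp_mul_left, smul_eq_mul]
  simp only [mul_zero]
  ring

/-- A fibre derivative is the total derivative in the direction (0, 1), so joint analyticity
persists by induction. -/
lemma analyticOnNhd_iteratedDeriv_snd {E : Type*} [NormedAddCommGroup E] [NormedSpace ℂ E]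
    {b : E × ℂ → ℂ} {U : Set (E × ℂ)} (hU : IsOpen U) (hb : AnalyticOnNhd ℂ b U) (k : ℕ) :
    AnalyticOnNhd ℂ (fun w : E × ℂ => iteratedDeriv k (fun ξ => b (w.1, ξ)) w.2) U := by
  induction k with
  | zero => simpa using hb
  | succ k ih =>
    have h1 : AnalyticOnNhd ℂ (fun w : E × ℂ => fderiv ℂ
        (fun w : E × ℂ => iteratedDeriv k (fun ξ => b (w.1, ξ)) w.2) w (0, 1)) U := fun w hw =>
      ((ContinuousLinearMap.apply ℂ ℂ ((0, 1) : E × ℂ)).analyticAt _).comp (ih w hw).fderiv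
    refine h1.congr hU fun w hw => ?_
    have h2 := (ih w hw).differentiableAt.hasFDerivAt
    have h3 : HasDerivAt (fun ξ : ℂ => (w.1, ξ)) ((0, 1) : E × ℂ) w.2 :=
      (hasDerivAt_const _ _).prodMk (hasDerivAt_id _)
    have h4 := (h2.comp_hasDerivAt (f := fun ξ : ℂ => (w.1, ξ)) w.2 h3).deriv
    simp only [Function.comp_def] at h4
    rw [iteratedDeriv_succ]
    exact h4.symm

/-- The squared norm of `ξ ^ k` on the disk of radius `t`, divided by `t ^ (2 * k + 2)`, is the
inverse of this number, up to a power of `2`. -/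
def fiberWeight (n k : ℕ) : ℝ := (k + 1) / (2 ^ (n + 1) * Real.pi)

lemma fiberWeight_pos (n k : ℕ) : 0 < fiberWeight n k := by
  have := Real.pi_pos
  rw [fiberWeight]; positivity

lemma inv_fiberWeight (n k : ℕ) : (fiberWeight n k)⁻¹ = 2 ^ (n + 1) * (Real.pi / (k + 1)) := by
  rw [fiberWeight, inv_div, mul_div_assoc]

end Calculus

/-! ### Passage between forms on D and sequences of sections on X. -/

section Geometry

variable {n : ℕ} {X : Type*} [TopologicalSpace X] [ChartedSpace (Fin n → ℂ) X]
  {L : X → Type*} [TopologicalSpace (TotalSpace ℂ L)]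
  [∀ x, AddCommGroup (L x)] [∀ x, Module ℂ (L x)] [∀ x, TopologicalSpace (L x)]
  [FiberBundle ℂ L] [VectorBundle ℂ ℂ L]

variable [∀ x, IsTopologicalAddGroup (L x)] [∀ x, ContinuousSMul ℂ (L x)]
  [IsManifold 𝓘(ℂ, Fin n → ℂ) ω X] [ContMDiffVectorBundle ω ℂ L 𝓘(ℂ, Fin n → ℂ)]

namespace HermitianMetric

open TrivializingChart Metric

variable (h : HermitianMetric n L) [SecondCountableTopology X] [Nonempty X]

lemma mem_coordDisk_iff_ball (c : TrivializingChart n L) {z : Fin n → ℂ} (hz : z ∈ c.chart.target)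
    (ξ : ℂ) : (z, ξ) ∈ h.coordDisk c ↔ ξ ∈ ball 0 (Real.sqrt (h.local_h c z)) := by
  rw [h.mem_coordDisk, mem_ball_zero_iff, Real.lt_sqrt (norm_nonneg ξ)]
  exact and_iff_right hz

/-- Integration over the disk bundle along the fibers. -/
lemma lintegral_diskPiece (j : ℕ) {b : (Fin n → ℂ) × ℂ → ℂ}
    (hb : ContinuousOn b (h.coordDisk (cover n L j))) :
    ∫⁻ w in h.diskPiece j, ‖b w‖ₑ ^ 2 = ∫⁻ z in basePiece n L j,
      ∫⁻ ξ in ball 0 (Real.sqrt (h.local_h (cover n L j) z)), ‖b (z, ξ)‖ₑ ^ 2 := by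
  have hm := h.measurableSet_diskPiece j
  have hG : AEMeasurable ((h.diskPiece j).indicator fun w => ‖b w‖ₑ ^ 2)
      ((volume : Measure (Fin n → ℂ)).prod (volume : Measure ℂ)) :=
    (aemeasurable_indicator_iff hm).2
      ((continuousOn_enorm_sq (hb.mono (h.diskPiece_subset j))).aemeasurable hm)
  rw [← lintegral_indicator hm, Measure.volume_eq_prod, lintegral_prod _ hG,
    ← lintegral_indicator (measurableSet_basePiece j)]
  refine lintegral_congr fun z => ?_
  by_cases hz : z ∈ basePiece n L j
  · rw [Set.indicator_of_mem hz, ← lintegral_indicator measurableSet_ball]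
    refine lintegral_congr fun ξ => ?_
    have hiff : (z, ξ) ∈ h.diskPiece j ↔
        ξ ∈ ball (0 : ℂ) (Real.sqrt (h.local_h (cover n L j) z)) := by
      rw [← h.mem_coordDisk_iff_ball _ (basePiece_subset j hz), diskPiece_eq]
      exact and_iff_left hz
    by_cases hξ : (z, ξ) ∈ h.diskPiece j
    · rw [Set.indicator_of_mem hξ, Set.indicator_of_mem (hiff.1 hξ)]
    · rw [Set.indicator_of_notMem hξ, Set.indicator_of_notMem fun h' => hξ (hiff.2 h')]
  · rw [Set.indicator_of_notMem hz]
    refine (lintegral_congr fun ξ => Set.indicator_of_notMem (fun hξ => hz ?_) _).trans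
      lintegral_zero
    rw [diskPiece_eq] at hξ
    exact hξ.2

/-- With R² = h(e_L, e_L), the factor R^{2k+2} from the fibre integral of |ξ|^{2k} is the weight
h^{k+1}. The norms of the sections therefore appear as integrals over X of disc norms. -/
lemma sum_sectionLintegral (N : ℕ) (a : ℕ → ℂ) (s : ∀ k : ℕ, ∀ x, Twisted n L (k + 1) x)
    (hs : ∀ k, ∀ c : TrivializingChart n L,
      AnalyticOnNhd ℂ (c.sectionCoeff (s k)) c.chart.target) :
    ∑ k ∈ Finset.range N,
      ENNReal.ofReal (‖a k‖ ^ 2 * (Real.pi / (k + 1))) * h.sectionLintegral (s k) =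
    ∑' j, ∫⁻ z in basePiece n L j, ENNReal.ofReal (∑ k ∈ Finset.range N,
      ‖a k * (cover n L j).sectionCoeff (s k) z‖ ^ 2 *
        (Real.pi / (k + 1) * Real.sqrt (h.local_h (cover n L j) z) ^ (2 * k + 2))) := by
  simp only [sectionLintegral, ← ENNReal.tsum_mul_left]
  rw [← Summable.tsum_finsetSum fun _ _ => ENNReal.summable]
  refine tsum_congr fun j => ?_
  simp only [← lintegral_const_mul' _ _ ENNReal.ofReal_ne_top]
  rw [← lintegral_finsetSum']
  · refine setLIntegral_congr_fun (measurableSet_basePiece j) fun z hz => ?_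
    have h0 := (h.local_h_pos _ (basePiece_subset j hz)).le
    have hp := Real.pi_pos
    rw [ENNReal.ofReal_sum_of_nonneg fun _ _ => by positivity]
    refine Finset.sum_congr rfl fun k _ => ?_
    rw [show 2 * k + 2 = 2 * (k + 1) by ring, pow_mul, Real.sq_sqrt h0, ← ofReal_norm,
      ← ENNReal.ofReal_pow (norm_nonneg _), ← ENNReal.ofReal_mul (by positivity),
      ← ENNReal.ofReal_mul (by positivity), norm_mul]
    congr 1
    ring
  · intro k _
    have h1 : ContinuousOn (fun z => h.local_h (cover n L j) z ^ (k + 1)) (basePiece n L j) :=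
      ((h.continuousOn_local_h _).mono (basePiece_subset j)).pow _
    have h2 : ContinuousOn (fun z => ‖(cover n L j).sectionCoeff (s k) z‖ₑ ^ 2) (basePiece n L j) :=
      continuousOn_enorm_sq ((hs k _).continuousOn.mono (basePiece_subset j))
    exact (((h1.aemeasurable (measurableSet_basePiece j)).ennreal_ofReal.mul
      (h2.aemeasurable (measurableSet_basePiece j)))).const_mul _

/-- The forms on the disk bundle that are polynomial along the fibers. -/
lemma exists_form_of_sections {h : HermitianMetric n L} (hpos : h.IsPositive) (N : ℕ) (a : ℕ → ℂ)
    (s : ∀ k : ℕ, ∀ x, Twisted n L (k + 1) x) (hs : ∀ k, h.MemBergmanSection (s k)) :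
    ∃ σ : DualForm n L, h.MemBergmanForm σ ∧
      (∀ c : TrivializingChart n L, ∀ w : (Fin n → ℂ) × ℂ, w.1 ∈ c.chart.target →
        c.formCoeff σ w = ∑ k ∈ Finset.range N, a k * c.sectionCoeff (s k) w.1 * w.2 ^ k) ∧
      (h.formInner σ σ).re = ∑ k ∈ Finset.range N,
        ‖a k‖ ^ 2 * ((fiberWeight n k)⁻¹ * (h.sectionInner (s k) (s k)).re) := by
  obtain ⟨σ, hσ⟩ := exists_form
    (fun (c : TrivializingChart n L) (w : (Fin n → ℂ) × ℂ) => ∑ k ∈ Finset.range N,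
      a k * c.sectionCoeff (s k) w.1 * w.2 ^ k) fun c c' w hw => by
    -- The section contributes r^{k+1} · jac, of which r^k is absorbed in (ξr)^k. What remains, jac
    -- · r, is the factor for forms, independent of k.
    rw [Finset.sum_mul]
    refine Finset.sum_congr rfl fun k _ => ?_
    rw [c.sectionCoeff_eq c' (s k) hw, totalTrans_eq]
    ring
  have hhol : ∀ c : TrivializingChart n L, AnalyticOnNhd ℂ (c.formCoeff σ) (h.coordDisk c) := by
    intro c
    have h1 : AnalyticOnNhd ℂ (fun w : (Fin n → ℂ) × ℂ => ∑ k ∈ Finset.range N,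
        a k * c.sectionCoeff (s k) w.1 * w.2 ^ k) (h.coordDisk c) := fun w hw =>
      Finset.analyticAt_fun_sum _ fun k _ => (analyticAt_const.mul
        (((hs k).holomorphic c w.1 hw.1).comp analyticAt_fst)).mul (analyticAt_snd.pow k)
    exact h1.congr (h.isOpen_coordDisk c) fun w hw => (hσ c w hw.1).symm
  have hint : h.formLintegral σ = ∑ k ∈ Finset.range N,
      ENNReal.ofReal (‖a k‖ ^ 2 * (Real.pi / (k + 1))) * h.sectionLintegral (s k) := by
    rw [h.sum_sectionLintegral N a s fun k => (hs k).holomorphic, formLintegral]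
    refine tsum_congr fun j => ?_
    rw [h.lintegral_diskPiece j (hhol _).continuousOn]
    refine setLIntegral_congr_fun (measurableSet_basePiece j) fun z hz => ?_
    -- Parseval on the disc is an identity for polynomials, so here the norm of the form is computed
    -- exactly.
    rw [← lintegral_polynomial N _ (Real.sqrt_nonneg _)]
    refine lintegral_congr fun ξ => ?_
    rw [hσ _ (z, ξ) (basePiece_subset j hz)]
  have hne : ∀ k ∈ Finset.range N,
      ENNReal.ofReal (‖a k‖ ^ 2 * (Real.pi / (k + 1))) * h.sectionLintegral (s k) ≠ ⊤ := fun k _ =>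
    ENNReal.mul_ne_top ENNReal.ofReal_ne_top ((hs k).lintegral_ne_top hpos)
  have hmem : h.MemBergmanForm σ := h.memBergmanForm_of_lintegral hhol <| by
    rw [hint]
    exact ENNReal.sum_ne_top.2 hne
  refine ⟨σ, hmem, hσ, ?_⟩
  rw [hmem.formInner_self, hint, ENNReal.toReal_sum hne, Finset.mul_sum]
  refine Finset.sum_congr rfl fun k _ => ?_
  have hp := Real.pi_pos
  rw [ENNReal.toReal_mul, ENNReal.toReal_ofReal (by positivity), (hs k).sectionInner_self hpos,
    inv_fiberWeight]
  ring

/-- The Taylor coefficients along the fibers of a form on the disk bundle. -/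
lemma exists_sections_of_form {h : HermitianMetric n L} (hpos : h.IsPositive) {σ : DualForm n L}
    (hσ : h.MemBergmanForm σ) :
    ∃ s : ∀ k : ℕ, ∀ x, Twisted n L (k + 1) x, (∀ k, h.MemBergmanSection (s k)) ∧
      (∀ k, ∀ c : TrivializingChart n L, ∀ z ∈ c.chart.target,
        c.sectionCoeff (s k) z = taylorCoeff (fun ξ => c.formCoeff σ (z, ξ)) k) ∧
      ∀ N, ∑ k ∈ Finset.range N, (fiberWeight n k)⁻¹ * (h.sectionInner (s k) (s k)).re ≤
        (h.formInner σ σ).re := by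
  have hex : ∀ k : ℕ, ∃ s : ∀ x, Twisted n L (k + 1) x, ∀ c : TrivializingChart n L,
      ∀ z ∈ c.chart.target,
        c.sectionCoeff s z = taylorCoeff (fun ξ => c.formCoeff σ (z, ξ)) k := fun k =>
    exists_section (k + 1) (fun c z => taylorCoeff (fun ξ => c.formCoeff σ (z, ξ)) k)
      fun c c' z hz => by
        -- Rescaling ξ by r contributes r^k to the k-th Taylor coefficient, and the factor jac · r
        -- for forms completes it to r^{k+1} · jac.
        have h1 : (fun ξ => c.formCoeff σ (z, ξ)) = fun ξ =>
            (fun ξ' => c'.formCoeff σ (c.baseTrans c' z, ξ')) (ξ * c.ratio c' z) *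
              (c.jac c' z * c.ratio c' z) :=
          funext fun ξ => c.formCoeff_eq c' σ (w := (z, ξ)) hz
        refine (congrArg (fun f => taylorCoeff f k) h1).trans ?_
        refine (taylorCoeff_comp_mul (fun ξ' => c'.formCoeff σ (c.baseTrans c' z, ξ'))
          (c.ratio c' z) (c.jac c' z * c.ratio c' z) k).trans ?_
        ring
  choose s hs using hex
  have hhol : ∀ k, ∀ c : TrivializingChart n L,
      AnalyticOnNhd ℂ (c.sectionCoeff (s k)) c.chart.target := by
    intro k c
    have h1 : AnalyticOnNhd ℂ (fun z => taylorCoeff (fun ξ => c.formCoeff σ (z, ξ)) k)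
        c.chart.target := fun z hz => by
      -- The zero section lies in D, so the Taylor coefficients are fibre derivatives at points
      -- where the form is holomorphic.
      have hz0 : (z, (0 : ℂ)) ∈ h.coordDisk c := by
        rw [h.mem_coordDisk]
        exact ⟨hz, by simpa using h.local_h_pos c hz⟩
      have h2 := analyticOnNhd_iteratedDeriv_snd (h.isOpen_coordDisk c) (hσ.holomorphic c) k _ hz0
      exact (h2.comp (f := fun z => (z, (0 : ℂ)))
        (analyticAt_id.prod analyticAt_const)).div_const
    exact h1.congr c.chart.open_target fun z hz => (hs k c z hz).symm
  -- Bessel's inequality on each fibre disc, integrated over X.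
  have hint : ∀ N, ∑ k ∈ Finset.range N,
      ENNReal.ofReal (Real.pi / (k + 1)) * h.sectionLintegral (s k) ≤ h.formLintegral σ := by
    intro N
    have h1 := h.sum_sectionLintegral N (fun _ => 1) s hhol
    simp only [norm_one, one_pow, one_mul] at h1
    rw [h1, formLintegral]
    refine ENNReal.tsum_le_tsum fun j => ?_
    rw [h.lintegral_diskPiece j (hσ.holomorphic _).continuousOn]
    refine setLIntegral_mono' (measurableSet_basePiece j) fun z hz => ?_
    have hz' := basePiece_subset j hz
    have hd : DifferentiableOn ℂ (fun ξ => (cover n L j).formCoeff σ (z, ξ))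
        (ball 0 (Real.sqrt (h.local_h (cover n L j) z))) :=
      (hσ.holomorphic (cover n L j)).differentiableOn.comp (by fun_prop)
        fun ξ hξ => (h.mem_coordDisk_iff_ball _ hz' ξ).2 hξ
    refine le_trans (le_of_eq ?_) (sum_taylorCoeff_le_lintegral (Real.sqrt_nonneg _) hd N)
    simp only [hs _ _ z hz']
  have hmem : ∀ k, h.MemBergmanSection (s k) := fun k => by
    refine memBergmanSection_of_lintegral hpos (hhol k) fun htop => ?_
    have h1 := (Finset.single_le_sum (fun _ _ => zero_le) (Finset.self_mem_range_succ k)).trans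
      (hint (k + 1))
    have hp := Real.pi_pos
    -- As π/(k+1) is nonzero, an infinite norm of one section would make the norm of the form
    -- infinite.
    rw [htop, ENNReal.mul_top (by simp; positivity)] at h1
    exact hσ.lintegral_ne_top (top_le_iff.1 h1)
  refine ⟨s, hmem, hs, fun N => ?_⟩
  have h1 := ENNReal.toReal_mono hσ.lintegral_ne_top (hint N)
  have hp := Real.pi_pos
  rw [ENNReal.toReal_sum fun k _ => ENNReal.mul_ne_top ENNReal.ofReal_ne_top
    ((hmem k).lintegral_ne_top hpos)] at h1
  rw [hσ.formInner_self]
  refine le_trans (le_of_eq ?_) (mul_le_mul_of_nonneg_left h1 (by positivity))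
  rw [Finset.mul_sum]
  refine Finset.sum_congr rfl fun k _ => ?_
  rw [ENNReal.toReal_mul, ENNReal.toReal_ofReal (by positivity), (hmem k).sectionInner_self hpos,
    inv_fiberWeight]
  ring

end HermitianMetric
end Geometry

/-! ### The two extremal inequalities and equality of the kernels in coordinates. -/

section Geometry

variable {n : ℕ} {X : Type*} [TopologicalSpace X] [ChartedSpace (Fin n → ℂ) X]
  {L : X → Type*} [TopologicalSpace (TotalSpace ℂ L)]
  [∀ x, AddCommGroup (L x)] [∀ x, Module ℂ (L x)] [∀ x, TopologicalSpace (L x)]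
  [FiberBundle ℂ L] [VectorBundle ℂ ℂ L]

variable [∀ x, IsTopologicalAddGroup (L x)] [∀ x, ContinuousSMul ℂ (L x)]
  [IsManifold 𝓘(ℂ, Fin n → ℂ) ω X] [ContMDiffVectorBundle ω ℂ L 𝓘(ℂ, Fin n → ℂ)]

namespace HermitianMetric

open TrivializingChart Metric

variable {h : HermitianMetric n L} [SecondCountableTopology X] [Nonempty X]
  (hpos : h.IsPositive)
include hpos

/-- Evaluation of sections is bounded. -/
lemma exists_bound_sectionEval (c : TrivializingChart n L) {z : Fin n → ℂ}
    (hz : z ∈ c.chart.target) (k : ℕ) : ∃ C : ℝ, IsReproducingBound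
      (h.MemBergmanSection (k := k + 1)) h.sectionInner (c.sectionEval (k + 1) z) C := by
  have hh := h.local_h_pos c hz
  -- Any nonzero point of the fibre disc would do. Evaluating the form with coefficient t ξ^k there
  -- turns a bound for forms into one for sections.
  set ξ : ℂ := ((Real.sqrt (h.local_h c z) / 2 : ℝ) : ℂ) with hξ
  have hs := Real.sqrt_pos.2 hh
  have hξn : ‖ξ‖ = Real.sqrt (h.local_h c z) / 2 := by
    rw [hξ, Complex.norm_real, Real.norm_of_nonneg (by positivity)]
  have hξ0 : 0 < ‖ξ‖ := by rw [hξn]; positivity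
  have hw : (z, ξ) ∈ h.coordDisk c := by
    rw [h.mem_coordDisk_iff_ball c hz, mem_ball_zero_iff, hξn]
    linarith
  obtain ⟨C, hC⟩ := h.exists_bound_formEval c hw
  have hC := hC.self_of_nhds
  have hf := fiberWeight_pos n k
  refine ⟨C * (fiberWeight n k)⁻¹ / ‖ξ‖ ^ (2 * k), by have := hC.nonneg; positivity, fun t ht => ?_⟩
  -- The sequence has `t` in degree `k` and zero in all other degrees.
  let s : ∀ k : ℕ, ∀ x, Twisted n L (k + 1) x := Function.update (fun _ => 0) k t
  have hsk : s k = t := Function.update_self _ _ _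
  have hmem : ∀ j, h.MemBergmanSection (s j) := fun j => by
    by_cases hj : j = k
    · subst hj; rwa [hsk]
    · rw [show s j = 0 from Function.update_of_ne hj _ _]
      exact (isHermitianForm_section hpos (j + 1)).zero_mem
  obtain ⟨σ, hσ, hcoeff, hnorm⟩ := exists_form_of_sections hpos (k + 1) (Pi.single k 1) s hmem
  have h1 := hC.bound σ hσ
  have hother : ∀ j ∈ Finset.range (k + 1), j ≠ k → (Pi.single k 1 : ℕ → ℂ) j = 0 := fun j _ hj =>
    Pi.single_eq_of_ne hj _
  have h2 : c.formEval (z, ξ) σ = c.sectionEval (k + 1) z t * ξ ^ k := by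
    refine (hcoeff c (z, ξ) hz).trans ?_
    rw [Finset.sum_eq_single_of_mem k (Finset.self_mem_range_succ k) fun j hj hjk => by
      rw [hother j hj hjk]; ring, Pi.single_eq_same, hsk, one_mul]
    rfl
  have h3 : (h.formInner σ σ).re = (fiberWeight n k)⁻¹ * (h.sectionInner t t).re := by
    rw [hnorm, Finset.sum_eq_single_of_mem k (Finset.self_mem_range_succ k) fun j hj hjk => by
      rw [hother j hj hjk]; simp, Pi.single_eq_same, hsk]
    simp
  rw [h2, h3, norm_mul, norm_pow, mul_pow, ← pow_mul, mul_comm k 2] at h1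
  rw [div_mul_eq_mul_div, le_div_iff₀ (by positivity)]
  linarith

variable {κ : ℕ → Type*} {s : ∀ k : ℕ, κ k → ∀ x, Twisted n L (k + 1) x}
  (hs : ∀ k, h.IsSectionBasis (s k))
include hs

lemma summable_sectionEval (c : TrivializingChart n L) {z : Fin n → ℂ}
    (hz : z ∈ c.chart.target) (k : ℕ) : Summable fun α => ‖c.sectionEval (k + 1) z (s k α)‖ ^ 2 :=
  have ⟨_, hC⟩ := exists_bound_sectionEval hpos c hz k
  (isHermitianForm_section hpos (k + 1)).summable_of_bound (hs k) hC

lemma isReproducingBound_sectionEval (c : TrivializingChart n L) {z : Fin n → ℂ}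
    (hz : z ∈ c.chart.target) (k : ℕ) :
    IsReproducingBound (h.MemBergmanSection (k := k + 1)) h.sectionInner (c.sectionEval (k + 1) z)
      (∑' α, ‖c.sectionEval (k + 1) z (s k α)‖ ^ 2) :=
  have ⟨_, hC⟩ := exists_bound_sectionEval hpos c hz k
  (isHermitianForm_section hpos (k + 1)).isReproducingBound_tsum (hs k) hC

/-- The part of the series for the kernel of the disk bundle that is given by finitely many basis
sections is at most the norm of the evaluation of forms. -/
lemma sum_sum_le_of_bound (c : TrivializingChart n L) {w : (Fin n → ℂ) × ℂ}
    (hw : w ∈ h.coordDisk c) {C : ℝ}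
    (hC : IsReproducingBound h.MemBergmanForm h.formInner (c.formEval w) C) (N : ℕ)
    (F : ∀ k, Finset (κ k)) :
    ∑ k ∈ Finset.range N, fiberWeight n k * (‖w.2‖ ^ (2 * k) *
      ∑ α ∈ F k, ‖c.sectionEval (k + 1) w.1 (s k α)‖ ^ 2) ≤ C := by
  set S : ℕ → ℝ := fun k => ∑ α ∈ F k, ‖c.sectionEval (k + 1) w.1 (s k α)‖ ^ 2 with hS
  -- Extremal sections in each degree: value at the point and squared norm both equal `S k`.
  let t : ∀ k : ℕ, ∀ x, Twisted n L (k + 1) x := fun k =>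
    ∑ α ∈ F k, star (c.sectionEval (k + 1) w.1 (s k α)) • s k α
  have hH := fun k => isHermitianForm_section (L := L) hpos (k + 1)
  have ht : ∀ k, h.MemBergmanSection (t k) := fun k => (hH k).sum_mem _ _ (hs k).mem_basis
  have htt : ∀ k, (h.sectionInner (t k) (t k)).re = S k := fun k => by
    have h1 := (hH k).sum_basis_self (hs k) (F k) fun α => star (c.sectionEval (k + 1) w.1 (s k α))
    simp only [norm_star] at h1
    exact (congrArg Complex.re h1).trans (Complex.ofReal_re _)
  have hct : ∀ k, c.sectionCoeff (t k) w.1 = S k := fun k => by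
    change c.sectionEval (k + 1) w.1 (t k) = _
    rw [map_sum, hS, Complex.ofReal_sum]
    refine Finset.sum_congr rfl fun α _ => ?_
    rw [map_smul, smul_eq_mul, Complex.star_def, Complex.conj_mul']
    push_cast; rfl
  set T := ∑ k ∈ Finset.range N, fiberWeight n k * (‖w.2‖ ^ (2 * k) * S k) with hT
  have hT0 : 0 ≤ T := Finset.sum_nonneg fun k _ => by
    have := fiberWeight_pos n k
    have : 0 ≤ S k := Finset.sum_nonneg fun _ _ => by positivity
    positivity
  -- The coefficients c_k conj(ξ)^k make the value at `w` and the squared norm of σ the same number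
  -- T, so the bound reads T² ≤ C T.
  obtain ⟨σ, hσ, hcoeff, hnorm⟩ := exists_form_of_sections hpos N
    (fun k => fiberWeight n k * star w.2 ^ k) t ht
  have h1 := hC.bound σ hσ
  have h2 : c.formEval w σ = (T : ℂ) := by
    refine (hcoeff c w hw.1).trans ?_
    rw [hT, Complex.ofReal_sum]
    refine Finset.sum_congr rfl fun k _ => ?_
    have h3 : star w.2 ^ k * w.2 ^ k = ((‖w.2‖ ^ (2 * k) : ℝ) : ℂ) := by
      rw [← mul_pow, Complex.star_def, Complex.conj_mul', ← pow_mul]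
      push_cast; rfl
    rw [hct, Complex.ofReal_mul, Complex.ofReal_mul, ← h3]
    ring
  have h3 : (h.formInner σ σ).re = T := by
    rw [hnorm]
    refine Finset.sum_congr rfl fun k _ => ?_
    have hf := fiberWeight_pos n k
    rw [htt, norm_mul, norm_pow, norm_star, Complex.norm_real, Real.norm_of_nonneg hf.le, mul_pow,
      ← pow_mul, mul_comm k 2]
    field_simp
  rw [h2, h3, Complex.norm_real, Real.norm_of_nonneg hT0] at h1
  rcases hT0.eq_or_lt with h0 | h0
  · rw [← h0]; exact hC.nonneg
  · exact le_of_mul_le_mul_right (by linarith [sq T]) h0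

/-- The partial sums of the series for the kernel of the disk bundle are at most the norm of the
evaluation of forms. -/
lemma sum_le_of_bound (c : TrivializingChart n L) {w : (Fin n → ℂ) × ℂ}
    (hw : w ∈ h.coordDisk c) {C : ℝ}
    (hC : IsReproducingBound h.MemBergmanForm h.formInner (c.formEval w) C) (N : ℕ) :
    ∑ k ∈ Finset.range N, fiberWeight n k * (‖w.2‖ ^ (2 * k) *
      ∑' α, ‖c.sectionEval (k + 1) w.1 (s k α)‖ ^ 2) ≤ C := by
  -- The finite sets for the different degrees grow independently, hence the product filter; each
  -- summand depends on one component only.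
  have h1 : Tendsto (fun F : ∀ k, Finset (κ k) => ∑ k ∈ Finset.range N,
      fiberWeight n k * (‖w.2‖ ^ (2 * k) * ∑ α ∈ F k, ‖c.sectionEval (k + 1) w.1 (s k α)‖ ^ 2))
      (Filter.pi fun _ => atTop) (𝓝 (∑ k ∈ Finset.range N, fiberWeight n k * (‖w.2‖ ^ (2 * k) *
        ∑' α, ‖c.sectionEval (k + 1) w.1 (s k α)‖ ^ 2))) :=
    tendsto_finsetSum _ fun k _ => ((((summable_sectionEval hpos hs c hw.1 k).hasSum.comp
      (tendsto_eval_pi _ k)).const_mul _).const_mul _)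
  exact le_of_tendsto' h1 (sum_sum_le_of_bound hpos hs c hw hC N)

lemma summable_series (c : TrivializingChart n L) {w : (Fin n → ℂ) × ℂ}
    (hw : w ∈ h.coordDisk c) : Summable fun k : ℕ => fiberWeight n k * (‖w.2‖ ^ (2 * k) *
      ∑' α, ‖c.sectionEval (k + 1) w.1 (s k α)‖ ^ 2) := by
  obtain ⟨C, hC⟩ := h.exists_bound_formEval c hw
  refine summable_of_sum_range_le (fun k => ?_) (sum_le_of_bound hpos hs c hw hC.self_of_nhds)
  have := fiberWeight_pos n k
  have : 0 ≤ ∑' α, ‖c.sectionEval (k + 1) w.1 (s k α)‖ ^ 2 := tsum_nonneg fun _ => by positivity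
  positivity

/-- The series bounds the evaluation of forms. -/
lemma isReproducingBound_series (c : TrivializingChart n L) {w : (Fin n → ℂ) × ℂ}
    (hw : w ∈ h.coordDisk c) : IsReproducingBound h.MemBergmanForm h.formInner (c.formEval w)
      (∑' k : ℕ, fiberWeight n k * (‖w.2‖ ^ (2 * k) *
        ∑' α, ‖c.sectionEval (k + 1) w.1 (s k α)‖ ^ 2)) := by
  have hM : ∀ k, 0 ≤ ∑' α, ‖c.sectionEval (k + 1) w.1 (s k α)‖ ^ 2 := fun k =>
    tsum_nonneg fun _ => by positivity
  have hpos' : ∀ k, 0 ≤ fiberWeight n k * (‖w.2‖ ^ (2 * k) *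
      ∑' α, ‖c.sectionEval (k + 1) w.1 (s k α)‖ ^ 2) := fun k => by
    have := fiberWeight_pos n k
    have := hM k
    positivity
  refine ⟨tsum_nonneg hpos', fun σ hσ => ?_⟩
  obtain ⟨t, ht, hcoeff, hnorm⟩ := exists_sections_of_form hpos hσ
  have hd : DifferentiableOn ℂ (fun ξ => c.formCoeff σ (w.1, ξ))
      (ball 0 (Real.sqrt (h.local_h c w.1))) :=
    (hσ.holomorphic c).differentiableOn.comp (by fun_prop)
      fun ξ hξ => (h.mem_coordDisk_iff_ball _ hw.1 ξ).2 hξ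
  have hsum := (hasSum_taylorCoeff hd ((h.mem_coordDisk_iff_ball _ hw.1 w.2).1 hw)).tendsto_sum_nat
  -- The Taylor series converges at the point itself, so estimating its partial sums is enough.
  refine le_of_tendsto' ((hsum.norm).pow 2) fun N => ?_
  have hip : ∀ k, 0 ≤ (h.sectionInner (t k) (t k)).re := fun k =>
    (isHermitianForm_section hpos (k + 1)).nonneg (ht k)
  calc ‖∑ k ∈ Finset.range N, taylorCoeff (fun ξ => c.formCoeff σ (w.1, ξ)) k * w.2 ^ k‖ ^ 2
      ≤ (∑ k ∈ Finset.range N, ‖c.sectionEval (k + 1) w.1 (t k)‖ * ‖w.2‖ ^ k) ^ 2 := by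
        refine pow_le_pow_left₀ (norm_nonneg _) ((norm_sum_le _ _).trans (le_of_eq ?_)) 2
        refine Finset.sum_congr rfl fun k _ => ?_
        rw [norm_mul, norm_pow, ← hcoeff k c w.1 hw.1]
        rfl
    _ ≤ (∑ k ∈ Finset.range N, fiberWeight n k * (‖w.2‖ ^ (2 * k) *
          ∑' α, ‖c.sectionEval (k + 1) w.1 (s k α)‖ ^ 2)) *
          ∑ k ∈ Finset.range N, (fiberWeight n k)⁻¹ * (h.sectionInner (t k) (t k)).re := by
        -- Weighted Cauchy–Schwarz: c_k goes with the kernel of degree k and its inverse with the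
        -- squared norm of the k-th section.
        refine Finset.sum_sq_le_sum_mul_sum_of_sq_le_mul _ (fun k _ => hpos' k) (fun k _ =>
          mul_nonneg (inv_nonneg.2 (fiberWeight_pos n k).le) (hip k)) fun k _ => ?_
        have h1 := (isReproducingBound_sectionEval hpos hs c hw.1 k).bound (t k) (ht k)
        have h2 := mul_le_mul_of_nonneg_left h1 (pow_nonneg (norm_nonneg w.2) (2 * k))
        have hf := fiberWeight_pos n k
        rw [mul_pow, ← pow_mul, mul_comm k 2]
        field_simp
        linarith
    _ ≤ _ := mul_le_mul ((summable_series hpos hs c hw).sum_le_tsum _ fun k _ => hpos' k)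
        (hnorm N) (Finset.sum_nonneg fun k _ =>
          mul_nonneg (inv_nonneg.2 (fiberWeight_pos n k).le) (hip k)) (tsum_nonneg hpos')

/-- The relation between the kernels in coordinates. -/
lemma hasSum_formEval {ι : Type*} {φ : ι → DualForm n L} (hφ : h.IsFormBasis φ)
    (c : TrivializingChart n L) {w : (Fin n → ℂ) × ℂ} (hw : w ∈ h.coordDisk c) :
    HasSum (fun i => ‖c.formEval w (φ i)‖ ^ 2) (∑' k : ℕ, fiberWeight n k * (‖w.2‖ ^ (2 * k) *
      ∑' α, ‖c.sectionEval (k + 1) w.1 (s k α)‖ ^ 2)) := by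
  have hH := h.isHermitianForm_form
  have hC := isReproducingBound_series hpos hs c hw
  have hsum := hH.summable_of_bound hφ hC
  -- Each of the two numbers is a reproducing bound, and each is the least one; this gives both
  -- inequalities.
  have hle := hsum.tsum_le_of_sum_le (hH.sum_le_of_bound hφ hC)
  have hge := (summable_series hpos hs c hw).tsum_le_of_sum_range_le
    (sum_le_of_bound hpos hs c hw (hH.isReproducingBound_tsum hφ hC))
  rw [← le_antisymm hle hge]
  exact hsum.hasSum

end HermitianMetric
end Geometry

/-! ### From coordinates to the global kernels, and uniform convergence. -/

section Geometry

variable {n : ℕ} {X : Type*} [TopologicalSpace X] [ChartedSpace (Fin n → ℂ) X]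
  {L : X → Type*} [TopologicalSpace (TotalSpace ℂ L)]
  [∀ x, AddCommGroup (L x)] [∀ x, Module ℂ (L x)] [∀ x, TopologicalSpace (L x)]
  [FiberBundle ℂ L] [VectorBundle ℂ ℂ L]

variable [∀ x, IsTopologicalAddGroup (L x)] [∀ x, ContinuousSMul ℂ (L x)]
  [IsManifold 𝓘(ℂ, Fin n → ℂ) ω X] [ContMDiffVectorBundle ω ℂ L 𝓘(ℂ, Fin n → ℂ)]

namespace TrivializingChart

lemma form_eq_smul_coordPair (c : TrivializingChart n L) (σ : DualForm n L) {v : Dual L}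
    (hv : v.proj ∈ c.chart.source) : σ v = c.formEval (c.coordPair v) σ • c.dzdξ v := by
  have key : ∀ w : (Fin n → ℂ) × ℂ, w.1 ∈ c.chart.target → ∀ v, c.param w = v →
      σ v = c.formEval w σ • c.dzdξ v := by
    rintro w hw _ rfl
    exact c.form_eq_smul σ hw
  exact key _ (c.chart.map_source hv) v (c.param_coordPair hv)

lemma wedgeConj_form_apply (c : TrivializingChart n L) (σ : DualForm n L) {v : Dual L}
    (hv : v.proj ∈ c.chart.source)
    (u : Fin (n + 1) ⊕ Fin (n + 1) → TangentSpace (dualModel n) v) :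
    wedgeConj (σ v) (σ v) u =
      ((‖c.formEval (c.coordPair v) σ‖ ^ 2 : ℝ) : ℂ) * wedgeConj (c.dzdξ v) (c.dzdξ v) u := by
  rw [c.form_eq_smul_coordPair σ hv, wedgeConj_smul, Complex.star_def, Complex.mul_conj']
  push_cast
  rfl

end TrivializingChart

namespace HermitianMetric

open TrivializingChart

section Norms

variable (h : HermitianMetric n L)

lemma coordPair_mem_coordDisk (c : TrivializingChart n L) {v : Dual L}
    (hv : v.proj ∈ c.chart.source) (hd : v ∈ h.disk) : c.coordPair v ∈ h.coordDisk c :=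
  ⟨c.chart.map_source hv, by rwa [c.param_coordPair hv]⟩

lemma one_sub_rho (c : TrivializingChart n L) {v : Dual L} (hv : v.proj ∈ c.chart.source) :
    1 - h.rho v = ‖(c.coordPair v).2‖ ^ 2 / h.local_h c (c.coordPair v).1 := by
  have h1 := h.dualNormSq_param c (w := c.coordPair v) (c.chart.map_source hv)
  rw [c.param_coordPair hv] at h1
  rw [rho, sub_sub_cancel, h1]

end Norms

variable {h : HermitianMetric n L} [SecondCountableTopology X] [Nonempty X]
  (hpos : h.IsPositive)
include hpos

/-- The factors |r|^{2k} and |jac|² by which the squared coefficient changes are compensated by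
those of h^k and of (det g)⁻¹. The pointwise norm may thus be computed in any chart. -/
lemma fiberNormSq_eq (c : TrivializingChart n L) {x : X} (hx : x ∈ c.chart.source) {k : ℕ}
    (s : ∀ x, Twisted n L k x) : h.fiberNormSq s x = h.local_h c (c.chart x) ^ k /
      h.detg c (c.chart x) * ‖c.sectionEval k (c.chart x) s‖ ^ 2 := by
  set c₀ := refChart n L x with hc₀
  set z := c₀.chart x with hzdef
  have hx₀ : x ∈ c₀.chart.source := mem_refChart x
  have hsymm : c₀.chart.symm z = x := c₀.chart.left_inv hx₀
  have hz : z ∈ c₀.overlap c := ⟨c₀.chart.map_source hx₀, by rwa [hsymm]⟩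
  have hb : c₀.baseTrans c z = c.chart x := by rw [baseTrans, hsymm]
  have h1 := c₀.sectionCoeff_eq c s hz
  have h2 := h.local_h_baseTrans c₀ c hz
  have h3 := h.detg_baseTrans c₀ c hz
  rw [hb] at h1 h2 h3
  have hG₀ := h.detg_pos hpos c₀ hz.1
  have hG := h.detg_pos hpos c (c.chart.map_source hx)
  have hj : ‖c₀.jac c z‖ ≠ 0 := by
    intro h0
    rw [h3, h0] at hG₀
    simp at hG₀
  change (h.fiberInner c₀ s s z).re = _ / _ * ‖c.sectionCoeff s (c.chart x)‖ ^ 2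
  have h4 : h.fiberInner c₀ s s z =
      ((‖c₀.sectionCoeff s z‖ ^ 2 * h.local_h c₀ z ^ k * (h.detg c₀ z)⁻¹ : ℝ) : ℂ) := by
    rw [fiberInner, Complex.star_def, Complex.mul_conj']
    push_cast
    rfl
  rw [h4, Complex.ofReal_re, h1, h2, h3, norm_mul, norm_mul, norm_pow]
  field_simp
  ring

lemma fiberNormSq_comp_eq {κ : Type*} {k : ℕ} (s : κ → ∀ x, Twisted n L k x)
    (c : TrivializingChart n L) {x : X} (hx : x ∈ c.chart.source) :
    (fun α => h.fiberNormSq (s α) x) = fun α => h.local_h c (c.chart x) ^ k /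
      h.detg c (c.chart x) * ‖c.sectionEval k (c.chart x) (s α)‖ ^ 2 :=
  funext fun α => fiberNormSq_eq hpos c hx (s α)

/-- The terms of the series for the kernel of the disk bundle, in coordinates. -/
lemma series_term_eq {κ : Type*} {k : ℕ} (s : κ → ∀ x, Twisted n L (k + 1) x)
    (c : TrivializingChart n L) {v : Dual L} (hv : v.proj ∈ c.chart.source) :
    ((k : ℝ) + 1) / (2 ^ (n + 1) * Real.pi) * (1 - h.rho v) ^ k * h.bergmanFunction s v.proj =
      h.local_h c (c.coordPair v).1 / h.detg c (c.coordPair v).1 *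
        (fiberWeight n k * (‖(c.coordPair v).2‖ ^ (2 * k) *
          ∑' α, ‖c.sectionEval (k + 1) (c.coordPair v).1 (s α)‖ ^ 2)) := by
  have hH := h.local_h_pos c (c.chart.map_source hv)
  have hG := h.detg_pos hpos c (c.chart.map_source hv)
  rw [bergmanFunction, fiberNormSq_comp_eq hpos s c hv, tsum_mul_left, h.one_sub_rho c hv,
    fiberWeight, div_pow, ← pow_mul]
  change _ * (_ / h.local_h c (c.chart v.proj) ^ k) * _ =
    h.local_h c (c.chart v.proj) / h.detg c (c.chart v.proj) *
      (_ * (_ * ∑' α, ‖c.sectionEval (k + 1) (c.chart v.proj) (s α)‖ ^ 2))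
  field_simp
  ring

lemma canonicalTopForm_apply (v : Dual L)
    (u : Fin (n + 1) ⊕ Fin (n + 1) → TangentSpace (dualModel n) v) :
    h.canonicalTopForm v u = Complex.I ^ ((n + 1) ^ 2) *
      ((h.detg (refChart n L v.proj) ((refChart n L v.proj).chart v.proj) /
        h.local_h (refChart n L v.proj) ((refChart n L v.proj).chart v.proj) : ℝ) : ℂ) *
      wedgeConj ((refChart n L v.proj).dzdξ v) ((refChart n L v.proj).dzdξ v) u := by
  have hH := h.local_h_pos (refChart n L v.proj)
    ((refChart n L v.proj).chart.map_source (mem_refChart v.proj))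
  have h1 : Real.exp (h.weight (refChart n L v.proj) ((refChart n L v.proj).chart v.proj)) =
      (h.local_h (refChart n L v.proj) ((refChart n L v.proj).chart v.proj))⁻¹ := by
    rw [weight, Real.exp_neg, Real.exp_log hH]
  change (_ * _ * _ : ℂ) * _ = _
  rw [h1]
  push_cast
  ring

variable {κ : ℕ → Type*} {s : ∀ k : ℕ, κ k → ∀ x, Twisted n L (k + 1) x}
  (hs : ∀ k, h.IsSectionBasis (s k))
include hs

lemma summable_fiberNormSq (k : ℕ) (x : X) : Summable fun α => h.fiberNormSq (s k α) x := by
  rw [fiberNormSq_comp_eq hpos (s k) _ (mem_refChart x)]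
  exact (summable_sectionEval hpos hs _ ((refChart n L x).chart.map_source (mem_refChart x))
    k).mul_left _

lemma summable_series_bergmanFunction {v : Dual L} (hv : v ∈ h.disk) :
    Summable (fun k : ℕ => ((k : ℝ) + 1) / (2 ^ (n + 1) * Real.pi) * (1 - h.rho v) ^ k *
      h.bergmanFunction (s k) v.proj) := by
  have hx := mem_refChart (n := n) (L := L) v.proj
  simp only [fun k => series_term_eq hpos (s k) _ hx]
  exact (summable_series hpos hs _ (h.coordPair_mem_coordDisk _ hx hv)).mul_left _

/-- The series is dominated by a geometric series, locally on the disk bundle. -/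
lemma exists_summable_bound {v₀ : Dual L} (hv₀ : v₀ ∈ h.disk) :
    ∃ b : ℕ → ℝ, Summable b ∧ ∀ᶠ v in 𝓝 v₀, ∀ k : ℕ,
      ‖((k : ℝ) + 1) / (2 ^ (n + 1) * Real.pi) * (1 - h.rho v) ^ k *
        h.bergmanFunction (s k) v.proj‖ ≤ b k := by
  set c := refChart n L v₀.proj with hc
  have hx : v₀.proj ∈ c.chart.source := mem_refChart v₀.proj
  set w₀ := c.coordPair v₀ with hw₀
  have hd := h.coordPair_mem_coordDisk c hx hv₀
  have hz₀ : w₀.1 ∈ c.chart.target := hd.1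
  have hlt : ‖w₀.2‖ < Real.sqrt (h.local_h c w₀.1) :=
    mem_ball_zero_iff.1 ((h.mem_coordDisk_iff_ball c hz₀ w₀.2).1 hd)
  -- With |ξ| < q < r < R near `v₀`, the k-th term at ξ is at most (q/r)^{2k} times the k-th term at
  -- r. The latter is bounded by the norm of evaluation at (z, r), uniformly for nearby z.
  obtain ⟨r, hr₀, hr⟩ := exists_between hlt
  obtain ⟨q, hq₀, hq⟩ := exists_between hr₀
  have hq0 : 0 ≤ q := (norm_nonneg _).trans hq₀.le
  have hr0 : 0 < r := hq0.trans_lt hq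
  have hrn : ‖(r : ℂ)‖ = r := by rw [Complex.norm_real, Real.norm_of_nonneg hr0.le]
  have hw₁ : (w₀.1, (r : ℂ)) ∈ h.coordDisk c := by
    rw [h.mem_coordDisk_iff_ball c hz₀, mem_ball_zero_iff, hrn]
    exact hr
  obtain ⟨C, hC⟩ := h.exists_bound_formEval c hw₁
  have hcont : ContinuousAt c.coordPair v₀ := (c.contMDiffAt_coordPair hx).continuousAt
  have hcont₁ : Tendsto (fun v => ((c.coordPair v).1, (r : ℂ))) (𝓝 v₀) (𝓝 (w₀.1, (r : ℂ))) :=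
    (hcont.fst).prodMk tendsto_const_nhds
  have hquot : ContinuousAt (fun z => h.local_h c z / h.detg c z) w₀.1 :=
    ((h.continuousOn_local_h c).continuousAt (c.chart.open_target.mem_nhds hz₀)).div
      (h.continuousAt_detg c hz₀) (h.detg_pos hpos c hz₀).ne'
  -- `B` bounds locally the factor h / det g between the series and its coordinate expression.
  obtain ⟨B, hB⟩ : ∃ B, h.local_h c w₀.1 / h.detg c w₀.1 < B := exists_gt _
  refine ⟨fun k => B * (C * ((q / r) ^ 2) ^ k), ?_, ?_⟩
  · refine ((summable_geometric_of_lt_one (by positivity) ?_).mul_left C).mul_left B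
    rw [sq_lt_one_iff₀ (by positivity), div_lt_one hr0]
    exact hq
  · have hproj : ContinuousAt (fun v : Dual L => v.proj) v₀ :=
      (FiberBundle.continuous_proj (ℂ →L[ℂ] ℂ) (fun x : X => L x →L[ℂ] ℂ)).continuousAt
    filter_upwards [hproj.eventually (c.chart.open_source.mem_nhds hx), hcont₁.eventually hC,
      hcont₁.eventually ((h.isOpen_coordDisk c).mem_nhds hw₁),
      (hquot.tendsto.comp hcont.fst).eventually (gt_mem_nhds hB),
      (hcont.snd.norm).eventually (gt_mem_nhds hq₀)] with v hv hvC hvd hvB hvq k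
    have hf := fiberWeight_pos n k
    have hM : 0 ≤ ∑' α, ‖c.sectionEval (k + 1) (c.coordPair v).1 (s k α)‖ ^ 2 :=
      tsum_nonneg fun _ => by positivity
    have hH := h.local_h_pos c (c.chart.map_source hv)
    have hG := h.detg_pos hpos c (c.chart.map_source hv)
    -- All terms are nonnegative, so each one is bounded by the bound for the partial sums.
    have h1 := (Finset.single_le_sum (fun j _ => mul_nonneg (fiberWeight_pos n j).le
      (mul_nonneg (by positivity) (tsum_nonneg fun _ => by positivity)))
      (Finset.self_mem_range_succ k)).trans (sum_le_of_bound hpos hs c hvd hvC (k + 1))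
    simp only [hrn] at h1
    have h2 : ‖(c.coordPair v).2‖ ^ (2 * k) ≤ ((q / r) ^ 2) ^ k * r ^ (2 * k) := by
      rw [← pow_mul, ← mul_pow, div_mul_cancel₀ _ hr0.ne']
      exact pow_le_pow_left₀ (norm_nonneg _) (le_of_lt hvq) _
    have h3 : 0 ≤ h.local_h c (c.coordPair v).1 / h.detg c (c.coordPair v).1 :=
      div_nonneg hH.le hG.le
    rw [series_term_eq hpos (s k) c hv, Real.norm_of_nonneg (by positivity)]
    refine mul_le_mul (le_of_lt hvB) ?_ (by positivity) (h3.trans (le_of_lt hvB))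
    calc _ ≤ fiberWeight n k * (((q / r) ^ 2) ^ k * r ^ (2 * k) *
          ∑' α, ‖c.sectionEval (k + 1) (c.coordPair v).1 (s k α)‖ ^ 2) := by gcongr
      _ = (fiberWeight n k * (r ^ (2 * k) *
          ∑' α, ‖c.sectionEval (k + 1) (c.coordPair v).1 (s k α)‖ ^ 2)) * ((q / r) ^ 2) ^ k := by ring
      _ ≤ C * ((q / r) ^ 2) ^ k := by gcongr

/-- The Weierstrass test gives local uniform convergence, and compactness makes it uniform. -/
lemma tendstoUniformlyOn_series {Z : Set (Dual L)} (hZ : IsCompact Z) (hsub : Z ⊆ h.disk) :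
    TendstoUniformlyOn
      (fun (N : ℕ) v => ∑ k ∈ Finset.range N,
        ((k : ℝ) + 1) / (2 ^ (n + 1) * Real.pi) * (1 - h.rho v) ^ k *
          h.bergmanFunction (s k) v.proj)
      (fun v => ∑' k : ℕ, ((k : ℝ) + 1) / (2 ^ (n + 1) * Real.pi) * (1 - h.rho v) ^ k *
        h.bergmanFunction (s k) v.proj)
      atTop Z := by
  rw [← tendstoLocallyUniformlyOn_iff_tendstoUniformlyOn_of_compact hZ]
  intro U hU v₀ hv₀
  obtain ⟨b, hb, hv⟩ := exists_summable_bound hpos hs (hsub hv₀)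
  obtain ⟨t, ht, htb⟩ := hv.exists_mem
  exact ⟨t, mem_nhdsWithin_of_mem_nhds ht,
    tendstoUniformlyOn_tsum_nat hb (fun k v hv => htb v hv k) U hU⟩

variable {ι : Type*} {φ : ι → DualForm n L} (hφ : h.IsFormBasis φ)
include hφ

lemma hasSum_wedgeConj {v : Dual L} (hv : v ∈ h.disk)
    (u : Fin (n + 1) ⊕ Fin (n + 1) → TangentSpace (dualModel n) v) :
    HasSum (fun i => wedgeConj (φ i v) (φ i v) u)
      (((∑' k : ℕ, fiberWeight n k * (‖((refChart n L v.proj).coordPair v).2‖ ^ (2 * k) *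
        ∑' α, ‖(refChart n L v.proj).sectionEval (k + 1)
          ((refChart n L v.proj).coordPair v).1 (s k α)‖ ^ 2) : ℝ) : ℂ) *
        wedgeConj ((refChart n L v.proj).dzdξ v) ((refChart n L v.proj).dzdξ v) u) := by
  have hx := mem_refChart (n := n) (L := L) v.proj
  have h1 := hasSum_formEval hpos hs hφ _ (h.coordPair_mem_coordDisk _ hx hv)
  simp only [fun i => wedgeConj_form_apply _ (φ i) hx u]
  exact (Complex.hasSum_ofReal.2 h1).mul_right _

/-- The coefficient e^φ det g = det g / h of T cancels the factor h / det g that relates the global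
series to its coordinate form. -/
lemma bergmanKernelForm_eq {v : Dual L} (hv : v ∈ h.disk)
    (u : Fin (n + 1) ⊕ Fin (n + 1) → TangentSpace (dualModel n) v) :
    bergmanKernelForm φ v u =
      ((∑' k : ℕ, ((k : ℝ) + 1) / (2 ^ (n + 1) * Real.pi) * (1 - h.rho v) ^ k *
        h.bergmanFunction (s k) v.proj : ℝ) : ℂ) * h.canonicalTopForm v u := by
  have hx := mem_refChart (n := n) (L := L) v.proj
  have hH := h.local_h_pos _ ((refChart n L v.proj).chart.map_source hx)
  have hG := h.detg_pos hpos _ ((refChart n L v.proj).chart.map_source hx)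
  rw [bergmanKernelForm, (hasSum_wedgeConj hpos hs hφ hv u).tsum_eq, canonicalTopForm_apply hpos]
  simp only [fun k => series_term_eq hpos (s k) _ hx]
  rw [tsum_mul_left]
  have hHG : h.local_h (refChart n L v.proj) ((refChart n L v.proj).coordPair v).1 /
      h.detg (refChart n L v.proj) ((refChart n L v.proj).coordPair v).1 *
      (h.detg (refChart n L v.proj) ((refChart n L v.proj).chart v.proj) /
        h.local_h (refChart n L v.proj) ((refChart n L v.proj).chart v.proj)) = 1 := by
    exact (div_mul_div_cancel₀' hH.ne' _ _).trans (div_self hG.ne')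
  have hHG' := congrArg (fun t : ℝ => (t : ℂ)) hHG
  simp only [Complex.ofReal_mul, Complex.ofReal_one] at hHG'
  rw [Complex.ofReal_mul]
  linear_combination (-(Complex.I ^ ((n + 1) ^ 2)) *
    ((∑' k : ℕ, fiberWeight n k * (‖((refChart n L v.proj).coordPair v).2‖ ^ (2 * k) *
        ∑' α, ‖(refChart n L v.proj).sectionEval (k + 1)
          ((refChart n L v.proj).coordPair v).1 (s k α)‖ ^ 2) : ℝ) : ℂ) *
        wedgeConj ((refChart n L v.proj).dzdξ v) ((refChart n L v.proj).dzdξ v) u) * hHG'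

end HermitianMetric
end Geometry

end DiskBundle

end

theorem mainTheorem8 (n : ℕ) {X : Type*} [TopologicalSpace X] [T2Space X]
    [SecondCountableTopology X] [Nonempty X] [ChartedSpace (Fin n → ℂ) X]
    [IsManifold 𝓘(ℂ, Fin n → ℂ) ω X]
    (L : X → Type*) [TopologicalSpace (TotalSpace ℂ L)]
    [∀ x, AddCommGroup (L x)] [∀ x, Module ℂ (L x)] [∀ x, TopologicalSpace (L x)]
    [∀ x, IsTopologicalAddGroup (L x)] [∀ x, ContinuousSMul ℂ (L x)]
    [FiberBundle ℂ L] [VectorBundle ℂ ℂ L]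
    [ContMDiffVectorBundle ω ℂ L 𝓘(ℂ, Fin n → ℂ)]
    (h : DiskBundle.HermitianMetric n L) (hpos : h.IsPositive)
    {ι : Type*} (φ : ι → DiskBundle.DualForm n L) (hφ : h.IsFormBasis φ)
    {κ : ℕ → Type*} (s : ∀ k : ℕ, κ k → ∀ x, DiskBundle.Twisted n L (k + 1) x)
    (hs : ∀ k, h.IsSectionBasis (s k)) :
    -- the sums defining the two kinds of Bergman kernels converge
    (∀ v ∈ h.disk, ∀ u, Summable fun i => DiskBundle.wedgeConj (φ i v) (φ i v) u) ∧
    (∀ k x, Summable fun α => h.fiberNormSq (s k α) x) ∧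
    -- the relation between the two kinds of Bergman kernels
    (∀ v ∈ h.disk,
      Summable (fun k : ℕ => ((k : ℝ) + 1) / (2 ^ (n + 1) * Real.pi) * (1 - h.rho v) ^ k *
        h.bergmanFunction (s k) v.proj) ∧
      ∀ u, DiskBundle.bergmanKernelForm φ v u =
        ((∑' k : ℕ, ((k : ℝ) + 1) / (2 ^ (n + 1) * Real.pi) * (1 - h.rho v) ^ k *
          h.bergmanFunction (s k) v.proj : ℝ) : ℂ) * h.canonicalTopForm v u) ∧
    -- uniform convergence on compact subsets of the disk bundle
    (∀ Z : Set (DiskBundle.Dual L), IsCompact Z → Z ⊆ h.disk →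
      TendstoUniformlyOn
        (fun (N : ℕ) v => ∑ k ∈ Finset.range N,
          ((k : ℝ) + 1) / (2 ^ (n + 1) * Real.pi) * (1 - h.rho v) ^ k *
            h.bergmanFunction (s k) v.proj)
        (fun v => ∑' k : ℕ, ((k : ℝ) + 1) / (2 ^ (n + 1) * Real.pi) * (1 - h.rho v) ^ k *
          h.bergmanFunction (s k) v.proj)
        atTop Z) := by
  refine ⟨fun v hv u => ?_, fun k x => ?_, fun v hv => ⟨?_, fun u => ?_⟩, fun Z hZ hsub => ?_⟩
  · exact (DiskBundle.HermitianMetric.hasSum_wedgeConj hpos hs hφ hv u).summable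
  · exact DiskBundle.HermitianMetric.summable_fiberNormSq hpos hs k x
  · exact DiskBundle.HermitianMetric.summable_series_bergmanFunction hpos hs hv
  · exact DiskBundle.HermitianMetric.bergmanKernelForm_eq hpos hs hφ hv u
  · exact DiskBundle.HermitianMetric.tendstoUniformlyOn_series hpos hs hZ hsub
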